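/- **Setting.** Let $n\ge 1$, let $\mathcal C_n:=\{y\in\mathbb R^n: y_1>\cdots>y_n\}$, let $\mathfrak S_n\mathcal C_n$ be the set of all vectors obtained by permuting the coordinates of vectors of $\mathcal C_n$ (vectors with distinct entries), and let $\Delta_n(y):=\prod_{i<j}(y_i-y_j)$. Let $\phi_1,\dots,\phi_n:\mathbb R\to\mathbb R$ be measurable and put $\Phi_n(y):=\big(\prod_{k=1}^n\phi_k(y_k)\big)\Delta_n(y)$. Assume that $\Phi_n$ is integrable on $\mathbb R^n$ and that $\det[\phi_i(y_j)]_{i,j=1}^n$ is non-negative for almost every $y\in\mathcal C_n$ and is not almost everywhere zero on $\mathcal C_n$. (Under these assumptions $\det[\phi_i(y^{(n)}_j)]\,dy^{(n)}\cdots dy^{(1)}$ can be normalised to a probability measure on Gelfand–Tsetlin patterns of depth $n$.) Two vectors $z,z'\in\mathfrak S_n\mathcal C_n$ are called interlaced if their decreasing rearrangements $\hat z,\hat z'$ satisfy $\hat z'_1>\hat z_1\ge\hat z'_2>\hat z_2\ge\cdots\ge\hat z'_n>\hat z_n$. Let $M>0$ and $c\in\mathcal C_n$ with $c_1=-M$.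 Let $E\subset(\mathbb R^n)^n$ be the set of $\bar z=(z^{(1)},\dots,z^{(n)})$ such that $z^{(n)}\in[-M,M]^n$; if $z^{(1)}$ has distinct entries then $\hat z^{(1)}_j=c_j$ for $j=2,\dots,n$; and $(z^{(r)},z^{(r+1)})$ is interlaced for $r=1,\dots,n-1$. Let $\xi_n$ be the measure on $(\mathbb R^n)^n$ given by $$d\xi_n[\bar z]=\frac{1}{(n!)^nZ}\,1_E(\bar z)\,\det[\phi_i(\hat z^{(n)}_j)]_{i,j=1}^n\;dz^{(n)}\cdots dz^{(1)},$$ where $Z=Z_{M,c}$ is the normalisation constant. Here $dz^{(r)}$ is Lebesgue measure on $\mathbb R^n$ for $r\ge2$, while on the first level, where on $E$ all but one of the coordinates are frozen at $c_2,\dots,c_n$ in some order, $dz^{(1)}$ denotes Lebesgue measure in the free coordinate times unit point masses in the frozen ones, summed over all orders (equivalently on $E$, the $n$-fold product of the measure $dx+\sum_{j=2}^n\delta_{c_j}$). A configuration $\bar z$ is regarded as the $n^2$ particles $(r,z^{(r)}_j)$, $1\le r,j\le n$, on $\{1,\dots,n\}\times\mathbb R$. Let $\mu$ be the measure on $\{1,\dots,n\}\times\mathbb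 R$ that is Lebesgue measure on each level, plus unit masses at the points $(1,c_j)$, $2\le j\le n$; in particular $\mu$ is counting measure times Lebesgue measure on $\{1,\dots,n\}\times(-M,M)$. The field is called determinantal with correlation kernel $J$ if it is given by a probability measure and, for every $m\le n^2$, the function $\det[J(x_i,x_j)]_{i,j=1}^m$ is $\mu^m$-integrable and its integral with respect to $\mu^m$ over each Borel set $B\subset(\{1,\dots,n\}\times\mathbb R)^m$ equals the (finite) expected number of $m$-tuples of distinct particles lying in $B$. **Proposition.** For all sufficiently large $M$ (uniformly in $c$) one has $Z_{M,c}>0$. Moreover, for every $M>0$ and every $c\in\mathcal C_n$ with $c_1=-M$ and $Z_{M,c}>0$: 1. $B_n^{(M)}:=\int_{[-M,M]^n}\Phi_n(z)\,dz>0$. 2. $\xi_n$ is a probability measure, and the random point field $((\mathbb R^n)^n,\xi_n)$ is determinantal with a correlation kernel $J_n:(\{1,\dots,n\}\times\mathbb R)^2\to\mathbb R$ which satisfies $$\begin{aligned}J_n((r,u),(s,v))&=\frac1{B_n^{(M)}}\int_{\mathfrak S_n\mathcal C_n^{(M)}}dz\,\Phi_n(z)\sum_{j=1}^n1_{v\le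 u<z_j}\frac{(z_j-u)^{n-r-1}}{(n-r-1)!}\,\frac{\partial^{n-s}}{\partial v^{n-s}}\prod_{i\ne j}\Big(\frac{v-z_i}{z_j-z_i}\Big)\\&\quad-\frac1{B_n^{(M)}}\int_{\mathfrak S_n\mathcal C_n^{(M)}}dz\,\Phi_n(z)\sum_{j=1}^n1_{v>u\ge z_j}\frac{(z_j-u)^{n-r-1}}{(n-r-1)!}\,\frac{\partial^{n-s}}{\partial v^{n-s}}\prod_{i\ne j}\Big(\frac{v-z_i}{z_j-z_i}\Big)\end{aligned}$$ for all $r\in\{1,\dots,n-1\}$, $s\in\{1,\dots,n\}$ and $u,v\in(-M,M)$, where $\mathfrak S_n\mathcal C_n^{(M)}$ is the set of all $z\in[-M,M]^n$ with distinct entries; both integrals converge absolutely. -/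

import Mathlib

open MeasureTheory Set
open scoped ENNReal

noncomputable section

namespace InterlacedField

/-! ### Random point fields with finitely many labelled particles -/

/-- The `m`-th factorial moment measure of the particles `X ω i`, `i : ι`: the expected number of
`m`-tuples of particles with pairwise distinct labels that lie in `B`. -/
def factorialMoment {Ω ι S : Type*} [MeasurableSpace Ω] [Fintype ι]
    (P : Measure Ω) (X : Ω → ι → S) (m : ℕ) (B : Set (Fin m → S)) : ℝ≥0∞ :=
  ∫⁻ ω, ∑ f : Fin m ↪ ι, B.indicator (fun _ => (1 : ℝ≥0∞)) (fun k => X ω (f k)) ∂P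

/-- `ρ` is an `m`-th correlation function with respect to the reference measure `μ`. -/
def IsCorrelationFunction {Ω ι S : Type*} [MeasurableSpace Ω] [Fintype ι] [MeasurableSpace S]
    (P : Measure Ω) (X : Ω → ι → S) (μ : Measure S) (m : ℕ) (ρ : (Fin m → S) → ℝ) : Prop :=
  Integrable ρ (Measure.pi fun _ : Fin m => μ) ∧
    ∀ B : Set (Fin m → S), MeasurableSet B →
      factorialMoment P X m B ≠ ∞ ∧
      (factorialMoment P X m B).toReal = ∫ x in B, ρ x ∂(Measure.pi fun _ : Fin m => μ)

/-- The random point field of the particles `X ω i` under the probability measure `P` is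
determinantal with correlation kernel `K` with respect to the reference measure `μ`. -/
def IsDeterminantal {Ω ι S : Type*} [MeasurableSpace Ω] [Fintype ι] [MeasurableSpace S]
    (P : Measure Ω) (X : Ω → ι → S) (μ : Measure S) (K : S → S → ℝ) : Prop :=
  IsProbabilityMeasure P ∧ (∀ i, Measurable fun ω => X ω i) ∧
    ∀ m ≤ Fintype.card ι, IsCorrelationFunction P X μ m
      (fun x => (Matrix.of fun i j => K (x i) (x j)).det)

/-! ### Chambers, interlacing and the Vandermonde product

Levels, particles and functions are numbered by `Fin n`, so that the level, particle or function
called `k` in `{1, …, n}` has index `k - 1`. -/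

/-- `C_n`: strictly decreasing vectors. -/
def chamber (n : ℕ) : Set (Fin n → ℝ) := {y | StrictAnti y}

/-- `[-M, M]^n`. -/
def box (n : ℕ) (M : ℝ) : Set (Fin n → ℝ) := Icc (fun _ => -M) (fun _ => M)

/-- The union of all permutations of `C_n ∩ [-M, M]^n`. -/
def symChamber (n : ℕ) (M : ℝ) : Set (Fin n → ℝ) :=
  {z | ∃ σ : Equiv.Perm (Fin n), z ∘ σ ∈ chamber n ∩ box n M}

/-- The pair `(z, z')` is interlaced: after reordering both vectors decreasingly,
`z'₁ > z₁ ≥ z'₂ > z₂ ≥ ⋯ ≥ z'ₙ > zₙ`. -/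
def Interlaced {n : ℕ} (z z' : Fin n → ℝ) : Prop :=
  ∃ σ τ : Equiv.Perm (Fin n), z ∘ σ ∈ chamber n ∧ z' ∘ τ ∈ chamber n ∧
    (∀ j, z (σ j) < z' (τ j)) ∧
    ∀ (j : Fin n) (h : j.val + 1 < n), z' (τ ⟨j.val + 1, h⟩) ≤ z (σ j)

/-- `Δ_n(y) = ∏_{i < j} (y_i - y_j)`. -/
def vandermondeProd {n : ℕ} (y : Fin n → ℝ) : ℝ := ∏ i, ∏ j ∈ Finset.Ioi i, (y i - y j)

/-- `Φ_n(y) = (∏_k φ_k(y_k)) Δ_n(y)`. -/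
def Phi {n : ℕ} (φ : Fin n → ℝ → ℝ) (y : Fin n → ℝ) : ℝ :=
  (∏ k, φ k (y k)) * vandermondeProd y

/-- `det [φ_i(y_j)]`. -/
def phiDet {n : ℕ} (φ : Fin n → ℝ → ℝ) (y : Fin n → ℝ) : ℝ :=
  (Matrix.of fun i j => φ i (y j)).det

open Classical in
/-- `det [φ_i(y_{σ(j)})]`, where `σ` is the permutation that puts `y` in decreasing order (it is
unique if it exists; the value is `0` if `y` has repeated entries). -/
def sortedPhiDet {n : ℕ} (φ : Fin n → ℝ → ℝ) (y : Fin n → ℝ) : ℝ :=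
  ∑ σ : Equiv.Perm (Fin n), if y ∘ σ ∈ chamber n then phiDet φ (y ∘ σ) else 0

/-- `B_n^{(M)}`. -/
def Bconst {n : ℕ} (φ : Fin n → ℝ → ℝ) (M : ℝ) : ℝ := ∫ z in box n M, Phi φ z

/-! ### The measure `ξ_n` -/

/-- Index of the top level `n`. -/
def topLevel (n : ℕ) [NeZero n] : Fin n := ⟨n - 1, Nat.sub_lt (NeZero.pos n) one_pos⟩

/-- The set `E` of admissible configurations `(z^{(1)}, …, z^{(n)})`. -/
def admissible {n : ℕ} [NeZero n] (M : ℝ) (c : Fin n → ℝ) : Set (Fin n → Fin n → ℝ) :=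
  {z | (∀ j, -M ≤ z (topLevel n) j ∧ z (topLevel n) j ≤ M) ∧
    (∀ τ : Equiv.Perm (Fin n), z 0 ∘ τ ∈ chamber n → ∀ j, j ≠ 0 → z 0 (τ j) = c j) ∧
    ∀ (r : Fin n) (h : r.val + 1 < n), Interlaced (z r) (z ⟨r.val + 1, h⟩)}

/-- Reference measure on a single level: Lebesgue measure, together with unit atoms at
`c_2, …, c_n` on the lowest level, where `n - 1` particles are frozen at these points. -/
def levelMeasure {n : ℕ} [NeZero n] (c : Fin n → ℝ) (r : Fin n) : Measure ℝ :=
  if r = 0 then volume + ∑ j ∈ Finset.univ.erase (0 : Fin n), Measure.dirac (c j) else volume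

/-- Reference measure on `{1, …, n} × ℝ`. -/
def refMeasure {n : ℕ} [NeZero n] (c : Fin n → ℝ) : Measure (Fin n × ℝ) :=
  Measure.sum fun r => (levelMeasure c r).map (Prod.mk r)

/-- The unnormalised measure `1_E det[φ_i(z^{(n)}_{σ(j)})] dz^{(n)} ⋯ dz^{(1)}`. On the levels
above the first, `dz^{(r)}` is Lebesgue measure. On the first level all but one of the coordinates
are frozen on `E`, at `c_2, …, c_n` in some order, and `dz^{(1)}` is Lebesgue measure in the free
coordinate times unit masses in the frozen ones, summed over all the orders; this is the
restriction to `E` of the product of the measures `levelMeasure c 0`. -/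
def xiRaw {n : ℕ} [NeZero n] (φ : Fin n → ℝ → ℝ) (M : ℝ) (c : Fin n → ℝ) :
    Measure (Fin n → Fin n → ℝ) :=
  ((Measure.pi fun r : Fin n => Measure.pi fun _ : Fin n => levelMeasure c r).restrict
    (admissible M c)).withDensity fun z => ENNReal.ofReal (sortedPhiDet φ (z (topLevel n)))

/-- The normalisation constant `Z`. -/
def Zconst {n : ℕ} [NeZero n] (φ : Fin n → ℝ → ℝ) (M : ℝ) (c : Fin n → ℝ) : ℝ≥0∞ :=
  xiRaw φ M c univ / (n.factorial : ℝ≥0∞) ^ n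

/-- The measure `ξ_n`. -/
def xi {n : ℕ} [NeZero n] (φ : Fin n → ℝ → ℝ) (M : ℝ) (c : Fin n → ℝ) :
    Measure (Fin n → Fin n → ℝ) :=
  ((n.factorial : ℝ≥0∞) ^ n * Zconst φ M c)⁻¹ • xiRaw φ M c

/-- The `n²` particles on `{1, …, n} × ℝ` of a configuration in `(ℝ^n)^n`. -/
def particles {n : ℕ} (z : Fin n → Fin n → ℝ) (p : Fin n × Fin n) : Fin n × ℝ :=
  (p.1, z p.1 p.2)

/-! ### The kernel -/

/-- `(z_j - u)^{n-r-1} / (n-r-1)! · ∂^{n-s}/∂v^{n-s} ∏_{i ≠ j} (v - z_i) / (z_j - z_i)`,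
where the levels called `r`, `s` in `{1, …, n}` have indices `r - 1`, `s - 1`. -/
def lagrangeTerm {n : ℕ} (r s : Fin n) (u v : ℝ) (z : Fin n → ℝ) (j : Fin n) : ℝ :=
  (z j - u) ^ (n - (r.val + 1) - 1) / ((n - (r.val + 1) - 1).factorial : ℝ) *
    iteratedDeriv (n - (s.val + 1))
      (fun w => ∏ i ∈ Finset.univ.erase j, (w - z i) / (z j - z i)) v

open Classical in
/-- Integrand of the first term of the kernel. -/
def upperIntegrand {n : ℕ} (φ : Fin n → ℝ → ℝ) (r s : Fin n) (u v : ℝ) (z : Fin n → ℝ) : ℝ :=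
  Phi φ z * ∑ j, if v ≤ u ∧ u < z j then lagrangeTerm r s u v z j else 0

open Classical in
/-- Integrand of the second term of the kernel. -/
def lowerIntegrand {n : ℕ} (φ : Fin n → ℝ → ℝ) (r s : Fin n) (u v : ℝ) (z : Fin n → ℝ) : ℝ :=
  Phi φ z * ∑ j, if u < v ∧ z j ≤ u then lagrangeTerm r s u v z j else 0

end InterlacedField

end

open InterlacedField

/-! ### Integrating out one point of a determinantal density -/

namespace InterlacedField

/-! The proof follows the Eynard–Mehta scheme: write the density as a chain of determinants, find a
kernel that reproduces itself under integration on one level, and then compute that kernel.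

Interlacing is encoded by matrices of zeros and ones: for decreasing `a`, `b` the determinant of
`1_{a i < b j}` is 1 if they interlace and 0 otherwise. Together with a determinant that freezes the
lowest level and the determinant of the `φ i` cut off to `[-M, M]`, this gives a product in which
every level is sorted twice, so the signs of the sorting permutations cancel
(`chainDensity_eq_indicator`). Transporting the start functions `B` up and the end functions down,
and making the latter biorthogonal with the inverse Gram matrix, gives families `A`, `B` and the
kernel `K = -T + ∑ A j ⊗ B j`. A Schur complement shows that the density is a constant multiple of
`det K` (`exists_sign_det_chainKernel`).

The composition rules of `T`, `A`, `B` imply that composing `K` with itself over one level gives `K`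
times a weight that depends only on levels (`IsChain.rep`). Hence integrating out one point on a
level multiplies `det K` by the number of particles there that are still free
(`integral_levelMatrix_det_cons`), and induction yields all correlation functions
(`isDeterminantal_of_density`).

For the explicit formula, on `[-M, M]` the start functions are derivatives of polynomials that form
a basis in degree at most `k = n - 1`. Their determinant is therefore a constant times the
Vandermonde product, and the Gram determinant is the same constant times `Bconst`, so it is
invertible exactly if `Bconst` does not vanish. Cramer's rule and Lagrange interpolation turn `∑ A j
⊗ B j` into an integral against `Phi` over the terms with `u < z j`; the constant cancels, and with
it the dependence on `c`. If `u < v`, the term `-T` is minus the sum of all Lagrange terms, which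
leaves minus those with `z j ≤ u` (`fieldKernel_eq`).

Finally, symmetrising `Phi` gives `n! * Bconst` as the integral of a non-negative function
(`factorial_mul_Bconst`), which settles the positivity of `Bconst` and of the normalisation. -/

/-- Expansion of a determinant along its first row and first column. -/
theorem det_eq_mul_sub_sum_cramer {R : Type*} [CommRing R] {m : ℕ}
    (A : Matrix (Fin (m + 1)) (Fin (m + 1)) R) :
    A.det = A 0 0 * (A.submatrix Fin.succ Fin.succ).det -
      ∑ i, A 0 (Fin.succ i) *
        ((A.submatrix Fin.succ Fin.succ).adjugate.mulVec fun a => A (Fin.succ a) 0) i := by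
  have hminor : ∀ i : Fin m, (A.submatrix Fin.succ (Fin.succAbove i.succ)).det =
      (-1) ^ (i : ℕ) *
        ((A.submatrix Fin.succ Fin.succ).adjugate.mulVec fun a => A (Fin.succ a) 0) i := by
    intro i
    rw [← Matrix.cramer_eq_adjugate_mulVec, Matrix.cramer_apply]
    -- The minor has column `0` in front and lacks column `i.succ`; `cycleRange` moves column `0`
    -- into the vacant place at the cost of `(-1) ^ i`.
    have h := Matrix.det_permute' i.cycleRange (A.submatrix Fin.succ (Fin.succAbove i.succ))
    rw [Fin.sign_cycleRange] at h
    have h2 : (A.submatrix Fin.succ (Fin.succAbove i.succ)).submatrix id i.cycleRange =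
        (A.submatrix Fin.succ Fin.succ).updateCol i fun a => A (Fin.succ a) 0 := by
      ext a j
      simp only [Matrix.submatrix_apply, id, Fin.succAbove_cycleRange, Matrix.updateCol_apply]
      split_ifs with hj
      · subst hj; simp
      · rw [Equiv.swap_apply_of_ne_of_ne (Fin.succ_ne_zero j) (by simpa using hj)]
    rw [h2] at h
    rw [h]
    push_cast
    rw [← mul_assoc, ← pow_add, Even.neg_one_pow ⟨_, rfl⟩, one_mul]
  rw [Matrix.det_succ_row_zero, Fin.sum_univ_succ]
  simp only [Fin.val_zero, pow_zero, one_mul, Fin.succAbove_zero, sub_eq_add_neg,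
    ← Finset.sum_neg_distrib, Fin.val_succ]
  congr 1
  refine Finset.sum_congr rfl fun i _ => ?_
  rw [hminor, pow_succ]
  have : ((-1 : R) ^ (i : ℕ)) * (-1) ^ (i : ℕ) = 1 := by
    rw [← pow_add, Even.neg_one_pow ⟨_, rfl⟩]
  linear_combination (-(A 0 i.succ * ((A.submatrix Fin.succ Fin.succ).adjugate.mulVec
    fun a => A (Fin.succ a) 0) i)) * this

/-- If the kernel reproduces itself up to the weights `β` of the columns and `α` of the rows, then
integrating one point out of the determinant multiplies it by a constant. -/
theorem integral_det_cons {S X : Type*} [MeasurableSpace X] (ν : Measure X) (K : S → S → ℝ)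
    (e : X → S) (α β : S → ℝ) (t : ℝ)
    (htr : Integrable (fun y => K (e y) (e y)) ν) (htr' : ∫ y, K (e y) (e y) ∂ν = t)
    (hrep : ∀ x x', Integrable (fun y => K x (e y) * K (e y) x') ν)
    (hrep' : ∀ x x', ∫ y, K x (e y) * K (e y) x' ∂ν = (β x' - α x) * K x x')
    {m : ℕ} (x : Fin m → S) :
    ∫ y, (Matrix.of fun i j => K ((Fin.cons (e y) x : Fin (m + 1) → S) i)
        ((Fin.cons (e y) x : Fin (m + 1) → S) j)).det ∂ν =
      (t - ∑ i, (β (x i) - α (x i))) * (Matrix.of fun i j => K (x i) (x j)).det := by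
  set A := Matrix.of fun i j => K (x i) (x j) with hA
  have hsub : ∀ y, ((Matrix.of fun i j => K ((Fin.cons (e y) x : Fin (m + 1) → S) i)
        ((Fin.cons (e y) x : Fin (m + 1) → S) j)).submatrix Fin.succ Fin.succ) = A := by
    intro y; ext i j; simp [hA]
  have hexp : ∀ y, (Matrix.of fun i j => K ((Fin.cons (e y) x : Fin (m + 1) → S) i)
        ((Fin.cons (e y) x : Fin (m + 1) → S) j)).det =
      K (e y) (e y) * A.det -
        ∑ i, ∑ a, A.adjugate i a * (K (x a) (e y) * K (e y) (x i)) := by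
    intro y
    rw [det_eq_mul_sub_sum_cramer, hsub]
    simp only [Matrix.of_apply, Fin.cons_zero, Fin.cons_succ, Matrix.mulVec, dotProduct,
      Finset.mul_sum]
    congr 1
    refine Finset.sum_congr rfl fun i _ => Finset.sum_congr rfl fun a _ => ?_
    ring
  have hint : ∀ i a, Integrable (fun y => A.adjugate i a * (K (x a) (e y) * K (e y) (x i))) ν :=
    fun i a => (hrep _ _).const_mul _
  simp_rw [hexp]
  rw [integral_sub (htr.mul_const _) (integrable_finsetSum _ fun i _ =>
    integrable_finsetSum _ fun a _ => hint i a), integral_mul_const, htr',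
    integral_finsetSum _ fun i _ => integrable_finsetSum _ fun a _ => hint i a]
  simp_rw [integral_finsetSum _ fun a _ => hint _ a, integral_const_mul, hrep']
  -- The weights `β` and `α` depend on one of the two indices only, so the other index can be summed
  -- out, by `adj A * A = det A` for `β` and by `A * adj A = det A` for `α`.
  have h1 : ∀ i, ∑ a, A.adjugate i a * (β (x i) * A a i) = β (x i) * A.det := by
    intro i
    have := congrFun (congrFun (Matrix.adjugate_mul A) i) i
    rw [Matrix.mul_apply] at this
    simp only [Matrix.smul_apply, Matrix.one_apply_eq, smul_eq_mul, mul_one] at this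
    rw [← this, Finset.mul_sum]
    exact Finset.sum_congr rfl fun a _ => by ring
  have h2 : ∀ a, ∑ i, A.adjugate i a * (α (x a) * A a i) = α (x a) * A.det := by
    intro a
    have := congrFun (congrFun (Matrix.mul_adjugate A) a) a
    rw [Matrix.mul_apply] at this
    simp only [Matrix.smul_apply, Matrix.one_apply_eq, smul_eq_mul, mul_one] at this
    rw [← this, Finset.mul_sum]
    exact Finset.sum_congr rfl fun i _ => by ring
  have h3 : ∑ i, ∑ a, A.adjugate i a * ((β (x i) - α (x a)) * K (x a) (x i)) =
      ∑ i, (β (x i) - α (x i)) * A.det := by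
    simp_rw [sub_mul, mul_sub, Finset.sum_sub_distrib]
    congr 1
    · exact Finset.sum_congr rfl fun i _ => h1 i
    · rw [Finset.sum_comm]
      exact Finset.sum_congr rfl fun a _ => h2 a
  rw [h3, ← Finset.sum_mul]
  ring

/-! ### Correlation functions of determinantal densities on several levels -/

section Levels

set_option linter.unusedSectionVars false

variable {Q X : Type*} [Fintype Q] [DecidableEq Q] [MeasurableSpace Q]
  [MeasurableSpace X]

/-- The matrix of the values of a kernel at points with prescribed levels. -/
def levelMatrix {ι : Type*} (K : Q × X → Q × X → ℝ) (r : ι → Q) (x : ι → X) : Matrix ι ι ℝ :=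
  Matrix.of fun i j => K (r i, x i) (r j, x j)

/-- A kernel on `Q × X` that reproduces itself, up to weights of rows and columns, when a point is
integrated out on any one level, and has trace `N` on each level. -/
structure IsLevelwiseReproducing (ν : Q → Measure X) (N : ℕ) (K : Q × X → Q × X → ℝ) : Prop where
  measurable : Measurable (Function.uncurry K)
  bound : ∃ a : Q × X → ℝ, (∀ q, Integrable (fun y => a (q, y)) (ν q)) ∧ ∀ x x', |K x x'| ≤ a x
  trace : ∀ q, ∫ y, K (q, y) (q, y) ∂(ν q) = N
  rep : ∃ α β : Q → Q × X → ℝ, (∀ q x, β q x - α q x = if x.1 = q then 1 else 0) ∧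
    ∀ q x x', ∫ y, K x (q, y) * K (q, y) x' ∂(ν q) = (β q x' - α q x) * K x x'

variable {ν : Q → Measure X} [∀ q, SigmaFinite (ν q)] {N : ℕ} {K : Q × X → Q × X → ℝ}

theorem measurable_levelMatrix_det {ι : Type*} [Fintype ι] [DecidableEq ι]
    (hK : Measurable (Function.uncurry K)) (r : ι → Q) :
    Measurable fun x : ι → X => (levelMatrix K r x).det := by
  simp only [Matrix.det_apply', levelMatrix, Matrix.of_apply]
  refine Finset.measurable_sum _ fun σ _ => (Finset.measurable_prod _ fun i _ => ?_).const_mul _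
  have h : Measurable fun x : ι → X => (((r (σ i), x (σ i)), (r i, x i)) : (Q × X) × (Q × X)) := by
    fun_prop
  exact hK.comp h

/-- The bound on the kernel depends on the row alone, so all Leibniz terms are dominated by one and
the same integrable product. -/
theorem integrable_levelMatrix_det {ι : Type*} [Fintype ι] [DecidableEq ι]
    (h : IsLevelwiseReproducing ν N K) (r : ι → Q) :
    Integrable (fun x : ι → X => (levelMatrix K r x).det) (Measure.pi fun i => ν (r i)) := by
  obtain ⟨a, ha, hKa⟩ := h.bound
  have hint : Integrable (fun x : ι → X => ∏ i, a (r i, x i)) (Measure.pi fun i => ν (r i)) :=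
    Integrable.fintype_prod_dep fun i => ha (r i)
  refine (hint.const_mul ((Fintype.card ι).factorial : ℝ)).mono'
    (measurable_levelMatrix_det h.measurable r).aestronglyMeasurable (.of_forall fun x => ?_)
  rw [Matrix.det_apply, Real.norm_eq_abs]
  refine (Finset.abs_sum_le_sum_abs _ _).trans ?_
  have hterm : ∀ σ : Equiv.Perm ι, |Equiv.Perm.sign σ • ∏ i, levelMatrix K r x (σ i) i| ≤
      ∏ i, a (r i, x i) := by
    intro σ
    have h1 : |Equiv.Perm.sign σ • ∏ i, levelMatrix K r x (σ i) i| =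
        ∏ i, |levelMatrix K r x (σ i) i| := by
      rcases Int.units_eq_one_or (Equiv.Perm.sign σ) with hs | hs <;>
        simp [hs, Finset.abs_prod]
    rw [h1]
    calc ∏ i, |levelMatrix K r x (σ i) i| ≤ ∏ i, a (r (σ i), x (σ i)) :=
          Finset.prod_le_prod (fun _ _ => abs_nonneg _) fun i _ => hKa _ _
      _ = ∏ i, a (r i, x i) := Equiv.prod_comp σ fun i => a (r i, x i)
  refine (Finset.sum_le_card_nsmul _ _ _ fun σ _ => hterm σ).trans_eq ?_
  rw [Finset.card_univ, Fintype.card_perm, nsmul_eq_mul]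

/-- The difference `β - α` is the indicator of the level `q`, so the sum of the weights in
`integral_det_cons` counts the points already on that level. -/
theorem integral_levelMatrix_det_cons (h : IsLevelwiseReproducing ν N K) (q : Q) {m : ℕ}
    (r : Fin m → Q) (x : Fin m → X) :
    ∫ y, (levelMatrix K (Fin.cons q r : Fin (m + 1) → Q) (Fin.cons y x : Fin (m + 1) → X)).det
        ∂(ν q) =
      (N - ((Finset.univ.filter fun i => r i = q).card : ℝ)) * (levelMatrix K r x).det := by
  obtain ⟨a, ha, hKa⟩ := h.bound
  obtain ⟨α, β, hαβ, hrep⟩ := h.rep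
  have hmeas : ∀ {Y : Type _} [MeasurableSpace Y] (f g : Y → Q × X), Measurable f → Measurable g →
      Measurable fun y => K (f y) (g y) := fun f g hf hg => h.measurable.comp (hf.prodMk hg)
  have hcons : ∀ y i, (((Fin.cons q r : Fin (m + 1) → Q) i, (Fin.cons y x : Fin (m + 1) → X) i)) =
      (Fin.cons (q, y) (fun i => (r i, x i)) : Fin (m + 1) → Q × X) i := by
    intro y i
    refine Fin.cases ?_ (fun i => ?_) i <;> simp
  have key := integral_det_cons (ν q) K (fun y => (q, y)) (α q) (β q) N
    ((ha q).mono' (hmeas _ _ (by fun_prop) (by fun_prop)).aestronglyMeasurable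
      (.of_forall fun y => hKa _ _)) (h.trace q)
    (fun x x' => (((ha q).const_mul (a x))).mono'
      ((hmeas _ _ (by fun_prop) (by fun_prop)).mul
        (hmeas _ _ (by fun_prop) (by fun_prop))).aestronglyMeasurable
      (.of_forall fun y => by
        rw [norm_mul]
        exact mul_le_mul (hKa _ _) (hKa _ _) (abs_nonneg _) ((abs_nonneg _).trans (hKa x x'))))
    (hrep q) (fun i => (r i, x i))
  simp only [levelMatrix, hcons]
  rw [key]
  congr 2
  simp_rw [hαβ]
  simp

theorem measurePreserving_comp_equiv {ι ι' : Type*} [Fintype ι] [Fintype ι'] (μ : ι' → Measure X)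
    [∀ i, SigmaFinite (μ i)] (e : ι ≃ ι') :
    MeasurePreserving (fun z : ι' → X => z ∘ e) (Measure.pi μ) (Measure.pi fun i => μ (e i)) :=
  (measurePreserving_piCongrLeft (α := fun _ : ι' => X) μ e).symm

/-- The integral of the determinant over all particles but those chosen by `f`. -/
theorem integral_levelMatrix_det_embedding (h : IsLevelwiseReproducing ν N K) (k : ℕ) :
    ∀ {m : ℕ} (_ : m + k = Fintype.card (Q × Fin N)) (f : Fin m ↪ Q × Fin N) (B : Set (Fin m → X))
      (_ : MeasurableSet B),
      ∫ z in {z : Q × Fin N → X | z ∘ f ∈ B}, (levelMatrix K Prod.fst z).det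
          ∂(Measure.pi fun l : Q × Fin N => ν l.1) =
        (∏ q, ((N - (Finset.univ.filter fun i => (f i).1 = q).card).factorial : ℝ)) *
          ∫ x in B, (levelMatrix K (fun i => (f i).1) x).det ∂(Measure.pi fun i => ν (f i).1) := by
  induction k with
  | zero =>
    intro m hm f B hB
    have hbij : Function.Bijective f :=
      (Fintype.bijective_iff_injective_and_card f).2 ⟨f.injective, by simpa using hm⟩
    set e : Fin m ≃ Q × Fin N := Equiv.ofBijective f hbij with he
    have hfe : ∀ i, f i = e i := fun i => rfl
    have hcard : ∀ q, (Finset.univ.filter fun i => (f i).1 = q).card = N := by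
      intro q
      have hinj : Function.Injective fun j : Fin N => e.symm (q, j) := fun a b hab => by
        simpa using hab
      have : (Finset.univ.filter fun i => (f i).1 = q) =
          Finset.univ.image fun j : Fin N => e.symm (q, j) := by
        ext i
        simp only [Finset.mem_filter, Finset.mem_univ, true_and, Finset.mem_image, hfe]
        constructor
        · rintro rfl
          exact ⟨(e i).2, by simp⟩
        · rintro ⟨j, rfl⟩
          simp
      rw [this, Finset.card_image_of_injective _ hinj]; simp
    have hmp := measurePreserving_comp_equiv (fun l : Q × Fin N => ν l.1) e
    have hemb : MeasurableEmbedding (fun z : Q × Fin N → X => z ∘ e) :=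
      (MeasurableEquiv.piCongrLeft (fun _ : Q × Fin N => X) e).symm.measurableEmbedding
    simp only [hcard, Nat.sub_self, Nat.factorial_zero, Nat.cast_one, Finset.prod_const_one, one_mul]
    have := hmp.setIntegral_preimage_emb hemb
      (fun x => (levelMatrix K (fun i => (f i).1) x).det) B
    refine Eq.trans (integral_congr_ae (.of_forall fun z => ?_)) this
    exact (Matrix.det_submatrix_equiv_self e (levelMatrix K Prod.fst z)).symm
  | succ k ih =>
    intro m hm f B hB
    -- The induction goes downwards in the number of fixed particles: fix one more particle `a`, use
    -- the hypothesis, then integrate `a` out.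
    obtain ⟨a, ha⟩ : ∃ a, a ∉ Set.range f := by
      by_contra! hcon
      have := Fintype.card_le_of_surjective f hcon
      simp at this hm
      omega
    let f' : Fin (m + 1) ↪ Q × Fin N := ⟨Fin.cons a f, by
      rw [Fin.cons_injective_iff]; exact ⟨ha, f.injective⟩⟩
    have hf'0 : f' 0 = a := rfl
    have hf's : ∀ i : Fin m, f' i.succ = f i := fun i => rfl
    have hB' : MeasurableSet {x : Fin (m + 1) → X | (fun i : Fin m => x i.succ) ∈ B} :=
      (measurable_pi_lambda _ fun i => measurable_pi_apply _) hB
    have key := ih (by omega) f' _ hB'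
    have hset : {z : Q × Fin N → X | z ∘ f' ∈ {x : Fin (m + 1) → X |
        (fun i : Fin m => x i.succ) ∈ B}} = {z | z ∘ f ∈ B} := rfl
    rw [hset] at key
    rw [key]
    -- split off the additional point
    have hmp := measurePreserving_piFinSuccAbove (α := fun _ : Fin (m + 1) => X)
      (fun i => ν (f' i).1) 0
    have hint := integrable_levelMatrix_det h (fun i => (f' i).1)
    have hcons : ∀ p : X × (Fin m → X),
        (MeasurableEquiv.piFinSuccAbove (fun _ : Fin (m + 1) => X) 0).symm p =
          (Fin.cons p.1 p.2 : Fin (m + 1) → X) := by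
      intro p
      simp [MeasurableEquiv.piFinSuccAbove_symm_apply, Fin.insertNthEquiv]
    have hlev : (fun i => (f' i).1) = (Fin.cons a.1 fun i => (f i).1 : Fin (m + 1) → Q) := by
      ext i
      refine Fin.cases ?_ (fun i => ?_) i
      · simp [hf'0]
      · simp [hf's]
    have hI : ∫ x in {x : Fin (m + 1) → X | (fun i : Fin m => x i.succ) ∈ B},
        (levelMatrix K (fun i => (f' i).1) x).det ∂(Measure.pi fun i => ν (f' i).1) =
        (N - ((Finset.univ.filter fun i => (f i).1 = a.1).card : ℝ)) *
          ∫ x in B, (levelMatrix K (fun i => (f i).1) x).det ∂(Measure.pi fun i => ν (f i).1) := by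
      have hint2 : Integrable (fun p : X × (Fin m → X) =>
          (levelMatrix K (fun i => (f' i).1) (Fin.cons p.1 p.2 : Fin (m + 1) → X)).det)
          ((ν a.1).prod (Measure.pi fun i => ν (f i).1)) := by
        have := (hmp.symm.integrable_comp_emb (MeasurableEquiv.measurableEmbedding _)).2 hint
        refine this.congr (.of_forall fun p => ?_)
        simp only [Function.comp_apply, hcons]
      have e1 := hmp.symm.setIntegral_preimage_emb (MeasurableEquiv.measurableEmbedding _)
        (fun x => (levelMatrix K (fun i => (f' i).1) x).det)
        {x : Fin (m + 1) → X | (fun i : Fin m => x i.succ) ∈ B}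
      rw [← e1]
      have e2 : (MeasurableEquiv.piFinSuccAbove (fun _ : Fin (m + 1) => X) 0).symm ⁻¹'
          {x : Fin (m + 1) → X | (fun i : Fin m => x i.succ) ∈ B} = univ ×ˢ B := by
        ext p
        simp
      rw [e2]
      simp only [hcons]
      change ∫ p in univ ×ˢ B, (levelMatrix K (fun i => (f' i).1)
        (Fin.cons p.1 p.2 : Fin (m + 1) → X)).det
          ∂((ν a.1).prod (Measure.pi fun i => ν (f i).1)) = _
      rw [← Measure.prod_restrict, Measure.restrict_univ, integral_prod_symm]
      · rw [← integral_const_mul]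
        refine integral_congr_ae (.of_forall fun x => ?_)
        simp only [hlev]
        exact integral_levelMatrix_det_cons h a.1 (fun i => (f i).1) x
      · refine hint2.mono_measure ?_
        calc (ν a.1).prod ((Measure.pi fun i => ν (f i).1).restrict B)
            = ((ν a.1).prod (Measure.pi fun i => ν (f i).1)).restrict (univ ×ˢ B) := by
              rw [← Measure.prod_restrict, Measure.restrict_univ]
          _ ≤ _ := Measure.restrict_le_self
    rw [hI, ← mul_assoc]
    congr 1
    have hcard' : ∀ q, (Finset.univ.filter fun i => (f' i).1 = q).card =
        (if a.1 = q then 1 else 0) + (Finset.univ.filter fun i => (f i).1 = q).card := by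
      intro q
      rw [Finset.card_filter, Finset.card_filter, Fin.sum_univ_succ]
      simp [hf'0, hf's]
    have hle : ∀ q, (Finset.univ.filter fun i => (f' i).1 = q).card ≤ N := by
      intro q
      have := Finset.card_le_card_of_injOn (s := Finset.univ.filter fun i => (f' i).1 = q)
        (t := (Finset.univ : Finset (Fin N))) (fun i => (f' i).2) (by simp) (by
          intro i hi j hj hij
          simp only [Finset.coe_filter, Finset.mem_univ, true_and, mem_ofPred_eq] at hi hj
          exact f'.injective (Prod.ext (hi.trans hj.symm) hij))
      simpa using this
    -- Only the factor of the level of `a` changes: with `c` points already there, the integration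
    -- contributes `N - c`, which turns `(N - c - 1)!` into `(N - c)!`.
    rw [← Finset.mul_prod_erase _ _ (Finset.mem_univ a.1),
      ← Finset.mul_prod_erase (Finset.univ : Finset Q)
        (fun q => ((N - (Finset.univ.filter fun i => (f i).1 = q).card).factorial : ℝ))
        (Finset.mem_univ a.1)]
    have h1 : ∏ q ∈ Finset.univ.erase a.1,
        ((N - (Finset.univ.filter fun i => (f' i).1 = q).card).factorial : ℝ) =
        ∏ q ∈ Finset.univ.erase a.1,
        ((N - (Finset.univ.filter fun i => (f i).1 = q).card).factorial : ℝ) := by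
      refine Finset.prod_congr rfl fun q hq => ?_
      rw [hcard', if_neg (Finset.ne_of_mem_erase hq).symm, zero_add]
    rw [h1]
    have h2 := hle a.1
    rw [hcard', if_pos rfl] at h2
    obtain ⟨d, hd⟩ := Nat.exists_eq_add_of_le h2
    set c := (Finset.univ.filter fun i => (f i).1 = a.1).card with hc
    have h3 : N - (1 + c) = d := by omega
    have h4 : N - c = d + 1 := by omega
    have h5 : (N : ℝ) - c = d + 1 := by rw [hd]; push_cast; ring
    rw [hcard', if_pos rfl, h3, h4, h5, Nat.factorial_succ]
    push_cast
    ring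

end Levels

/-! ### Determinantal fields from densities -/

section Levels

set_option linter.unusedSectionVars false

variable {Q X : Type*} [Fintype Q] [DecidableEq Q] [MeasurableSpace Q] [MeasurableSingletonClass Q]
  [MeasurableSpace X]

/-- Embeddings of points with prescribed levels into the labelled particles correspond to families
of embeddings, one for each level. -/
def levelEmbeddingEquiv {m : ℕ} (N : ℕ) (r : Fin m → Q) :
    {f : Fin m ↪ Q × Fin N // (fun i => (f i).1) = r} ≃ (∀ q, {i // r i = q} ↪ Fin N) where
  toFun f q := ⟨fun i => (f.1 i).2, fun i j hij => by
    have hi : (f.1 i).1 = q := (congrFun f.2 i).trans i.2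
    have hj : (f.1 j).1 = q := (congrFun f.2 j).trans j.2
    exact Subtype.ext (f.1.injective (Prod.ext (hi.trans hj.symm) hij))⟩
  invFun g := ⟨⟨fun i => (r i, g (r i) ⟨i, rfl⟩), fun i j hij => by
    have h1 : ∀ (q : Q) (hi : r i = q), g (r i) ⟨i, rfl⟩ = g q ⟨i, hi⟩ := by
      rintro q rfl; rfl
    simp only [Prod.mk.injEq] at hij
    rw [h1 _ hij.1] at hij
    exact congrArg Subtype.val ((g (r j)).injective hij.2)⟩, rfl⟩
  left_inv f := by
    obtain ⟨f, rfl⟩ := f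
    rfl
  right_inv g := by
    funext q
    ext ⟨i, rfl⟩
    rfl

/-- The count factorises over the levels, and a level with `c` points contributes `N! / (N - c)!`
embeddings. -/
theorem card_levelEmbedding_mul {m : ℕ} (N : ℕ) (r : Fin m → Q)
    (hr : ∀ q, (Finset.univ.filter fun i => r i = q).card ≤ N) :
    Fintype.card {f : Fin m ↪ Q × Fin N // (fun i => (f i).1) = r} *
      ∏ q, (N - (Finset.univ.filter fun i => r i = q).card).factorial =
        N.factorial ^ Fintype.card Q := by
  classical
  rw [Fintype.card_congr (levelEmbeddingEquiv N r), Fintype.card_pi, ← Finset.prod_mul_distrib,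
    ← Finset.card_univ, ← Finset.prod_const]
  refine Finset.prod_congr rfl fun q _ => ?_
  rw [Fintype.card_embedding_eq, Fintype.card_fin, Fintype.card_subtype, mul_comm]
  exact Nat.factorial_mul_descFactorial (hr q)

/-- The measure on `Q × X` that is `ν q` on the level `q`. -/
noncomputable def sumLevels (ν : Q → Measure X) : Measure (Q × X) :=
  Measure.sum fun q => (ν q).map (Prod.mk q)

theorem sigmaFinite_sumLevels (ν : Q → Measure X) [∀ q, SigmaFinite (ν q)] :
    SigmaFinite (sumLevels ν) := by
  have h : ∀ q, SigmaFinite ((ν q).map (Prod.mk q)) := fun q =>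
    (measurableEmbedding_prodMk_left q).sigmaFinite_map
  exact inferInstanceAs (SigmaFinite (Measure.sum fun q => (ν q).map (Prod.mk q)))

/-- A power of `sumLevels ν` is the sum over all choices of the levels. -/
theorem pi_sumLevels (ν : Q → Measure X) [∀ q, SigmaFinite (ν q)] (m : ℕ) :
    (Measure.pi fun _ : Fin m => sumLevels ν) =
      ∑ r : Fin m → Q, (Measure.pi fun i => ν (r i)).map fun x i => (r i, x i) := by
  have := sigmaFinite_sumLevels ν
  refine Measure.pi_eq fun s hs => ?_
  have hmap : ∀ r : Fin m → Q, Measurable fun (x : Fin m → X) (i : Fin m) => (r i, x i) :=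
    fun r => by fun_prop
  have hval : ∀ i, sumLevels ν (s i) = ∑ q, ν q (Prod.mk q ⁻¹' s i) := by
    intro i
    rw [sumLevels, Measure.sum_apply _ (hs i), tsum_fintype]
    exact Finset.sum_congr rfl fun q _ => Measure.map_apply measurable_prodMk_left (hs i)
  simp_rw [hval, Finset.prod_univ_sum, Fintype.piFinset_univ]
  rw [Measure.finsetSum_apply]
  refine Finset.sum_congr rfl fun r _ => ?_
  rw [Measure.map_apply (hmap r) (MeasurableSet.univ_pi hs)]
  have : (fun (x : Fin m → X) (i : Fin m) => (r i, x i)) ⁻¹' univ.pi s =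
      univ.pi fun i => Prod.mk (r i) ⁻¹' s i := by
    ext x; simp
  rw [this, Measure.pi_pi]

variable {ν : Q → Measure X} [∀ q, SigmaFinite (ν q)] {N : ℕ} {K : Q × X → Q × X → ℝ}

/-- All embeddings with the same vector of levels contribute the same integral, so the factorial
moment groups by levels. Their number cancels the factorials left by the integration against the
normalisation `N! ^ card Q`. -/
theorem isDeterminantal_of_density {Ω : Type*} [MeasurableSpace Ω] {P : Measure Ω}
    [IsProbabilityMeasure P] (h : IsLevelwiseReproducing ν N K)
    (hvanish : ∀ (m : ℕ) (r : Fin m → Q) (x : Fin m → X) (q : Q),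
      N < (Finset.univ.filter fun i => r i = q).card → (levelMatrix K r x).det = 0)
    {Z : Ω → Q × Fin N → X} (hZ : Measurable Z)
    (hP : ∀ S : Set (Q × Fin N → X), MeasurableSet S → (P (Z ⁻¹' S)).toReal =
      ((N.factorial : ℝ) ^ Fintype.card Q)⁻¹ *
        ∫ z in S, (levelMatrix K Prod.fst z).det ∂(Measure.pi fun l : Q × Fin N => ν l.1)) :
    IsDeterminantal P (fun ω p => (p.1, Z ω p)) (sumLevels ν) K := by
  classical
  refine ⟨inferInstance, fun i => by fun_prop, fun m hm => ?_⟩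
  have hmap : ∀ r : Fin m → Q, Measurable fun (x : Fin m → X) (i : Fin m) => (r i, x i) :=
    fun r => by fun_prop
  have hemb : ∀ r : Fin m → Q, MeasurableEmbedding
      fun (x : Fin m → X) (i : Fin m) => (r i, x i) := by
    intro r
    refine MeasurableEmbedding.of_measurable_inverse (g := fun p i => (p i).2) (hmap r) ?_
      (by fun_prop) (fun x => rfl)
    have : range (fun (x : Fin m → X) (i : Fin m) => (r i, x i)) =
        ⋂ i, {p : Fin m → Q × X | (p i).1 = r i} := by
      ext p
      simp only [mem_range, mem_iInter]
      constructor
      · rintro ⟨x, rfl⟩ i; rfl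
      · intro hp
        exact ⟨fun i => (p i).2, funext fun i => Prod.ext (hp i).symm rfl⟩
    rw [this]
    exact MeasurableSet.iInter fun i =>
      (measurable_fst.comp (measurable_pi_apply i)) (measurableSet_singleton (r i))
  have hintr : ∀ r : Fin m → Q, Integrable
      (fun p : Fin m → Q × X => (Matrix.of fun i j => K (p i) (p j)).det)
      ((Measure.pi fun i => ν (r i)).map fun x i => (r i, x i)) := fun r =>
    (hemb r).integrable_map_iff.2 (integrable_levelMatrix_det h r)
  refine ⟨?_, fun B hB => ?_⟩
  · rw [pi_sumLevels, integrable_finsetSum_measure]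
    exact fun r _ => hintr r
  have hmeasf : ∀ f : Fin m ↪ Q × Fin N,
      Measurable fun ω (k : Fin m) => ((f k).1, Z ω (f k)) := fun f => by fun_prop
  have hfm : factorialMoment P (fun ω p => (p.1, Z ω p)) m B =
      ∑ f : Fin m ↪ Q × Fin N, P ((fun ω (k : Fin m) => ((f k).1, Z ω (f k))) ⁻¹' B) := by
    rw [factorialMoment, lintegral_finsetSum]
    · refine Finset.sum_congr rfl fun f _ => ?_
      rw [← lintegral_indicator_one ((hmeasf f) hB)]
      rfl
    · exact fun f _ => (measurable_const.indicator hB).comp (hmeasf f)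
  have hterm : ∀ f : Fin m ↪ Q × Fin N,
      (P ((fun ω (k : Fin m) => ((f k).1, Z ω (f k))) ⁻¹' B)).toReal =
      ((N.factorial : ℝ) ^ Fintype.card Q)⁻¹ *
        ((∏ q, ((N - (Finset.univ.filter fun i => (f i).1 = q).card).factorial : ℝ)) *
        ∫ x in (fun (x : Fin m → X) (i : Fin m) => ((f i).1, x i)) ⁻¹' B,
          (levelMatrix K (fun i => (f i).1) x).det ∂(Measure.pi fun i => ν (f i).1)) := by
    intro f
    rw [← integral_levelMatrix_det_embedding h (Fintype.card (Q × Fin N) - m) (by omega) f _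
      ((hmap _) hB)]
    have hcomp : Measurable fun (z : Q × Fin N → X) (i : Fin m) => z (f i) := by fun_prop
    exact hP {z | z ∘ f ∈ (fun (x : Fin m → X) (i : Fin m) => ((f i).1, x i)) ⁻¹' B}
      (hcomp ((hmap fun i => (f i).1) hB))
  rw [hfm]
  refine ⟨ENNReal.sum_ne_top.2 fun f _ => measure_ne_top _ _, ?_⟩
  rw [ENNReal.toReal_sum fun f _ => measure_ne_top _ _, pi_sumLevels,
    ← Measure.sum_fintype, Measure.restrict_sum _ hB, Measure.sum_fintype,
    integral_finsetSum_measure fun r _ => (hintr r).integrableOn]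
  rw [← Finset.sum_fiberwise_of_maps_to (g := fun (f : Fin m ↪ Q × Fin N) i => (f i).1)
    (t := Finset.univ) (fun _ _ => Finset.mem_univ _)]
  refine Finset.sum_congr rfl fun r _ => ?_
  rw [(hemb r).setIntegral_map]
  change _ = ∫ x in (fun (x : Fin m → X) (i : Fin m) => (r i, x i)) ⁻¹' B,
          (levelMatrix K r x).det ∂(Measure.pi fun i => ν (r i))
  have hconst : ∀ f ∈ Finset.univ.filter
      (fun f : Fin m ↪ Q × Fin N => (fun i => (f i).1) = r),
      (P ((fun ω (k : Fin m) => ((f k).1, Z ω (f k))) ⁻¹' B)).toReal =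
      ((N.factorial : ℝ) ^ Fintype.card Q)⁻¹ *
        ((∏ q, ((N - (Finset.univ.filter fun i => r i = q).card).factorial : ℝ)) *
        ∫ x in (fun (x : Fin m → X) (i : Fin m) => (r i, x i)) ⁻¹' B,
          (levelMatrix K r x).det ∂(Measure.pi fun i => ν (r i))) := by
    intro f hf
    obtain rfl := (Finset.mem_filter.1 hf).2
    exact hterm f
  rw [Finset.sum_congr rfl hconst, Finset.sum_const, ← Fintype.card_subtype, nsmul_eq_mul]
  by_cases hr : ∀ q, (Finset.univ.filter fun i => r i = q).card ≤ N
  · have hc := card_levelEmbedding_mul N r hr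
    have hc' : (Fintype.card {f : Fin m ↪ Q × Fin N // (fun i => (f i).1) = r} : ℝ) *
      ∏ q, ((N - (Finset.univ.filter fun i => r i = q).card).factorial : ℝ) =
        (N.factorial : ℝ) ^ Fintype.card Q := by exact_mod_cast hc
    have h0 : (N.factorial : ℝ) ^ Fintype.card Q ≠ 0 := by positivity
    rw [mul_left_comm, ← mul_assoc (Fintype.card _ : ℝ), hc', ← mul_assoc, inv_mul_cancel₀ h0,
      one_mul]
  -- With more than `N` points on one level there is no embedding, so the correlation function has
  -- to vanish as well; this is what `hvanish` supplies.
  · push Not at hr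
    obtain ⟨q, hq⟩ := hr
    simp [hvanish m r _ q hq]

end Levels

/-! ### Kernels of chains of determinants -/

section BlockDeterminants

variable {X : Type*}

/-- The kernel built from transitions `T` between the levels and two families of functions. -/
def chainKernel {S V : Type*} [Fintype V] (T : S → S → ℝ) (A B : V → S → ℝ) (x y : S) : ℝ :=
  -T x y + ∑ j, A j x * B j y

/-- The kernel matrix is the Schur complement `-T - A * (-B)` of the identity block. In the block
form the vanishing of `T` becomes usable. -/
theorem det_chainKernel {S V ι : Type*} [Fintype V] [DecidableEq V] [Fintype ι] [DecidableEq ι]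
    (T : S → S → ℝ) (A B : V → S → ℝ) (p : ι → S) :
    (Matrix.of fun i j => chainKernel T A B (p i) (p j)).det =
      (Matrix.fromBlocks 1 (Matrix.of fun v j => -B v (p j)) (Matrix.of fun i v => A v (p i))
        (Matrix.of fun i j => -T (p i) (p j))).det := by
  rw [Matrix.det_fromBlocks_one₁₁]
  congr 1
  ext i j
  simp [chainKernel, Matrix.mul_apply]

/-- A matrix with a zero block that is too large has determinant zero. -/
theorem det_eq_zero_of_zero_block {ι : Type*} [Fintype ι] [DecidableEq ι] (A : Matrix ι ι ℝ)
    (R C : Finset ι) (hA : ∀ i ∈ R, ∀ j ∈ C, A i j = 0) (hcard : Rᶜ.card < C.card) :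
    A.det = 0 := by
  rw [Matrix.det_apply]
  refine Finset.sum_eq_zero fun σ _ => ?_
  obtain ⟨j, hj, hjR⟩ : ∃ j ∈ C, σ j ∈ R := by
    by_contra! hcon
    refine absurd (Finset.card_le_card_of_injOn σ ?_ σ.injective.injOn) (not_le.2 hcard)
    intro j hj
    simpa using hcon j hj
  have h0 : ∏ i, A (σ i) i = 0 := Finset.prod_eq_zero (Finset.mem_univ j) (hA _ hjR _ hj)
  rw [h0, smul_zero]

/-- In the block matrix, the rows of points on levels `≥ q` meet the columns of points on levels `≤
q` in zeros. The remaining rows number `card V` plus the points below `q`, fewer than these columns.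
-/
theorem levelMatrix_chainKernel_det_eq_zero {Q V : Type*} [LinearOrder Q] [Fintype V]
    {T : Q × X → Q × X → ℝ} {A B : V → Q × X → ℝ}
    (hT : ∀ x y, ¬ x.1 < y.1 → T x y = 0) {m : ℕ} (r : Fin m → Q) (x : Fin m → X) (q : Q)
    (hq : Fintype.card V < (Finset.univ.filter fun i => r i = q).card) :
    (levelMatrix (chainKernel T A B) r x).det = 0 := by
  classical
  rw [levelMatrix, det_chainKernel T A B fun i => (r i, x i)]
  refine det_eq_zero_of_zero_block _
    ((Finset.univ.filter fun i => q ≤ r i).map Function.Embedding.inr)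
    ((Finset.univ.filter fun i => r i ≤ q).map Function.Embedding.inr) ?_ ?_
  · intro i hi j hj
    simp only [Finset.mem_map, Finset.mem_filter, Finset.mem_univ, true_and,
      Function.Embedding.inr_apply] at hi hj
    obtain ⟨i, hi, rfl⟩ := hi
    obtain ⟨j, hj, rfl⟩ := hj
    simp [hT _ _ (not_lt.2 (hj.trans hi) : ¬ ((r i, x i) : Q × X).1 < ((r j, x j) : Q × X).1)]
  · rw [Finset.card_compl, Finset.card_map, Finset.card_map, Fintype.card_sum, Fintype.card_fin]
    have h1 : (Finset.univ.filter fun i => r i ≤ q).card =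
        (Finset.univ.filter fun i => r i < q).card + (Finset.univ.filter fun i => r i = q).card := by
      rw [← Finset.card_union_of_disjoint]
      · congr 1
        ext i
        simp [le_iff_lt_or_eq]
      · rw [Finset.disjoint_filter]
        intro i _ h1 h2
        exact absurd h2 h1.ne
    have h2 : (Finset.univ.filter fun i => r i < q).card +
        (Finset.univ.filter fun i => q ≤ r i).card = m := by
      have := Finset.card_filter_add_card_filter_not (s := (Finset.univ : Finset (Fin m)))
        (fun i => r i < q)
      simpa using this
    omega

/-- Rows of the block matrix of a chain: first the block of functions, then the levels. -/
def chainRows (k N : ℕ) : Fin (k + 2) × Fin N ≃ Fin N ⊕ Fin (k + 1) × Fin N where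
  toFun p := Fin.cases (motive := fun _ => Fin N ⊕ Fin (k + 1) × Fin N)
    (Sum.inl p.2) (fun r => Sum.inr (r, p.2)) p.1
  invFun := Sum.elim (fun j => (0, j)) fun q => (q.1.succ, q.2)
  left_inv p := by
    obtain ⟨a, j⟩ := p
    refine Fin.cases ?_ (fun r => ?_) a <;> simp
  right_inv s := by rcases s with j | ⟨r, j⟩ <;> simp

/-- Columns of the block matrix of a chain: first the levels, then the block of functions. -/
def chainCols (k N : ℕ) : Fin (k + 2) × Fin N ≃ Fin N ⊕ Fin (k + 1) × Fin N where
  toFun p := Fin.lastCases (motive := fun _ => Fin N ⊕ Fin (k + 1) × Fin N)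
    (Sum.inl p.2) (fun r => Sum.inr (r, p.2)) p.1
  invFun := Sum.elim (fun j => (Fin.last _, j)) fun q => (q.1.castSucc, q.2)
  left_inv p := by
    obtain ⟨a, j⟩ := p
    refine Fin.lastCases ?_ (fun r => ?_) a <;> simp
  right_inv s := by rcases s with j | ⟨r, j⟩ <;> simp

theorem det_blockTriangular_prod {k N : ℕ}
    (M : Matrix (Fin k × Fin N) (Fin k × Fin N) ℝ) (hM : M.BlockTriangular Prod.fst) :
    M.det = ∏ a, (Matrix.of fun i j => M (a, i) (a, j)).det := by
  rw [hM.det_fintype]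
  refine Finset.prod_congr rfl fun a _ => ?_
  let e : Fin N ≃ {p : Fin k × Fin N // p.1 = a} :=
    { toFun := fun i => ⟨(a, i), rfl⟩
      invFun := fun p => p.1.2
      left_inv := fun i => rfl
      right_inv := by rintro ⟨⟨b, i⟩, rfl⟩; rfl }
  rw [← Matrix.det_submatrix_equiv_self e]
  rfl

/-- With `N` particles on each of the levels `0, …, k`, the determinant of the kernel is, up to a
sign, the product of the determinants along the chain. -/
theorem exists_sign_det_chainKernel (k N : ℕ) :
    ∃ ε : ℝ, ε ≠ 0 ∧ ∀ (T : Fin (k + 1) × X → Fin (k + 1) × X → ℝ)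
      (A B : Fin N → Fin (k + 1) × X → ℝ) (_ : ∀ x y, ¬ x.1 < y.1 → T x y = 0)
      (z : Fin (k + 1) × Fin N → X),
      (Matrix.of fun i j => B i (0, z (0, j))).det *
        (∏ r : Fin k, (Matrix.of fun i j =>
          T (r.castSucc, z (r.castSucc, i)) (r.succ, z (r.succ, j))).det) *
        (Matrix.of fun i j => A i (Fin.last k, z (Fin.last k, j))).det =
      ε * (levelMatrix (chainKernel T A B) Prod.fst z).det := by
  set σ : Equiv.Perm (Fin (k + 2) × Fin N) := (chainCols k N).trans (chainRows k N).symm with hσ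
  -- One factor `(-1) ^ N` for each of the `k + 1` diagonal blocks that carry a minus sign, and the
  -- sign of the shift between the two orderings of the blocks.
  refine ⟨((-1) ^ N) ^ (k + 1) * ((Equiv.Perm.sign σ : ℤ) : ℝ), ?_, fun T A B hT z => ?_⟩
  · rcases Int.units_eq_one_or (Equiv.Perm.sign σ) with h | h <;> simp [h]
  rw [levelMatrix, det_chainKernel T A B fun i => (i.1, z i)]
  set M := Matrix.fromBlocks (1 : Matrix (Fin N) (Fin N) ℝ)
    (Matrix.of fun v j => -B v ((fun i : Fin (k + 1) × Fin N => (i.1, z i)) j))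
    (Matrix.of fun i v => A v ((fun i : Fin (k + 1) × Fin N => (i.1, z i)) i))
    (Matrix.of fun i j => -T ((fun i : Fin (k + 1) × Fin N => (i.1, z i)) i)
      ((fun i : Fin (k + 1) × Fin N => (i.1, z i)) j)) with hM
  have h1 : (M.submatrix (chainRows k N) (chainCols k N)).det =
      ((Equiv.Perm.sign σ : ℤ) : ℝ) * M.det := by
    have := Matrix.det_permute' σ (M.submatrix (chainRows k N) (chainRows k N))
    rw [Matrix.det_submatrix_equiv_self] at this
    rw [← this]
    congr 1
    ext i j
    simp [hσ]
  -- Rows are shifted by one block against columns. The diagonal blocks are then `-B` on level `0`,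
  -- `-T` between neighbouring levels and `A` on level `k`, while below the diagonal only
  -- transitions that do not go up occur, and these vanish.
  have h2 : (M.submatrix (chainRows k N) (chainCols k N)).BlockTriangular Prod.fst := by
    rintro ⟨a, i⟩ ⟨b, j⟩ hab
    change b < a at hab
    induction a using Fin.cases with
    | zero => exact absurd hab (Fin.not_lt_zero b)
    | succ r =>
      induction b using Fin.lastCases with
      | last => exact absurd hab (not_lt.2 (Fin.le_last _))
      | cast s =>
        have : ¬ r < s := by
          rw [Fin.lt_def] at hab ⊢
          simp at hab
          omega
        simp [chainRows, chainCols, hM, hT (r, z (r, i)) (s, z (s, j)) this]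
  rw [mul_assoc (((-1 : ℝ) ^ N) ^ (k + 1)), ← h1, det_blockTriangular_prod _ h2, Fin.prod_univ_succ, Fin.prod_univ_castSucc]
  have hneg : ∀ W : Matrix (Fin N) (Fin N) ℝ, W.det = (-1) ^ N * (-W).det := by
    intro W
    rw [Matrix.det_neg, Fintype.card_fin, ← mul_assoc, ← mul_pow]; simp
  have e0 : (Matrix.of fun i j => B i (0, z (0, j))).det = (-1) ^ N *
      (Matrix.of fun i j => M.submatrix (chainRows k N) (chainCols k N) (0, i) (0, j)).det := by
    rw [hneg]
    congr 2
    ext i j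
    change _ = M (chainRows k N (0, i)) (chainCols k N ((0 : Fin (k + 1)).castSucc, j))
    simp only [chainRows, chainCols, Equiv.coe_fn_mk, Fin.cases_zero, Fin.lastCases_castSucc, hM,
      Matrix.fromBlocks_apply₁₂]
    rfl
  have er : ∀ r : Fin k, (Matrix.of fun i j =>
      T (r.castSucc, z (r.castSucc, i)) (r.succ, z (r.succ, j))).det = (-1) ^ N *
      (Matrix.of fun i j => M.submatrix (chainRows k N) (chainCols k N)
        (r.castSucc.succ, i) (r.castSucc.succ, j)).det := by
    intro r
    rw [hneg]
    congr 2
    ext i j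
    change _ = M (chainRows k N (r.castSucc.succ, i)) (chainCols k N (r.succ.castSucc, j))
    simp only [chainRows, chainCols, Equiv.coe_fn_mk, Fin.cases_succ, Fin.lastCases_castSucc, hM,
      Matrix.fromBlocks_apply₂₂]
    rfl
  have el : (Matrix.of fun i j => A i (Fin.last k, z (Fin.last k, j))).det =
      (Matrix.of fun i j => M.submatrix (chainRows k N) (chainCols k N)
        ((Fin.last k).succ, i) ((Fin.last k).succ, j)).det := by
    rw [← Matrix.det_transpose]
    congr 1
    ext i j
    change _ = M (chainRows k N ((Fin.last k).succ, i)) (chainCols k N (Fin.last (k + 1), j))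
    simp only [chainRows, chainCols, Equiv.coe_fn_mk, Fin.cases_succ, Fin.lastCases_last, hM,
      Matrix.fromBlocks_apply₂₁]
    rfl
  rw [e0, Finset.prod_congr rfl fun r _ => er r, Finset.prod_mul_distrib, Finset.prod_const,
    Finset.card_univ, Fintype.card_fin, el]
  ring

end BlockDeterminants

/-! ### Reproducing property of chain kernels -/

section Reproducing

variable {Q V X : Type*} [LinearOrder Q] [Fintype V] [DecidableEq V] [MeasurableSpace X]

/-- Transitions between levels, together with families of functions that they transport and that
are biorthogonal on each level. -/
structure IsChain (ν : Q → Measure X) (T : Q × X → Q × X → ℝ) (A B : V → Q × X → ℝ) : Prop where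
  zero : ∀ x y, ¬ x.1 < y.1 → T x y = 0
  intTT : ∀ q x x', Integrable (fun y => T x (q, y) * T (q, y) x') (ν q)
  TT : ∀ q x x', ∫ y, T x (q, y) * T (q, y) x' ∂(ν q) =
    if x.1 < q ∧ q < x'.1 then T x x' else 0
  intTA : ∀ q x i, Integrable (fun y => T x (q, y) * A i (q, y)) (ν q)
  TA : ∀ q x i, ∫ y, T x (q, y) * A i (q, y) ∂(ν q) = if x.1 < q then A i x else 0
  intBT : ∀ q x i, Integrable (fun y => B i (q, y) * T (q, y) x) (ν q)
  BT : ∀ q x i, ∫ y, B i (q, y) * T (q, y) x ∂(ν q) = if q < x.1 then B i x else 0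
  intBA : ∀ q i j, Integrable (fun y => B i (q, y) * A j (q, y)) (ν q)
  BA : ∀ q i j, ∫ y, B i (q, y) * A j (q, y) ∂(ν q) = if i = j then 1 else 0

variable {ν : Q → Measure X} {T : Q × X → Q × X → ℝ} {A B : V → Q × X → ℝ}

theorem IsChain.trace (h : IsChain ν T A B) (q : Q) :
    ∫ y, chainKernel T A B (q, y) (q, y) ∂(ν q) = Fintype.card V := by
  have h0 : ∀ y, chainKernel T A B (q, y) (q, y) = ∑ j, B j (q, y) * A j (q, y) := by
    intro y
    rw [chainKernel, h.zero _ _ (lt_irrefl _), neg_zero, zero_add]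
    exact Finset.sum_congr rfl fun j _ => mul_comm _ _
  simp_rw [h0]
  rw [integral_finsetSum _ fun j _ => h.intBA q j j]
  simp [h.BA]

/-- Multiplying out gives four terms. The coefficient of `∑ A j ⊗ B j` is `1 - 1_{x < q} - 1_{q <
x'}` in terms of levels, which is the stated weight. The coefficient of `T` is `1_{x < q < x'}`; it
agrees with minus the weight except if `x' ≤ q ≤ x`, where `T x x'` vanishes. -/
theorem IsChain.rep (h : IsChain ν T A B) (q : Q) (x x' : Q × X) :
    ∫ y, chainKernel T A B x (q, y) * chainKernel T A B (q, y) x' ∂(ν q) =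
      ((if x'.1 ≤ q then 1 else 0) - if x.1 < q then 1 else 0) * chainKernel T A B x x' := by
  have h0 : ∀ y, chainKernel T A B x (q, y) * chainKernel T A B (q, y) x' =
      T x (q, y) * T (q, y) x' - ∑ j, (T x (q, y) * A j (q, y)) * B j x'
      - ∑ i, A i x * (B i (q, y) * T (q, y) x') +
      ∑ i, ∑ j, A i x * B j x' * (B i (q, y) * A j (q, y)) := by
    intro y
    have e1 : ∑ i, ∑ j, A i x * B j x' * (B i (q, y) * A j (q, y)) =
        (∑ i, A i x * B i (q, y)) * ∑ j, A j (q, y) * B j x' := by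
      rw [Finset.sum_mul_sum]
      exact Finset.sum_congr rfl fun i _ => Finset.sum_congr rfl fun j _ => by ring
    have e2 : ∑ j, (T x (q, y) * A j (q, y)) * B j x' =
        T x (q, y) * ∑ j, A j (q, y) * B j x' := by
      rw [Finset.mul_sum]
      exact Finset.sum_congr rfl fun j _ => by ring
    have e3 : ∑ i, A i x * (B i (q, y) * T (q, y) x') =
        (∑ i, A i x * B i (q, y)) * T (q, y) x' := by
      rw [Finset.sum_mul]
      exact Finset.sum_congr rfl fun j _ => by ring
    rw [e1, e2, e3, chainKernel, chainKernel]
    ring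
  have i1 := h.intTT q x x'
  have i2 : Integrable (fun y => ∑ j, (T x (q, y) * A j (q, y)) * B j x') (ν q) :=
    integrable_finsetSum _ fun j _ => (h.intTA q x j).mul_const _
  have i3 : Integrable (fun y => ∑ i, A i x * (B i (q, y) * T (q, y) x')) (ν q) :=
    integrable_finsetSum _ fun j _ => (h.intBT q x' j).const_mul _
  have i4' : ∀ i, Integrable (fun y => ∑ j, A i x * B j x' * (B i (q, y) * A j (q, y))) (ν q) :=
    fun i => integrable_finsetSum _ fun j _ => (h.intBA q i j).const_mul _
  have i4 : Integrable (fun y => ∑ i, ∑ j, A i x * B j x' * (B i (q, y) * A j (q, y))) (ν q) :=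
    integrable_finsetSum _ fun i _ => i4' i
  have i12 : Integrable (fun y => T x (q, y) * T (q, y) x' -
      ∑ j, (T x (q, y) * A j (q, y)) * B j x') (ν q) := i1.sub i2
  have i123 : Integrable (fun y => T x (q, y) * T (q, y) x' -
      ∑ j, (T x (q, y) * A j (q, y)) * B j x' -
      ∑ i, A i x * (B i (q, y) * T (q, y) x')) (ν q) := i12.sub i3
  simp_rw [h0]
  rw [integral_add i123 i4, integral_sub i12 i3, integral_sub i1 i2,
    integral_finsetSum _ fun j _ => (h.intTA q x j).mul_const _,
    integral_finsetSum _ fun j _ => (h.intBT q x' j).const_mul _,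
    integral_finsetSum _ fun i _ => i4' i]
  simp_rw [integral_finsetSum _ fun j _ => (h.intBA q _ j).const_mul _, integral_const_mul,
    integral_mul_const, h.TT, h.TA, h.BT, h.BA]
  simp only [mul_ite, mul_one, mul_zero, Finset.sum_ite_eq, Finset.mem_univ, if_true, chainKernel]
  by_cases h1 : x.1 < q <;> by_cases h2 : q < x'.1
  · simp [h1, h2, not_le.2 h2]; ring
  · simp [h1, h2, not_lt.1 h2]
  · simp [h1, h2, not_le.2 h2]
  · have h3 : T x x' = 0 := h.zero _ _ fun h3 => h2 ((not_lt.1 h1).trans_lt h3)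
    simp [h1, h2, not_lt.1 h2, h3]

theorem IsChain.isLevelwiseReproducing [Fintype Q] [DecidableEq Q]
    [MeasurableSpace Q] (h : IsChain ν T A B)
    (hmeas : Measurable (Function.uncurry (chainKernel T A B)))
    (hbound : ∃ a : Q × X → ℝ, (∀ q, Integrable (fun y => a (q, y)) (ν q)) ∧
      ∀ x x', |chainKernel T A B x x'| ≤ a x) :
    IsLevelwiseReproducing ν (Fintype.card V) (chainKernel T A B) where
  measurable := hmeas
  bound := hbound
  trace := h.trace
  rep := ⟨fun q x => if x.1 < q then 1 else 0, fun q x => if x.1 ≤ q then 1 else 0, fun q x => by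
    rcases lt_trichotomy x.1 q with hx | hx | hx
    · simp [hx, hx.le, hx.ne]
    · simp [hx]
    · simp [hx.not_gt, hx.not_ge, hx.ne'], h.rep⟩

end Reproducing

/-! ### The transitions between the levels -/

/-- The divided power `x ^ a / a!`. -/
noncomputable def dpow (a : ℕ) (x : ℝ) : ℝ := x ^ a / a.factorial

theorem dpow_zero (x : ℝ) : dpow 0 x = 1 := by simp [dpow]

theorem dpow_succ_zero (a : ℕ) : dpow (a + 1) 0 = 0 := by simp [dpow]

theorem hasDerivAt_dpow (a : ℕ) (x : ℝ) : HasDerivAt (dpow (a + 1)) (dpow a x) x := by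
  have h := (hasDerivAt_pow (a + 1) x).div_const ((a + 1).factorial : ℝ)
  convert! h using 1
  rw [dpow, Nat.factorial_succ]
  push_cast
  have : (a.factorial : ℝ) ≠ 0 := by positivity
  have h2 : (a : ℝ) + 1 ≠ 0 := by positivity
  field_simp

theorem continuous_dpow (a : ℕ) : Continuous (dpow a) := by
  unfold dpow; fun_prop

/-- The Beta integral, by integration by parts. Dividing by the factorials removes every constant,
so exponents of composed transitions simply add up, plus one. -/
theorem integral_dpow_mul_dpow (b : ℕ) : ∀ (a : ℕ) (x y : ℝ),
    ∫ w in x..y, dpow a (w - x) * dpow b (y - w) = dpow (a + b + 1) (y - x) := by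
  have hd : ∀ (a : ℕ) (x w : ℝ), HasDerivAt (fun w => dpow (a + 1) (w - x)) (dpow a (w - x)) w := by
    intro a x w
    exact (hasDerivAt_dpow a (w - x)).comp_sub_const w x
  induction b with
  | zero =>
    intro a x y
    simp_rw [dpow_zero, mul_one]
    rw [intervalIntegral.integral_eq_sub_of_hasDerivAt (fun w _ => hd a x w)
      (((continuous_dpow a).comp (by fun_prop)).intervalIntegrable _ _)]
    simp [dpow_succ_zero]
  | succ b ih =>
    intro a x y
    have hu : ∀ w, HasDerivAt (fun w => dpow (b + 1) (y - w)) (-dpow b (y - w)) w := by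
      intro w
      exact (hasDerivAt_dpow b (y - w)).comp_const_sub y w
    have h := intervalIntegral.integral_mul_deriv_eq_deriv_mul (a := x) (b := y)
      (u := fun w => dpow (b + 1) (y - w)) (u' := fun w => -dpow b (y - w))
      (v := fun w => dpow (a + 1) (w - x)) (v' := fun w => dpow a (w - x))
      (fun w _ => hu w) (fun w _ => hd a x w)
      (((continuous_dpow b).comp (by fun_prop)).neg.intervalIntegrable _ _)
      (((continuous_dpow a).comp (by fun_prop)).intervalIntegrable _ _)
    simp only [sub_self, dpow_succ_zero, zero_mul, mul_zero, zero_sub, neg_mul,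
      intervalIntegral.integral_neg, neg_neg] at h
    simp_rw [mul_comm (dpow a _)]
    rw [h]
    simp_rw [mul_comm (dpow b _)]
    rw [ih]
    congr 1
    omega

/-! ### Divided powers cut off to an interval -/

/-- The divided power of `y - x`, cut off to `lo ≤ x < y ≤ hi`. -/
noncomputable def cutPow (lo hi : ℝ) (a : ℕ) (x y : ℝ) : ℝ :=
  if lo ≤ x ∧ x < y ∧ y ≤ hi then dpow a (y - x) else 0

theorem cutPow_of_mem {lo hi x y : ℝ} (a : ℕ) (h1 : lo ≤ x) (h2 : x < y) (h3 : y ≤ hi) :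
    cutPow lo hi a x y = dpow a (y - x) := if_pos ⟨h1, h2, h3⟩

theorem cutPow_of_not_lt {lo hi x y : ℝ} (a : ℕ) (h : y ≤ x) : cutPow lo hi a x y = 0 :=
  if_neg fun h' => absurd h'.2.1 (not_lt.2 h)

theorem measurable_cutPow (lo hi : ℝ) (a : ℕ) :
    Measurable fun p : ℝ × ℝ => cutPow lo hi a p.1 p.2 := by
  unfold cutPow
  refine Measurable.ite ?_ ((continuous_dpow a).measurable.comp (by fun_prop)) measurable_const
  exact (measurableSet_le measurable_const measurable_fst).inter
    ((measurableSet_lt measurable_fst measurable_snd).inter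
      (measurableSet_le measurable_snd measurable_const))

/-- The estimate `x ^ a / a! ≤ exp x` makes the bound uniform in the exponent, hence in the levels.
-/
theorem abs_cutPow_le (lo hi : ℝ) (a : ℕ) (x y : ℝ) :
    |cutPow lo hi a x y| ≤ Real.exp (hi - lo) * (Icc lo hi).indicator 1 x *
      (Icc lo hi).indicator 1 y := by
  unfold cutPow
  split_ifs with h
  · obtain ⟨h1, h2, h3⟩ := h
    rw [indicator_of_mem (show x ∈ Icc lo hi from ⟨h1, (h2.trans_le h3).le⟩),
      indicator_of_mem (show y ∈ Icc lo hi from ⟨(h1.trans_lt h2).le, h3⟩)]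
    simp only [Pi.one_apply, mul_one]
    have h4 : 0 ≤ y - x := by linarith
    rw [abs_of_nonneg (by unfold dpow; positivity)]
    exact (Real.pow_div_factorial_le_exp _ h4 a).trans (Real.exp_le_exp.2 (by linarith))
  · rw [abs_zero]
    have h1 : ∀ w : ℝ, (0 : ℝ) ≤ (Icc lo hi).indicator 1 w := fun w =>
      indicator_nonneg (fun _ _ => zero_le_one) w
    exact mul_nonneg (mul_nonneg (Real.exp_pos _).le (h1 x)) (h1 y)

/-- The cut-off survives composition because an intermediate point with `x < w < y` lies in `[lo,
hi]` as soon as `lo ≤ x` and `y ≤ hi`. -/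
theorem integral_cutPow_mul_cutPow (lo hi : ℝ) (a b : ℕ) (x y : ℝ) :
    ∫ w, cutPow lo hi a x w * cutPow lo hi b w y = cutPow lo hi (a + b + 1) x y := by
  by_cases h : lo ≤ x ∧ x < y ∧ y ≤ hi
  · obtain ⟨h1, h2, h3⟩ := h
    have h0 : ∀ w, cutPow lo hi a x w * cutPow lo hi b w y =
        (Ioo x y).indicator (fun w => dpow a (w - x) * dpow b (y - w)) w := by
      intro w
      by_cases hw : w ∈ Ioo x y
      · rw [indicator_of_mem hw, cutPow_of_mem a h1 hw.1 (hw.2.le.trans h3),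
          cutPow_of_mem b (h1.trans hw.1.le) hw.2 h3]
      · rw [indicator_of_notMem hw]
        simp only [mem_Ioo, not_and_or, not_lt] at hw
        rcases hw with hw | hw
        · rw [cutPow_of_not_lt a hw, zero_mul]
        · rw [cutPow_of_not_lt b hw, mul_zero]
    simp_rw [h0]
    rw [integral_indicator measurableSet_Ioo, ← integral_Ioc_eq_integral_Ioo,
      ← intervalIntegral.integral_of_le h2.le, integral_dpow_mul_dpow, cutPow_of_mem _ h1 h2 h3]
  · have h0 : ∀ w, cutPow lo hi a x w * cutPow lo hi b w y = 0 := by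
      intro w
      unfold cutPow
      split_ifs with h1 h2
      · exact absurd ⟨h1.1, h1.2.1.trans h2.2.1, h2.2.2⟩ h
      all_goals simp
    simp_rw [h0]
    rw [integral_zero, cutPow, if_neg h]

/-! ### Transitions, start functions and end functions of the field -/

variable {k : ℕ}

/-- The transition from level `p.1` to level `q.1`. -/
noncomputable def levelTrans (c : Fin (k + 1) → ℝ) (M : ℝ) (p q : Fin (k + 1) × ℝ) : ℝ :=
  if p.1 < q.1 then cutPow (c (Fin.last k)) M ((q.1 : ℕ) - p.1 - 1) p.2 q.2 else 0

/-- The functions on the levels that start from the lowest level: there, from the indicator of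
`[-M, M]` for `j = 0` and of the point `c j` for `j ≠ 0`. -/
noncomputable def startFun (c : Fin (k + 1) → ℝ) (M : ℝ) (j : Fin (k + 1))
    (p : Fin (k + 1) × ℝ) : ℝ :=
  if p.1 = 0 then
    if j = 0 then (Icc (-M) M).indicator 1 p.2 else if p.2 = c j then 1 else 0
  else cutPow (c (Fin.last k)) M (if j = 0 then (p.1 : ℕ) else (p.1 : ℕ) - 1) (c j) p.2

/-- The functions on the top level. -/
noncomputable def endFun (φ : Fin (k + 1) → ℝ → ℝ) (M : ℝ) (i : Fin (k + 1)) : ℝ → ℝ :=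
  (Icc (-M) M).indicator (φ i)

/-- The functions `endFun` transported down to all levels. -/
noncomputable def backFun (φ : Fin (k + 1) → ℝ → ℝ) (c : Fin (k + 1) → ℝ) (M : ℝ)
    (i : Fin (k + 1)) (p : Fin (k + 1) × ℝ) : ℝ :=
  if p.1 = Fin.last k then endFun φ M i p.2
  else ∫ z, levelTrans c M p (Fin.last k, z) * endFun φ M i z

/-- The matrix of the integrals of the products of `startFun` and `endFun` on the top level. -/
noncomputable def gram (φ : Fin (k + 1) → ℝ → ℝ) (c : Fin (k + 1) → ℝ) (M : ℝ) :
    Matrix (Fin (k + 1)) (Fin (k + 1)) ℝ :=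
  Matrix.of fun j i => ∫ z, startFun c M j (Fin.last k, z) * endFun φ M i z

/-- The functions biorthogonal to `startFun`. -/
noncomputable def dualFun (φ : Fin (k + 1) → ℝ → ℝ) (c : Fin (k + 1) → ℝ) (M : ℝ)
    (j : Fin (k + 1)) (p : Fin (k + 1) × ℝ) : ℝ :=
  ∑ i, backFun φ c M i p * (gram φ c M)⁻¹ i j

theorem measurable_of_levels {n : ℕ} {Y : Type*} [MeasurableSpace Y] {f : (Fin n × ℝ) × Y → ℝ}
    (hf : ∀ r, Measurable fun p : ℝ × Y => f ((r, p.1), p.2)) : Measurable f := by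
  classical
  have h : f = fun p => ∑ r, if p.1.1 = r then f ((r, p.1.2), p.2) else 0 := by
    funext p
    simp
  rw [h]
  refine Finset.measurable_sum _ fun r _ => Measurable.ite ?_ ?_ measurable_const
  · exact (measurable_fst.comp measurable_fst) (measurableSet_singleton r)
  · exact (hf r).comp ((measurable_snd.comp measurable_fst).prodMk measurable_snd)

theorem measurable_levelTrans (c : Fin (k + 1) → ℝ) (M : ℝ) :
    Measurable (Function.uncurry (levelTrans c M)) := by
  refine measurable_of_levels fun r => ?_
  have h2 : Measurable fun p : (Fin (k + 1) × ℝ) × ℝ => levelTrans c M (r, p.2) p.1 := by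
    refine measurable_of_levels fun s => ?_
    simp only [levelTrans]
    split_ifs
    · exact (measurable_cutPow _ _ _).comp (measurable_snd.prodMk measurable_fst)
    · exact measurable_const
  exact h2.comp (measurable_snd.prodMk measurable_fst)

theorem measurable_startFun (c : Fin (k + 1) → ℝ) (M : ℝ) (j : Fin (k + 1)) :
    Measurable (startFun c M j) := by
  have h : Measurable fun p : (Fin (k + 1) × ℝ) × Unit => startFun c M j p.1 := by
    refine measurable_of_levels fun r => ?_
    simp only [startFun]
    split_ifs
    · exact (measurable_one.indicator measurableSet_Icc).comp measurable_fst
    · exact Measurable.ite (measurable_fst (measurableSet_singleton _)) measurable_const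
        measurable_const
    all_goals exact (measurable_cutPow _ _ _).comp (measurable_const.prodMk measurable_fst)
  exact h.comp (measurable_id.prodMk (measurable_const (a := ())))

theorem measurable_endFun {φ : Fin (k + 1) → ℝ → ℝ} (hφ : ∀ i, Measurable (φ i)) (M : ℝ)
    (i : Fin (k + 1)) : Measurable (endFun φ M i) :=
  (hφ i).indicator measurableSet_Icc

theorem measurable_backFun {φ : Fin (k + 1) → ℝ → ℝ} (hφ : ∀ i, Measurable (φ i))
    (c : Fin (k + 1) → ℝ) (M : ℝ) (i : Fin (k + 1)) : Measurable (backFun φ c M i) := by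
  unfold backFun
  refine Measurable.ite (measurable_fst (measurableSet_singleton _))
    ((measurable_endFun hφ M i).comp measurable_snd) ?_
  have h : Measurable fun p : (Fin (k + 1) × ℝ) × ℝ =>
      levelTrans c M p.1 (Fin.last k, p.2) * endFun φ M i p.2 :=
    ((measurable_levelTrans c M).comp
      (f := fun p : (Fin (k + 1) × ℝ) × ℝ => (p.1, ((Fin.last k, p.2) : Fin (k + 1) × ℝ)))
      (by fun_prop)).mul ((measurable_endFun hφ M i).comp measurable_snd)
  exact h.stronglyMeasurable.integral_prod_right'.measurable

theorem measurable_dualFun {φ : Fin (k + 1) → ℝ → ℝ} (hφ : ∀ i, Measurable (φ i))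
    (c : Fin (k + 1) → ℝ) (M : ℝ) (j : Fin (k + 1)) : Measurable (dualFun φ c M j) :=
  Finset.measurable_sum _ fun i _ => (measurable_backFun hφ c M i).mul_const _

theorem levelTrans_of_not_lt (c : Fin (k + 1) → ℝ) (M : ℝ) (p q : Fin (k + 1) × ℝ)
    (h : ¬ p.1 < q.1) : levelTrans c M p q = 0 := if_neg h

/-- The indicator function of the interval `[c_n, M]` that contains all particles. -/
noncomputable def rangeInd (c : Fin (k + 1) → ℝ) (M : ℝ) : ℝ → ℝ :=
  (Icc (c (Fin.last k)) M).indicator 1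

theorem rangeInd_nonneg (c : Fin (k + 1) → ℝ) (M x : ℝ) : 0 ≤ rangeInd c M x :=
  indicator_nonneg (fun _ _ => zero_le_one) x

theorem rangeInd_le_one (c : Fin (k + 1) → ℝ) (M x : ℝ) : rangeInd c M x ≤ 1 :=
  indicator_le_self' (fun _ _ => zero_le_one) x

theorem abs_levelTrans_le (c : Fin (k + 1) → ℝ) (M : ℝ) (p q : Fin (k + 1) × ℝ) :
    |levelTrans c M p q| ≤ Real.exp (M - c (Fin.last k)) * rangeInd c M p.2 * rangeInd c M q.2 := by
  unfold levelTrans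
  split_ifs with h
  · exact abs_cutPow_le _ _ _ _ _
  · rw [abs_zero]
    exact mul_nonneg (mul_nonneg (Real.exp_pos _).le (rangeInd_nonneg _ _ _)) (rangeInd_nonneg _ _ _)

theorem chamber_last_le {c : Fin (k + 1) → ℝ} (hc : c ∈ chamber (k + 1)) (j : Fin (k + 1)) :
    c (Fin.last k) ≤ c j := hc.antitone (Fin.le_last j)

theorem chamber_le_zero {c : Fin (k + 1) → ℝ} (hc : c ∈ chamber (k + 1)) (j : Fin (k + 1)) :
    c j ≤ c 0 := hc.antitone (Fin.zero_le j)

theorem abs_startFun_le {c : Fin (k + 1) → ℝ} {M : ℝ} (hM : 0 < M) (hc : c ∈ chamber (k + 1))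
    (hc0 : c 0 = -M) (j : Fin (k + 1)) (p : Fin (k + 1) × ℝ) :
    |startFun c M j p| ≤ Real.exp (M - c (Fin.last k)) * rangeInd c M p.2 := by
  have h1 := chamber_last_le hc 0
  have h2 := chamber_le_zero hc j
  have hexp : 1 ≤ Real.exp (M - c (Fin.last k)) := Real.one_le_exp (by linarith)
  have hpos : 0 ≤ Real.exp (M - c (Fin.last k)) * rangeInd c M p.2 :=
    mul_nonneg (Real.exp_pos _).le (rangeInd_nonneg _ _ _)
  unfold startFun
  split_ifs with h3 h4 h5
  · by_cases hp : p.2 ∈ Icc (-M) M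
    · rw [indicator_of_mem hp, rangeInd,
        indicator_of_mem (show p.2 ∈ Icc (c (Fin.last k)) M from ⟨by linarith [hp.1], hp.2⟩)]
      simpa using hexp
    · rwa [indicator_of_notMem hp, abs_zero]
  · rw [rangeInd, indicator_of_mem
      (show p.2 ∈ Icc (c (Fin.last k)) M from ⟨h5 ▸ chamber_last_le hc j, by linarith⟩)]
    simpa using hexp
  · rwa [abs_zero]
  all_goals
    refine (abs_cutPow_le _ _ _ _ _).trans ?_
    refine mul_le_mul_of_nonneg_right ?_ (rangeInd_nonneg _ _ _)
    exact mul_le_of_le_one_right (Real.exp_pos _).le (rangeInd_le_one _ _ _)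

/-! ### The transitions form a chain -/

variable {φ : Fin (k + 1) → ℝ → ℝ} {c : Fin (k + 1) → ℝ} {M : ℝ}

theorem levelMeasure_of_ne_zero (c : Fin (k + 1) → ℝ) {q : Fin (k + 1)} (hq : q ≠ 0) :
    levelMeasure c q = volume := if_neg hq

theorem levelMeasure_zero (c : Fin (k + 1) → ℝ) : levelMeasure c 0 =
    volume + ∑ j ∈ Finset.univ.erase (0 : Fin (k + 1)), Measure.dirac (c j) := if_pos rfl

/-- For `k = 0` the top level is also the lowest one, but then there are no frozen particles and
hence no atoms. -/
theorem levelMeasure_last (c : Fin (k + 1) → ℝ) : levelMeasure c (Fin.last k) = volume := by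
  rcases k with _ | k
  · have : (Finset.univ.erase (0 : Fin (0 + 1))) = ∅ := rfl
    rw [show Fin.last 0 = (0 : Fin (0 + 1)) from rfl, levelMeasure_zero, this, Finset.sum_empty,
      add_zero]
  · exact levelMeasure_of_ne_zero c (Fin.last_pos.ne')

instance sigmaFinite_levelMeasure (c : Fin (k + 1) → ℝ) (q : Fin (k + 1)) :
    SigmaFinite (levelMeasure c q) := by
  unfold levelMeasure
  split_ifs
  · infer_instance
  · infer_instance

theorem integrable_rangeInd (c : Fin (k + 1) → ℝ) (M : ℝ) (q : Fin (k + 1)) :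
    Integrable (rangeInd c M) (levelMeasure c q) := by
  refine (integrable_indicator_iff measurableSet_Icc).2 (integrableOn_const ?_)
  unfold levelMeasure
  split_ifs
  · rw [Measure.add_apply, Measure.finsetSum_apply]
    exact ENNReal.add_ne_top.2 ⟨by simp, measure_ne_top
      (∑ j ∈ Finset.univ.erase (0 : Fin (k + 1)), Measure.dirac (c j)) _ |> fun h => by
        rwa [Measure.finsetSum_apply] at h⟩
  · simp

theorem integrable_of_le_rangeInd {q : Fin (k + 1)} {f : ℝ → ℝ} (hf : Measurable f) {C : ℝ}
    (h : ∀ x, |f x| ≤ C * rangeInd c M x) : Integrable f (levelMeasure c q) :=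
  ((integrable_rangeInd c M q).const_mul C).mono' hf.aestronglyMeasurable (.of_forall h)

theorem integral_levelMeasure_zero {f : ℝ → ℝ} (hf : Integrable f (levelMeasure c 0)) :
    ∫ x, f x ∂(levelMeasure c 0) =
      (∫ x, f x) + ∑ j ∈ Finset.univ.erase (0 : Fin (k + 1)), f (c j) := by
  rw [levelMeasure_zero] at hf ⊢
  have h := integrable_add_measure.1 hf
  rw [integral_add_measure h.1 h.2, integral_finsetSum_measure]
  · simp [integral_dirac]
  · exact fun j hj => (integrable_finsetSum_measure.1 h.2) j hj

theorem measurable_levelTrans_left (p : Fin (k + 1) × ℝ) (q : Fin (k + 1)) :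
    Measurable fun y => levelTrans c M p (q, y) :=
  (measurable_levelTrans c M).comp (measurable_const.prodMk (measurable_const.prodMk measurable_id))

theorem measurable_levelTrans_right (p : Fin (k + 1) × ℝ) (q : Fin (k + 1)) :
    Measurable fun y => levelTrans c M (q, y) p :=
  (measurable_levelTrans c M).comp ((measurable_const.prodMk measurable_id).prodMk measurable_const)

theorem abs_levelTrans_le_left (p q : Fin (k + 1) × ℝ) :
    |levelTrans c M p q| ≤ Real.exp (M - c (Fin.last k)) * rangeInd c M p.2 :=
  (abs_levelTrans_le c M p q).trans (mul_le_of_le_one_right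
    (mul_nonneg (Real.exp_pos _).le (rangeInd_nonneg _ _ _)) (rangeInd_le_one _ _ _))

theorem abs_levelTrans_le_right (p q : Fin (k + 1) × ℝ) :
    |levelTrans c M p q| ≤ Real.exp (M - c (Fin.last k)) * rangeInd c M q.2 := by
  refine (abs_levelTrans_le c M p q).trans ?_
  refine mul_le_mul_of_nonneg_right ?_ (rangeInd_nonneg _ _ _)
  exact mul_le_of_le_one_right (Real.exp_pos _).le (rangeInd_le_one _ _ _)

theorem abs_levelTrans_le_exp (p q : Fin (k + 1) × ℝ) :
    |levelTrans c M p q| ≤ Real.exp (M - c (Fin.last k)) :=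
  (abs_levelTrans_le_left p q).trans
    (mul_le_of_le_one_right (Real.exp_pos _).le (rangeInd_le_one _ _ _))

theorem integrable_levelTrans_mul {q : Fin (k + 1)} (p : Fin (k + 1) × ℝ) {f : ℝ → ℝ}
    (hf : Integrable f (levelMeasure c q)) :
    Integrable (fun y => levelTrans c M p (q, y) * f y) (levelMeasure c q) :=
  hf.bdd_mul (measurable_levelTrans_left p q).aestronglyMeasurable
    (.of_forall fun _ => abs_levelTrans_le_exp _ _)

theorem integrable_mul_levelTrans {q : Fin (k + 1)} (p : Fin (k + 1) × ℝ) {f : ℝ → ℝ}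
    (hf : Integrable f (levelMeasure c q)) :
    Integrable (fun y => f y * levelTrans c M (q, y) p) (levelMeasure c q) :=
  hf.mul_bdd (measurable_levelTrans_right p q).aestronglyMeasurable
    (.of_forall fun _ => abs_levelTrans_le_exp _ _)

theorem measurable_startFun_level (j q : Fin (k + 1)) :
    Measurable fun y => startFun c M j (q, y) :=
  (measurable_startFun c M j).comp (measurable_const.prodMk measurable_id)

theorem integrable_startFun (hM : 0 < M) (hc : c ∈ chamber (k + 1)) (hc0 : c 0 = -M)
    (j q : Fin (k + 1)) : Integrable (fun y => startFun c M j (q, y)) (levelMeasure c q) :=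
  integrable_of_le_rangeInd (measurable_startFun_level j q) fun y => abs_startFun_le hM hc hc0 j (q, y)

theorem integral_levelTrans_mul_levelTrans (q : Fin (k + 1)) (x x' : Fin (k + 1) × ℝ) :
    ∫ y, levelTrans c M x (q, y) * levelTrans c M (q, y) x' ∂(levelMeasure c q) =
      if x.1 < q ∧ q < x'.1 then levelTrans c M x x' else 0 := by
  split_ifs with h
  · rw [levelMeasure_of_ne_zero c (Fin.pos_of_ne_zero (fun h0 => by
      rw [h0] at h; exact absurd h.1 (Fin.not_lt_zero _))).ne']
    simp only [levelTrans, if_pos h.1, if_pos h.2, if_pos (h.1.trans h.2)]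
    rw [integral_cutPow_mul_cutPow]
    congr 1
    have h1 := h.1
    have h2 := h.2
    rw [Fin.lt_def] at h1 h2
    omega
  · rw [not_and_or] at h
    have h0 : ∀ y, levelTrans c M x (q, y) * levelTrans c M (q, y) x' = 0 := by
      intro y
      rcases h with h | h
      · rw [levelTrans_of_not_lt c M x (q, y) h, zero_mul]
      · rw [levelTrans_of_not_lt c M (q, y) x' h, mul_zero]
    simp [h0]

/-- From the atom at `c j`, `j ≠ 0`, level `q` is reached with exponent `q - 1`. The function with
`j = 0` starts from Lebesgue measure on `[-M, M]`, and integrating it from `c 0 = -M` raises the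
exponent by one. -/
theorem integral_startFun_mul_levelTrans (hM : 0 < M) (hc : c ∈ chamber (k + 1)) (hc0 : c 0 = -M)
    (q : Fin (k + 1)) (x : Fin (k + 1) × ℝ) (j : Fin (k + 1)) :
    ∫ y, startFun c M j (q, y) * levelTrans c M (q, y) x ∂(levelMeasure c q) =
      if q < x.1 then startFun c M j x else 0 := by
  split_ifs with h
  swap
  · have h0 : ∀ y, startFun c M j (q, y) * levelTrans c M (q, y) x = 0 := fun y => by
      rw [levelTrans_of_not_lt c M (q, y) x h, mul_zero]
    simp [h0]
  have hx0 : x.1 ≠ 0 := fun h0 => absurd (h0 ▸ h) (Fin.not_lt_zero _)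
  have hq' := Fin.lt_def.1 h
  by_cases hq : q = 0
  · subst hq
    rw [integral_levelMeasure_zero (integrable_mul_levelTrans x (integrable_startFun hM hc hc0 j 0))]
    by_cases hj : j = 0
    · subst hj
      have hsum : ∑ i ∈ Finset.univ.erase (0 : Fin (k + 1)),
          startFun c M 0 (0, c i) * levelTrans c M (0, c i) x = 0 := by
        refine Finset.sum_eq_zero fun i hi => ?_
        have h1 : c i < c 0 := hc (Fin.pos_of_ne_zero (Finset.ne_of_mem_erase hi))
        have h2 : c i ∉ Icc (-M) M := fun h2 => absurd h2.1 (not_le.2 (hc0 ▸ h1))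
        simp [startFun, indicator_of_notMem h2]
      rw [hsum, add_zero]
      -- Up to the null set `{-M}`, the indicator of `[-M, M]` is the cut-off power of exponent `0`
      -- that starts at `c 0 = -M`, so the composition rule for cut-off powers applies.
      have hae : (fun y => startFun c M 0 (0, y) * levelTrans c M (0, y) x) =ᵐ[volume]
          fun y => cutPow (c (Fin.last k)) M 0 (c 0) y *
            cutPow (c (Fin.last k)) M ((x.1 : ℕ) - (0 : Fin (k + 1)) - 1) y x.2 := by
        filter_upwards [Measure.ae_ne volume (-M)] with y hy
        simp only [startFun, if_true, levelTrans, if_pos h]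
        congr 1
        by_cases hy' : y ∈ Icc (-M) M
        · rw [indicator_of_mem hy', cutPow_of_mem _ (chamber_last_le hc 0)
            (hc0 ▸ lt_of_le_of_ne hy'.1 (Ne.symm hy)) hy'.2, dpow_zero, Pi.one_apply]
        · rw [indicator_of_notMem hy', cutPow, if_neg]
          exact fun h' => hy' ⟨hc0 ▸ h'.2.1.le, h'.2.2⟩
      rw [integral_congr_ae hae, integral_cutPow_mul_cutPow]
      simp only [startFun, if_neg hx0, if_true]
      congr 1
      simp only [Fin.val_zero] at hq' ⊢
      omega
    · have hvol : ∫ y, startFun c M j (0, y) * levelTrans c M (0, y) x = 0 := by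
        refine integral_eq_zero_of_ae ?_
        filter_upwards [Measure.ae_ne volume (c j)] with y hy
        simp [startFun, hj, hy]
      rw [hvol, zero_add, Finset.sum_eq_single_of_mem j (by simp [hj])]
      · simp [startFun, hj, hx0, levelTrans, h]
      · intro i _ hij
        have : c i ≠ c j := fun h => hij (hc.injective h)
        simp [startFun, hj, this]
  · rw [levelMeasure_of_ne_zero c hq]
    simp only [startFun, if_neg hq, if_neg hx0, levelTrans, if_pos h]
    rw [integral_cutPow_mul_cutPow]
    congr 1
    have : 0 < (q : ℕ) := Nat.pos_of_ne_zero fun h0 => hq (Fin.ext h0)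
    split_ifs <;> omega

theorem integrable_mul_levelTrans_mul {q : Fin (k + 1)} {f g : ℝ → ℝ} (hf : Measurable f)
    {C : ℝ} (hfC : ∀ y, |f y| ≤ C * rangeInd c M y) (hg : Integrable g) :
    Integrable (fun p : ℝ × ℝ => f p.1 * levelTrans c M (q, p.1) (Fin.last k, p.2) * g p.2)
      ((levelMeasure c q).prod volume) := by
  have h1 : Integrable (fun p : ℝ × ℝ => f p.1 * g p.2) ((levelMeasure c q).prod volume) :=
    (integrable_of_le_rangeInd hf hfC).mul_prod hg
  have h2 : Measurable fun p : ℝ × ℝ => levelTrans c M (q, p.1) (Fin.last k, p.2) :=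
    (measurable_levelTrans c M).comp ((measurable_const.prodMk measurable_fst).prodMk
      (measurable_const.prodMk measurable_snd))
  refine (h1.bdd_mul h2.aestronglyMeasurable
    (.of_forall fun _ => abs_levelTrans_le_exp _ _)).congr (.of_forall fun p => ?_)
  simp only
  ring

/-- Fubini's theorem for a function on a level that is transported to the top level. -/
theorem integral_mul_backFun (hφM : ∀ i, Integrable (endFun φ M i))
    {q : Fin (k + 1)} (hq : q ≠ Fin.last k) {f : ℝ → ℝ} (hf : Measurable f) {C : ℝ}
    (hfC : ∀ y, |f y| ≤ C * rangeInd c M y) (i : Fin (k + 1)) :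
    ∫ y, f y * backFun φ c M i (q, y) ∂(levelMeasure c q) =
      ∫ z, (∫ y, f y * levelTrans c M (q, y) (Fin.last k, z) ∂(levelMeasure c q)) *
        endFun φ M i z := by
  simp only [backFun, if_neg hq, ← integral_const_mul, ← integral_mul_const]
  refine Eq.trans ?_ (integral_integral_swap (integrable_mul_levelTrans_mul hf hfC (hφM i)))
  simp only [mul_assoc]

theorem measurable_backFun_level (hφ : ∀ i, Measurable (φ i)) (i q : Fin (k + 1)) :
    Measurable fun y => backFun φ c M i (q, y) :=
  (measurable_backFun hφ c M i).comp (measurable_const.prodMk measurable_id)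

/-- Below the top level the end function has been integrated against a bounded transition. On the
top level it is only integrable. -/
theorem abs_backFun_le (hφM : ∀ i, Integrable (endFun φ M i)) (i : Fin (k + 1))
    {p : Fin (k + 1) × ℝ} (hp : p.1 ≠ Fin.last k) :
    |backFun φ c M i p| ≤
      Real.exp (M - c (Fin.last k)) * (∫ z, |endFun φ M i z|) * rangeInd c M p.2 := by
  rw [backFun, if_neg hp, ← Real.norm_eq_abs]
  calc ‖∫ z, levelTrans c M p (Fin.last k, z) * endFun φ M i z‖
      ≤ ∫ z, Real.exp (M - c (Fin.last k)) * rangeInd c M p.2 * |endFun φ M i z| := by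
        refine norm_integral_le_of_norm_le ((hφM i).abs.const_mul _) (.of_forall fun z => ?_)
        rw [norm_mul]
        exact mul_le_mul_of_nonneg_right (abs_levelTrans_le_left _ _) (abs_nonneg _)
    _ = _ := by rw [integral_const_mul]; ring

theorem integrable_backFun (hφ : ∀ i, Measurable (φ i)) (hφM : ∀ i, Integrable (endFun φ M i))
    (i q : Fin (k + 1)) : Integrable (fun y => backFun φ c M i (q, y)) (levelMeasure c q) := by
  by_cases hq : q = Fin.last k
  · subst hq
    rw [levelMeasure_last]
    refine (hφM i).congr (.of_forall fun y => ?_)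
    simp [backFun]
  · exact integrable_of_le_rangeInd (measurable_backFun_level hφ i q) fun y =>
      abs_backFun_le hφM i (p := (q, y)) hq

theorem integral_levelTrans_mul_backFun (hφM : ∀ i, Integrable (endFun φ M i))
    (q : Fin (k + 1)) (x : Fin (k + 1) × ℝ) (i : Fin (k + 1)) :
    ∫ y, levelTrans c M x (q, y) * backFun φ c M i (q, y) ∂(levelMeasure c q) =
      if x.1 < q then backFun φ c M i x else 0 := by
  split_ifs with h
  swap
  · have h0 : ∀ y, levelTrans c M x (q, y) * backFun φ c M i (q, y) = 0 := fun y => by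
      rw [levelTrans_of_not_lt c M x (q, y) h, zero_mul]
    simp [h0]
  have hx : x.1 ≠ Fin.last k := (h.trans_le (Fin.le_last q)).ne
  by_cases hq : q = Fin.last k
  · subst hq
    rw [levelMeasure_last, backFun, if_neg hx]
    simp [backFun]
  · have hq' : q < Fin.last k := lt_of_le_of_ne (Fin.le_last q) hq
    rw [integral_mul_backFun hφM hq (measurable_levelTrans_left x q)
      fun y => abs_levelTrans_le_right x (q, y)]
    simp_rw [integral_levelTrans_mul_levelTrans, if_pos (And.intro h hq')]
    rw [backFun, if_neg hx]

/-- By Fubini the pairing can be moved to the top level, transporting the start function up instead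
of the end function down. The Gram matrix is thus the same on all levels, and one inverse yields
biorthogonality on each of them. -/
theorem integral_startFun_mul_backFun (hM : 0 < M) (hc : c ∈ chamber (k + 1)) (hc0 : c 0 = -M)
    (hφM : ∀ i, Integrable (endFun φ M i)) (q j i : Fin (k + 1)) :
    ∫ y, startFun c M j (q, y) * backFun φ c M i (q, y) ∂(levelMeasure c q) =
      gram φ c M j i := by
  by_cases hq : q = Fin.last k
  · subst hq
    rw [levelMeasure_last]
    simp [backFun, gram]
  · have hq' : q < Fin.last k := lt_of_le_of_ne (Fin.le_last q) hq
    rw [integral_mul_backFun hφM hq (measurable_startFun_level j q)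
      fun y => abs_startFun_le hM hc hc0 j (q, y)]
    simp_rw [integral_startFun_mul_levelTrans hM hc hc0, if_pos hq']
    rfl

theorem isChain_levelTrans (hM : 0 < M) (hc : c ∈ chamber (k + 1)) (hc0 : c 0 = -M)
    (hφ : ∀ i, Measurable (φ i)) (hφM : ∀ i, Integrable (endFun φ M i))
    (hdet : (gram φ c M).det ≠ 0) :
    IsChain (levelMeasure c) (levelTrans c M) (dualFun φ c M) (startFun c M) := by
  have hTA : ∀ (q : Fin (k + 1)) (x : Fin (k + 1) × ℝ) i, Integrable (fun y =>
      levelTrans c M x (q, y) * backFun φ c M i (q, y)) (levelMeasure c q) :=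
    fun q x i => integrable_levelTrans_mul x (integrable_backFun hφ hφM i q)
  have hBA : ∀ (q j i : Fin (k + 1)), Integrable (fun y =>
      startFun c M j (q, y) * backFun φ c M i (q, y)) (levelMeasure c q) := fun q j i =>
    (integrable_backFun hφ hφM i q).bdd_mul (measurable_startFun_level j q).aestronglyMeasurable
      (.of_forall fun y => (abs_startFun_le hM hc hc0 j (q, y)).trans
        (mul_le_of_le_one_right (Real.exp_pos _).le (rangeInd_le_one _ _ _)))
  refine
    { zero := levelTrans_of_not_lt c M
      intTT := fun q x x' => integrable_levelTrans_mul x (integrable_of_le_rangeInd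
        (measurable_levelTrans_right x' q) fun y => abs_levelTrans_le_left (q, y) x')
      TT := integral_levelTrans_mul_levelTrans
      intTA := fun q x j => ?_
      TA := fun q x j => ?_
      intBT := fun q x j => integrable_mul_levelTrans x (integrable_startFun hM hc hc0 j q)
      BT := integral_startFun_mul_levelTrans hM hc hc0
      intBA := fun q i j => ?_
      BA := fun q i j => ?_ }
  · simp only [dualFun, Finset.mul_sum, ← mul_assoc]
    exact integrable_finsetSum _ fun i _ => (hTA q x i).mul_const _
  · simp only [dualFun, Finset.mul_sum, ← mul_assoc]
    rw [integral_finsetSum _ fun i _ => (hTA q x i).mul_const _]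
    simp_rw [integral_mul_const, integral_levelTrans_mul_backFun hφM]
    split_ifs <;> simp
  · simp only [dualFun, Finset.mul_sum, ← mul_assoc]
    exact integrable_finsetSum _ fun l _ => (hBA q i l).mul_const _
  · simp only [dualFun, Finset.mul_sum, ← mul_assoc]
    rw [integral_finsetSum _ fun l _ => (hBA q i l).mul_const _]
    simp_rw [integral_mul_const, integral_startFun_mul_backFun hM hc hc0 hφM]
    rw [← Matrix.mul_apply, Matrix.mul_nonsing_inv _ (isUnit_iff_ne_zero.2 hdet), Matrix.one_apply]

/-- The correlation kernel. -/
noncomputable def fieldKernel (φ : Fin (k + 1) → ℝ → ℝ) (c : Fin (k + 1) → ℝ) (M : ℝ) :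
    Fin (k + 1) × ℝ → Fin (k + 1) × ℝ → ℝ :=
  chainKernel (levelTrans c M) (dualFun φ c M) (startFun c M)

theorem isLevelwiseReproducing_fieldKernel (hM : 0 < M) (hc : c ∈ chamber (k + 1))
    (hc0 : c 0 = -M) (hφ : ∀ i, Measurable (φ i)) (hφM : ∀ i, Integrable (endFun φ M i))
    (hdet : (gram φ c M).det ≠ 0) :
    IsLevelwiseReproducing (levelMeasure c) (k + 1) (fieldKernel φ c M) := by
  have h := (isChain_levelTrans hM hc hc0 hφ hφM hdet).isLevelwiseReproducing ?_ ?_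
  · simpa [fieldKernel] using h
  · refine (measurable_levelTrans c M).neg.add (Finset.measurable_sum _ fun j _ => ?_)
    exact ((measurable_dualFun hφ c M j).comp measurable_fst).mul
      ((measurable_startFun c M j).comp measurable_snd)
  · refine ⟨fun p => Real.exp (M - c (Fin.last k)) * rangeInd c M p.2 +
      ∑ j, |dualFun φ c M j p| * Real.exp (M - c (Fin.last k)), fun q => ?_, fun x x' => ?_⟩
    · refine ((integrable_rangeInd c M q).const_mul _).add (integrable_finsetSum _ fun j _ => ?_)
      refine Integrable.mul_const (Integrable.abs ?_) _
      exact integrable_finsetSum _ fun i _ => (integrable_backFun hφ hφM i q).mul_const _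
    · refine (abs_add_le _ _).trans (add_le_add ?_ ?_)
      · rw [abs_neg]
        exact abs_levelTrans_le_left x x'
      · refine (Finset.abs_sum_le_sum_abs _ _).trans (Finset.sum_le_sum fun j _ => ?_)
        rw [abs_mul]
        exact mul_le_mul_of_nonneg_left ((abs_startFun_le hM hc hc0 j x').trans
          (mul_le_of_le_one_right (Real.exp_pos _).le (rangeInd_le_one _ _ _))) (abs_nonneg _)

/-! ### The density as a chain of determinants -/

theorem exists_comp_mem_chamber {n : ℕ} {z : Fin n → ℝ} (hz : Function.Injective z) :
    ∃ σ : Equiv.Perm (Fin n), z ∘ σ ∈ chamber n := by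
  refine ⟨Tuple.sort (fun i => -z i), ?_⟩
  have h := Tuple.monotone_sort (fun i => -z i)
  intro i j hij
  refine lt_of_le_of_ne ?_ fun h' => hij.ne' ((Tuple.sort (fun i => -z i)).injective (hz h'))
  simpa using h hij.le

theorem injective_of_comp_mem_chamber {n : ℕ} {z : Fin n → ℝ} {σ : Equiv.Perm (Fin n)}
    (h : z ∘ σ ∈ chamber n) : Function.Injective z := by
  have := (StrictAnti.injective h).comp σ.symm.injective
  rwa [Function.comp_assoc, Equiv.self_comp_symm, Function.comp_id] at this

theorem perm_eq_of_comp_mem_chamber {n : ℕ} {z : Fin n → ℝ} {σ τ : Equiv.Perm (Fin n)}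
    (hσ : z ∘ σ ∈ chamber n) (hτ : z ∘ τ ∈ chamber n) : σ = τ := by
  have h := Tuple.unique_monotone (f := fun i => -z i) (σ := σ) (τ := τ)
    (fun i j hij => neg_le_neg (hσ.antitone hij)) (fun i j hij => neg_le_neg (hτ.antitone hij))
  ext i
  have h1 : z (σ i) = z (τ i) := by simpa using congrFun h i
  rw [injective_of_comp_mem_chamber hσ h1]

theorem sortedPhiDet_eq {n : ℕ} (φ : Fin n → ℝ → ℝ) {z : Fin n → ℝ} {σ : Equiv.Perm (Fin n)}
    (hσ : z ∘ σ ∈ chamber n) : sortedPhiDet φ z = phiDet φ (z ∘ σ) := by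
  classical
  rw [sortedPhiDet, Finset.sum_eq_single σ]
  · rw [if_pos hσ]
  · intro τ _ hτ
    rw [if_neg fun h => hτ (perm_eq_of_comp_mem_chamber h hσ)]
  · simp

/-- The matrix is unitriangular: for `i < j`, `b j ≤ b (i + 1) ≤ a i`. -/
theorem det_lt_of_interlaced {n : ℕ} {a b : Fin n → ℝ} (hb : b ∈ chamber n)
    (h1 : ∀ j, a j < b j) (h2 : ∀ (j : Fin n) (h : j.val + 1 < n), b ⟨j.val + 1, h⟩ ≤ a j) :
    (Matrix.of fun i j => if a i < b j then (1 : ℝ) else 0).det = 1 := by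
  rw [Matrix.det_of_isLowerTriangular]
  · simp [h1]
  · intro i j hij
    have hij' : i < j := hij
    have h : i.val + 1 < n := lt_of_le_of_lt hij' j.2
    have h3 : b j ≤ b ⟨i.val + 1, h⟩ := StrictAnti.antitone hb (Fin.le_def.2 hij')
    simp [h3.trans (h2 i h)]

/-- If `b l ≤ a l`, the rows up to `l` and the columns from `l` on form too large a zero block. If
`a i < b (i + 1)`, the rows `i` and `i + 1` coincide. -/
theorem interlaced_of_det_lt_ne_zero {n : ℕ} {a b : Fin n → ℝ} (ha : a ∈ chamber n)
    (hb : b ∈ chamber n)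
    (hdet : (Matrix.of fun i j => if a i < b j then (1 : ℝ) else 0).det ≠ 0) :
    (∀ j, a j < b j) ∧ ∀ (j : Fin n) (h : j.val + 1 < n), b ⟨j.val + 1, h⟩ ≤ a j := by
  constructor
  · intro l
    by_contra! hl
    refine hdet (det_eq_zero_of_zero_block _ (Finset.Iic l) (Finset.Ici l) ?_ ?_)
    · intro i hi j hj
      have h1 := StrictAnti.antitone ha (Finset.mem_Iic.1 hi)
      have h2 := StrictAnti.antitone hb (Finset.mem_Ici.1 hj)
      simp [h2.trans (hl.trans h1)]
    · rw [Finset.card_compl, Fintype.card_fin, Fin.card_Iic, Fin.card_Ici]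
      omega
  -- The induction runs from the largest index down: equality of the rows `i` and `i + 1` in the
  -- columns beyond `i + 1` needs `b (i + 2) ≤ a (i + 1)`.
  · suffices H : ∀ d, ∀ (j : Fin n) (h : j.val + 1 < n), n - j.val ≤ d →
        b ⟨j.val + 1, h⟩ ≤ a j from fun j h => H _ j h le_rfl
    intro d
    induction d with
    | zero => intro j h hd; omega
    | succ d ih =>
      intro i h hd
      by_contra! hlt
      refine hdet (Matrix.det_zero_of_row_eq (i := i) (j := ⟨i.val + 1, h⟩)
        (fun h => by simpa using congrArg Fin.val h) ?_)
      funext j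
      have h1 : a ⟨i.val + 1, h⟩ < a i := ha (Fin.lt_def.2 (Nat.lt_succ_self _))
      by_cases hj : j.val ≤ i.val + 1
      · have h2 : b ⟨i.val + 1, h⟩ ≤ b j := StrictAnti.antitone hb (Fin.le_def.2 hj)
        simp [hlt.trans_le h2, h1.trans (hlt.trans_le h2)]
      · have hi2 : i.val + 1 + 1 < n := by omega
        have h2 : b j ≤ b ⟨i.val + 1 + 1, hi2⟩ :=
          StrictAnti.antitone hb (Fin.le_def.2 (by simp; omega))
        have h3 := h2.trans (ih ⟨i.val + 1, h⟩ hi2 (by simp; omega))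
        simp only [Matrix.of_apply]
        rw [if_neg (not_lt.2 (h3.trans h1.le)), if_neg (not_lt.2 h3)]

theorem det_of_comp_perm {n : ℕ} (f : Fin n → Fin n → ℝ) (σ τ : Equiv.Perm (Fin n)) :
    (Matrix.of f).det = (Equiv.Perm.sign σ : ℤ) * (Equiv.Perm.sign τ : ℤ) *
      (Matrix.of fun i j => f (σ i) (τ j)).det := by
  have h1 := Matrix.det_permute σ (Matrix.of f)
  have h2 := Matrix.det_permute' τ ((Matrix.of f).submatrix σ id)
  have h3 : (((Matrix.of f).submatrix σ id).submatrix id τ) =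
    Matrix.of fun i j => f (σ i) (τ j) := rfl
  rw [h3, h1] at h2
  have e1 : ∀ s : ℤˣ, (((s : ℤ) : ℝ)) * ((s : ℤ) : ℝ) = 1 := by
    intro s
    rcases Int.units_eq_one_or s with h | h <;> simp [h]
  rw [h2]
  linear_combination (-(Matrix.of f).det) * e1 (Equiv.Perm.sign σ) -
    ((Equiv.Perm.sign σ : ℤ) : ℝ) * ((Equiv.Perm.sign σ : ℤ) : ℝ) * (Matrix.of f).det *
      e1 (Equiv.Perm.sign τ)

theorem exists_perm_of_det_ne_zero {n : ℕ} {f : Fin n → Fin n → ℝ} (h : (Matrix.of f).det ≠ 0) :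
    ∃ σ : Equiv.Perm (Fin n), ∀ i, f i (σ i) ≠ 0 := by
  rw [← Matrix.det_transpose, Matrix.det_apply] at h
  obtain ⟨σ, _, hσ⟩ := Finset.exists_ne_zero_of_sum_ne_zero h
  refine ⟨σ, fun i hi => hσ ?_⟩
  have h0 : ∏ j, (Matrix.of f).transpose (σ j) j = 0 := Finset.prod_eq_zero (Finset.mem_univ i) hi
  rw [h0, smul_zero]

/-- The density of the configurations as a product of determinants. -/
noncomputable def chainDensity (φ : Fin (k + 1) → ℝ → ℝ) (c : Fin (k + 1) → ℝ) (M : ℝ)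
    (z : Fin (k + 1) → Fin (k + 1) → ℝ) : ℝ :=
  (Matrix.of fun i j => startFun c M i (0, z 0 j)).det *
    (∏ r : Fin k, (Matrix.of fun i j =>
      levelTrans c M (r.castSucc, z r.castSucc i) (r.succ, z r.succ j)).det) *
    (Matrix.of fun i j => endFun φ M i (z (Fin.last k) j)).det

theorem levelTrans_castSucc_succ (r : Fin k) (x y : ℝ) :
    levelTrans c M (r.castSucc, x) (r.succ, y) =
      if c (Fin.last k) ≤ x ∧ x < y ∧ y ≤ M then 1 else 0 := by
  simp [levelTrans, cutPow, dpow_zero]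

/-- A violated cut-off produces a zero row or column and a repeated entry produces two equal ones.
What remains is the matrix of comparisons, which may be sorted. -/
theorem interlaced_of_det_levelTrans_ne_zero (r : Fin k) {x y : Fin (k + 1) → ℝ}
    (h : (Matrix.of fun i j => levelTrans c M (r.castSucc, x i) (r.succ, y j)).det ≠ 0) :
    Interlaced x y := by
  simp only [levelTrans_castSucc_succ] at h
  have hx : ∀ i, c (Fin.last k) ≤ x i := by
    intro i
    by_contra! hi
    exact h (Matrix.det_eq_zero_of_row_eq_zero i fun j => by simp [not_le.2 hi])
  have hy : ∀ j, y j ≤ M := by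
    intro j
    by_contra! hj
    exact h (Matrix.det_eq_zero_of_column_eq_zero j fun i => by simp [not_le.2 hj])
  simp only [hx, hy, true_and, and_true] at h
  have hxi : Function.Injective x := by
    intro i i' hii
    by_contra hne
    exact h (Matrix.det_zero_of_row_eq hne (by funext j; simp [hii]))
  have hyi : Function.Injective y := by
    intro i i' hii
    by_contra hne
    exact h (Matrix.det_zero_of_column_eq hne (by intro j; simp [hii]))
  obtain ⟨σ, hσ⟩ := exists_comp_mem_chamber hxi
  obtain ⟨τ, hτ⟩ := exists_comp_mem_chamber hyi
  rw [det_of_comp_perm _ σ τ] at h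
  exact ⟨σ, τ, hσ, hτ, interlaced_of_det_lt_ne_zero hσ hτ (right_ne_zero_of_mul h)⟩

theorem mem_admissible_of_chainDensity_ne_zero (hc : c ∈ chamber (k + 1)) (hc0 : c 0 = -M)
    {z : Fin (k + 1) → Fin (k + 1) → ℝ} (h : chainDensity φ c M z ≠ 0) :
    z ∈ admissible M c := by
  obtain ⟨h12, h3⟩ := mul_ne_zero_iff.1 h
  obtain ⟨h1, h2⟩ := mul_ne_zero_iff.1 h12
  refine ⟨fun j => ?_, ?_, fun r hr => ?_⟩
  · by_contra hj
    refine h3 (Matrix.det_eq_zero_of_column_eq_zero j fun i => ?_)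
    exact indicator_of_notMem (show z (Fin.last k) j ∉ Icc (-M) M from hj) _
  -- A non-vanishing Leibniz term assigns one particle to `[-M, M]` and the others to the points `c
  -- j`. Since `c j < -M` for `j ≠ 0`, this assignment is the decreasing order.
  · obtain ⟨σ, hσ⟩ := exists_perm_of_det_ne_zero h1
    have hσ0 : -M ≤ z 0 (σ 0) := by
      by_contra h0
      refine hσ 0 ?_
      rw [startFun, if_pos rfl, if_pos rfl]
      exact indicator_of_notMem (fun h' : z 0 (σ 0) ∈ Icc (-M) M => h0 h'.1) _
    have hσj : ∀ j, j ≠ 0 → z 0 (σ j) = c j := by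
      intro j hj
      by_contra h0
      exact hσ j (by simp [startFun, hj, h0])
    have hσc : z 0 ∘ σ ∈ chamber (k + 1) := by
      intro i j hij
      have hj : j ≠ 0 := (Fin.pos_of_ne_zero fun h => by simp [h] at hij).ne'
      simp only [Function.comp_apply, hσj j hj]
      by_cases hi : i = 0
      · subst hi
        exact (hc hij).trans_le (hc0.le.trans hσ0)
      · rw [hσj i hi]
        exact hc hij
    intro τ hτ
    rw [perm_eq_of_comp_mem_chamber hτ hσc]
    exact hσj
  · have hr' : r.val < k := by omega
    exact interlaced_of_det_levelTrans_ne_zero ⟨r, hr'⟩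
      (Finset.prod_ne_zero_iff.1 h2 ⟨r, hr'⟩ (Finset.mem_univ _))

/-- After every level is sorted, the start matrix is the identity and the transition matrices are
unitriangular; the only other contribution is signs. Each level occurs in exactly two of the
determinants, so its sign is squared. -/
theorem chainDensity_of_mem_admissible (hc : c ∈ chamber (k + 1)) (hc0 : c 0 = -M)
    {z : Fin (k + 1) → Fin (k + 1) → ℝ} (h : z ∈ admissible M c) :
    chainDensity φ c M z = sortedPhiDet φ (z (Fin.last k)) := by
  obtain ⟨htop, hbot, hint⟩ := h
  have hint' : ∀ r : Fin k, Interlaced (z r.castSucc) (z r.succ) := fun r =>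
    hint r.castSucc (by simp)
  have hsort : ∀ r, ∃ σ : Equiv.Perm (Fin (k + 1)), z r ∘ σ ∈ chamber (k + 1) := by
    intro r
    -- With a single level there is no interlacing condition to provide the order, but one entry is
    -- always sorted.
    rcases k with _ | k
    · exact ⟨1, fun i j hij => absurd hij (by rw [Fin.lt_def]; omega)⟩
    · induction r using Fin.cases with
      | zero =>
        obtain ⟨σ, τ, hσ, -⟩ := hint' 0
        exact ⟨σ, hσ⟩
      | succ r =>
        obtain ⟨σ, τ, -, hτ, -⟩ := hint' r
        exact ⟨τ, hτ⟩
  choose σ hσ using hsort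
  set y : Fin (k + 1) → Fin (k + 1) → ℝ := fun r => z r ∘ σ r with hy
  have hlt : ∀ (r : Fin k) j, y r.castSucc j < y r.succ j := by
    intro r j
    obtain ⟨σ', τ', h1, h2, h3, -⟩ := hint' r
    have := h3 j
    rwa [perm_eq_of_comp_mem_chamber h1 (hσ _), perm_eq_of_comp_mem_chamber h2 (hσ _)] at this
  have hle : ∀ (r : Fin k) (j : Fin (k + 1)) (h : j.val + 1 < k + 1),
      y r.succ ⟨j.val + 1, h⟩ ≤ y r.castSucc j := by
    intro r j hj
    obtain ⟨σ', τ', h1, h2, -, h3⟩ := hint' r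
    have := h3 j hj
    rwa [perm_eq_of_comp_mem_chamber h1 (hσ _), perm_eq_of_comp_mem_chamber h2 (hσ _)] at this
  have hbot' : ∀ j, j ≠ 0 → y 0 j = c j := hbot (σ 0) (hσ 0)
  have htop' : ∀ j, y (Fin.last k) j ∈ Icc (-M) M := fun j => htop (σ (Fin.last k) j)
  have hmono : ∀ j, Monotone fun r => y r j := fun j =>
    Fin.monotone_iff_le_succ.2 fun r => (hlt r j).le
  -- Down the diagonal the interlacing inequalities bound the free particle of the lowest level
  -- below by the smallest top particle, hence by `-M`; this makes the cut-off to `[-M, M]` on the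
  -- lowest level harmless.
  have hanti : Antitone fun r => y r r := Fin.antitone_iff_succ_le.2 fun r =>
    hle r r.castSucc (by simp)
  have hy00 : -M ≤ y 0 0 := (htop' (Fin.last k)).1.trans (hanti (Fin.zero_le _))
  have hyM : ∀ r j, y r j ≤ M := fun r j => (hmono j (Fin.le_last r)).trans (htop' j).2
  have hylo : ∀ r j, c (Fin.last k) ≤ y r j := by
    intro r j
    refine le_trans ?_ (hmono j (Fin.zero_le r))
    by_cases hj : j = 0
    · subst hj
      exact (chamber_last_le hc 0).trans (hc0.le.trans hy00)
    · exact (chamber_last_le hc j).trans_eq (hbot' j hj).symm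
  have d0 : (Matrix.of fun i j => startFun c M i (0, z 0 j)).det =
      ((Equiv.Perm.sign (σ 0) : ℤ) : ℝ) := by
    rw [det_of_comp_perm _ 1 (σ 0)]
    have : (Matrix.of fun i j => startFun c M ((1 : Equiv.Perm (Fin (k + 1))) i)
        (0, z 0 (σ 0 j))) = 1 := by
      ext i j
      change startFun c M i (0, y 0 j) = _
      rw [startFun, if_pos rfl]
      by_cases hi : i = 0
      · subst hi
        rw [if_pos rfl]
        by_cases hj : j = 0
        · subst hj
          rw [indicator_of_mem (show y 0 0 ∈ Icc (-M) M from ⟨hy00, hyM 0 0⟩)]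
          simp
        · rw [indicator_of_notMem, Matrix.one_apply_ne (Ne.symm hj)]
          intro h
          have h1 := hc (Fin.pos_of_ne_zero hj)
          rw [hc0] at h1
          exact absurd h.1 (not_le.2 (by simpa [hbot' j hj] using h1))
      · rw [if_neg hi]
        by_cases hj : j = 0
        · subst hj
          have h1 := hc (Fin.pos_of_ne_zero hi)
          rw [hc0] at h1
          rw [if_neg (h1.trans_le hy00).ne', Matrix.one_apply_ne hi]
        · simp only [hbot' j hj, hc.injective.eq_iff, Matrix.one_apply, eq_comm]
    rw [this]
    simp
  have dr : ∀ r : Fin k, (Matrix.of fun i j =>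
      levelTrans c M (r.castSucc, z r.castSucc i) (r.succ, z r.succ j)).det =
      ((Equiv.Perm.sign (σ r.castSucc) : ℤ) : ℝ) * ((Equiv.Perm.sign (σ r.succ) : ℤ) : ℝ) := by
    intro r
    rw [det_of_comp_perm _ (σ r.castSucc) (σ r.succ)]
    have : (Matrix.of fun i j => levelTrans c M (r.castSucc, z r.castSucc (σ r.castSucc i))
        (r.succ, z r.succ (σ r.succ j))) =
        Matrix.of fun i j => if y r.castSucc i < y r.succ j then (1 : ℝ) else 0 := by
      ext i j
      change levelTrans c M (r.castSucc, y r.castSucc i) (r.succ, y r.succ j) = _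
      rw [levelTrans_castSucc_succ]
      simp [hylo, hyM]
    rw [this, det_lt_of_interlaced (hσ _) (hlt r) (hle r), mul_one]
  have dl : (Matrix.of fun i j => endFun φ M i (z (Fin.last k) j)).det =
      ((Equiv.Perm.sign (σ (Fin.last k)) : ℤ) : ℝ) * phiDet φ (y (Fin.last k)) := by
    rw [det_of_comp_perm _ 1 (σ (Fin.last k))]
    have : (Matrix.of fun i j => endFun φ M ((1 : Equiv.Perm (Fin (k + 1))) i)
        (z (Fin.last k) (σ (Fin.last k) j))) = Matrix.of fun i j => φ i (y (Fin.last k) j) := by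
      ext i j
      exact indicator_of_mem (htop' j) _
    rw [this, phiDet]
    simp
  rw [chainDensity, d0, Finset.prod_congr rfl fun r _ => dr r, dl, Finset.prod_mul_distrib,
    sortedPhiDet_eq φ (hσ _)]
  have p1 := Fin.prod_univ_castSucc fun r => ((Equiv.Perm.sign (σ r) : ℤ) : ℝ)
  have p2 := Fin.prod_univ_succ fun r => ((Equiv.Perm.sign (σ r) : ℤ) : ℝ)
  have p3 : (∏ r, ((Equiv.Perm.sign (σ r) : ℤ) : ℝ)) * ∏ r, ((Equiv.Perm.sign (σ r) : ℤ) : ℝ) = 1 := by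
    rw [← Finset.prod_mul_distrib]
    refine Finset.prod_eq_one fun r _ => ?_
    rcases Int.units_eq_one_or (Equiv.Perm.sign (σ r)) with h | h <;> simp [h]
  nth_rewrite 1 [p1] at p3
  rw [p2] at p3
  linear_combination (phiDet φ (y (Fin.last k))) * p3

theorem chainDensity_eq_indicator (hc : c ∈ chamber (k + 1)) (hc0 : c 0 = -M)
    (z : Fin (k + 1) → Fin (k + 1) → ℝ) :
    chainDensity φ c M z =
      (admissible M c).indicator (fun z => sortedPhiDet φ (z (topLevel (k + 1)))) z := by
  by_cases hz : z ∈ admissible M c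
  · rw [indicator_of_mem hz, chainDensity_of_mem_admissible hc hc0 hz]
    rfl
  · rw [indicator_of_notMem hz]
    by_contra h
    exact hz (mem_admissible_of_chainDensity_ne_zero hc hc0 h)

/-! ### Measurability of the admissible set -/

theorem measurableSet_comp_mem_chamber {n : ℕ} (σ : Equiv.Perm (Fin n)) :
    MeasurableSet {z : Fin n → ℝ | z ∘ σ ∈ chamber n} := by
  have : {z : Fin n → ℝ | z ∘ σ ∈ chamber n} =
      ⋂ i, ⋂ j, ⋂ (_ : i < j), {z : Fin n → ℝ | z (σ j) < z (σ i)} := by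
    ext z
    simp only [mem_iInter]
    exact Iff.rfl
  rw [this]
  exact MeasurableSet.iInter fun i => MeasurableSet.iInter fun j => MeasurableSet.iInter fun _ =>
    measurableSet_lt (measurable_pi_apply _) (measurable_pi_apply _)

theorem measurableSet_interlaced (n : ℕ) :
    MeasurableSet {p : (Fin n → ℝ) × (Fin n → ℝ) | Interlaced p.1 p.2} := by
  have : {p : (Fin n → ℝ) × (Fin n → ℝ) | Interlaced p.1 p.2} =
      ⋃ σ : Equiv.Perm (Fin n), ⋃ τ : Equiv.Perm (Fin n),
        ({p | p.1 ∘ σ ∈ chamber n} ∩ {p | p.2 ∘ τ ∈ chamber n} ∩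
          (⋂ j, {p | p.1 (σ j) < p.2 (τ j)}) ∩
          ⋂ (j : Fin n), ⋂ (h : j.val + 1 < n), {p | p.2 (τ ⟨j.val + 1, h⟩) ≤ p.1 (σ j)}) := by
    ext p
    simp only [mem_iUnion, mem_inter_iff, mem_iInter, and_assoc]
    exact Iff.rfl
  rw [this]
  refine MeasurableSet.iUnion fun σ => MeasurableSet.iUnion fun τ => ?_
  refine (((measurable_fst (measurableSet_comp_mem_chamber σ)).inter
    (measurable_snd (measurableSet_comp_mem_chamber τ))).inter
    (MeasurableSet.iInter fun j => measurableSet_lt (by fun_prop) (by fun_prop))).inter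
    (MeasurableSet.iInter fun j => MeasurableSet.iInter fun h =>
      measurableSet_le (by fun_prop) (by fun_prop))

theorem measurableSet_admissible (M : ℝ) (c : Fin (k + 1) → ℝ) :
    MeasurableSet (admissible M c) := by
  have : admissible M c = (⋂ j, {z | -M ≤ z (topLevel (k + 1)) j ∧ z (topLevel (k + 1)) j ≤ M}) ∩
      (⋂ τ : Equiv.Perm (Fin (k + 1)), ({z | z 0 ∘ τ ∈ chamber (k + 1)}ᶜ ∪
        ⋂ j, ⋂ (_ : j ≠ 0), {z | z 0 (τ j) = c j})) ∩
      ⋂ r : Fin (k + 1), ⋂ (h : r.val + 1 < k + 1),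
        {z | Interlaced (z r) (z ⟨r.val + 1, h⟩)} := by
    ext z
    simp only [mem_inter_iff, mem_iInter, mem_union, mem_compl_iff, ← imp_iff_not_or, and_assoc]
    exact Iff.rfl
  rw [this]
  have hev : ∀ r j, Measurable fun z : Fin (k + 1) → Fin (k + 1) → ℝ => z r j := by
    intro r j; fun_prop
  refine ((MeasurableSet.iInter fun j => ?_).inter (MeasurableSet.iInter fun τ => ?_)).inter
    (MeasurableSet.iInter fun r => MeasurableSet.iInter fun h => ?_)
  · exact (measurableSet_le measurable_const (hev _ _)).inter
      (measurableSet_le (hev _ _) measurable_const)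
  · exact ((measurable_pi_apply 0) (measurableSet_comp_mem_chamber τ)).compl.union
      (MeasurableSet.iInter fun j : Fin (k + 1) => MeasurableSet.iInter fun (_ : j ≠ 0) =>
        measurableSet_eq_fun (hev 0 (τ j)) measurable_const)
  · have hm : Measurable fun z : Fin (k + 1) → Fin (k + 1) → ℝ => (z r, z ⟨r.val + 1, h⟩) := by
      fun_prop
    exact hm (measurableSet_interlaced (k + 1))

/-! ### Integrability of the functions and symmetrisation -/

theorem ae_injective_pi (n : ℕ) : ∀ᵐ y : Fin n → ℝ, Function.Injective y := by
  have h : ∀ i j : Fin n, i ≠ j → ∀ᵐ y : Fin n → ℝ, y i ≠ y j := by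
    intro i j hij
    set L : (Fin n → ℝ) →ₗ[ℝ] ℝ := (LinearMap.proj (R := ℝ) (φ := fun _ : Fin n => ℝ) i) -
      LinearMap.proj (R := ℝ) (φ := fun _ : Fin n => ℝ) j with hL
    have h0 := Measure.addHaar_submodule (volume : Measure (Fin n → ℝ)) (LinearMap.ker L) (by
      intro htop
      have : Pi.single i (1 : ℝ) ∈ LinearMap.ker L := htop ▸ Submodule.mem_top
      simp [hL, hij.symm] at this)
    refine (measure_eq_zero_iff_ae_notMem.1 h0).mono fun y hy hyy => hy ?_
    simp [hL, hyy]
  have h' : ∀ᵐ y : Fin n → ℝ, ∀ i j, i ≠ j → y i ≠ y j := by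
    refine ae_all_iff.2 fun i => ae_all_iff.2 fun j => ?_
    by_cases hij : i = j
    · simp [hij]
    · filter_upwards [h i j hij] with y hy _ using hy
  filter_upwards [h'] with y hy i j hij
  by_contra hne
  exact hy i j hne hij

/-- If the determinants do not vanish almost everywhere, none of the functions does. -/
theorem not_ae_zero_of_phiDet {n : ℕ} {φ : Fin n → ℝ → ℝ}
    (hne : ¬ ∀ᵐ y : Fin n → ℝ, y ∈ chamber n → phiDet φ y = 0) (j : Fin n) :
    volume {x | φ j x ≠ 0} ≠ 0 := by
  intro h0
  refine hne ?_
  have h1 : ∀ᵐ x : ℝ, φ j x = 0 := h0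
  have h2 : ∀ᵐ y : Fin n → ℝ, ∀ i, φ j (y i) = 0 := by
    refine ae_all_iff.2 fun i => ?_
    exact (Measure.quasiMeasurePreserving_eval (fun _ : Fin n => (volume : Measure ℝ)) i).ae h1
  filter_upwards [h2] with y hy _
  exact Matrix.det_eq_zero_of_row_eq_zero j hy

theorem vandermondeProd_ne_zero {n : ℕ} {y : Fin n → ℝ} (hy : Function.Injective y) :
    vandermondeProd y ≠ 0 := by
  refine Finset.prod_ne_zero_iff.2 fun i _ => Finset.prod_ne_zero_iff.2 fun j hj => ?_
  exact sub_ne_zero.2 fun h => (Finset.mem_Ioi.1 hj).ne (hy h)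

theorem continuous_vandermondeProd (n : ℕ) : Continuous (vandermondeProd (n := n)) := by
  unfold vandermondeProd
  fun_prop

/-- Only `Phi` is known to be integrable, and its Vandermonde factor has zeros. Near a given point
`a` the other coordinates can be frozen at values distinct from each other and from `a`, so that
this factor stays away from zero. -/
theorem locallyIntegrable_of_integrable_Phi {n : ℕ} {φ : Fin n → ℝ → ℝ}
    (hφ : ∀ k, Measurable (φ k)) (hΦ : Integrable (Phi φ))
    (hne : ∀ j, volume {x | φ j x ≠ 0} ≠ 0) (i : Fin n) : LocallyIntegrable (φ i) := by
  intro a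
  obtain ⟨m, rfl⟩ : ∃ m, n = m + 1 := ⟨n - 1, by have := i.2; omega⟩
  have hmp := volume_preserving_piFinSuccAbove (fun _ : Fin (m + 1) => ℝ) i
  have h1 : Integrable (fun p : ℝ × (Fin m → ℝ) => Phi φ (i.insertNth p.1 p.2))
      (volume.prod volume) := by
    have := (hmp.symm.integrable_comp_emb (MeasurableEquiv.measurableEmbedding _)).2 hΦ
    exact this
  have h2 := h1.prod_left_ae
  -- The other `φ j` may vanish on large sets, so suitable values form a set of positive, not full,
  -- measure; this suffices to meet the almost sure conditions `h2`, `h4` and injectivity.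
  have h3 : ∃ᵐ w : Fin m → ℝ, ∀ j, φ (i.succAbove j) (w j) ≠ 0 := by
    rw [frequently_ae_iff]
    have : {w : Fin m → ℝ | ∀ j, φ (i.succAbove j) (w j) ≠ 0} =
        univ.pi fun j => {x | φ (i.succAbove j) x ≠ 0} := by
      ext w; simp
    rw [this, volume_pi_pi]
    exact Finset.prod_ne_zero_iff.2 fun j _ => hne _
  have h4 : ∀ᵐ w : Fin m → ℝ, ∀ j, w j ≠ a := ae_all_iff.2 fun j =>
    Measure.ae_eval_ne (fun _ : Fin m => (volume : Measure ℝ)) j a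
  obtain ⟨w, hw1, hw2, hw3, hw4⟩ :=
    (h3.and_eventually (h2.and ((ae_injective_pi m).and h4))).exists
  -- the slice through `w` is `φ i` times a continuous function that does not vanish at `a`
  set C := ∏ j, φ (i.succAbove j) (w j) with hC
  have hC0 : C ≠ 0 := Finset.prod_ne_zero_iff.2 fun j _ => hw1 j
  have hslice : ∀ x, Phi φ (i.insertNth x w) =
      φ i x * C * vandermondeProd (i.insertNth x w : Fin (m + 1) → ℝ) := by
    intro x
    rw [Phi, Fin.prod_univ_succAbove _ i]
    simp [hC]
  have hcont : Continuous fun x : ℝ => vandermondeProd (i.insertNth x w : Fin (m + 1) → ℝ) :=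
    (continuous_vandermondeProd _).comp (by fun_prop)
  have hinj : Function.Injective (i.insertNth a w : Fin (m + 1) → ℝ) := by
    intro p q
    induction p using i.succAboveCases with
    | x => induction q using i.succAboveCases with
      | x => simp
      | p q => simpa using fun h => absurd h.symm (hw4 q)
    | p p => induction q using i.succAboveCases with
      | x => simpa using fun h => absurd h (hw4 p)
      | p q => simpa using fun h => hw3 h
  have hpos : 0 < |vandermondeProd (i.insertNth a w : Fin (m + 1) → ℝ)| :=
    abs_pos.2 (vandermondeProd_ne_zero hinj)
  obtain ⟨δ, hδ0, hδ⟩ := exists_between hpos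
  have hev : ∀ᶠ x in nhds a, δ < |vandermondeProd (i.insertNth x w : Fin (m + 1) → ℝ)| :=
    hcont.abs.continuousAt.eventually (lt_mem_nhds hδ)
  obtain ⟨U, hU, hUo, haU⟩ := eventually_nhds_iff.1 hev
  refine ⟨U, hUo.mem_nhds haU, ?_⟩
  refine ((hw2.norm.const_mul (|C| * δ)⁻¹).integrableOn (s := U)).mono'
    (hφ i).aestronglyMeasurable ?_
  filter_upwards [ae_restrict_mem hUo.measurableSet] with x hx
  rw [hslice, norm_mul, norm_mul, Real.norm_eq_abs, Real.norm_eq_abs, Real.norm_eq_abs]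
  have hC0' : 0 < |C| := abs_pos.2 hC0
  rw [le_inv_mul_iff₀ (by positivity)]
  have := mul_le_mul_of_nonneg_left (hU x hx).le (mul_nonneg (abs_nonneg (φ i x)) hC0'.le)
  linarith

theorem integrable_endFun {k : ℕ} {φ : Fin (k + 1) → ℝ → ℝ} (hφ : ∀ k, Measurable (φ k))
    (hΦ : Integrable (Phi φ))
    (hne : ¬ ∀ᵐ y : Fin (k + 1) → ℝ, y ∈ chamber (k + 1) → phiDet φ y = 0) (M : ℝ)
    (i : Fin (k + 1)) : Integrable (endFun φ M i) :=
  (integrable_indicator_iff measurableSet_Icc).2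
    ((locallyIntegrable_of_integrable_Phi hφ hΦ (not_ae_zero_of_phiDet hne) i).integrableOn_isCompact
      isCompact_Icc)

/-! ### Symmetrisation over permutations and positivity of `Bconst` -/

section Symmetrisation

variable {n : ℕ} {φ : Fin n → ℝ → ℝ}

/-- The sign that relates `vandermondeProd` to the determinant of the Vandermonde matrix. -/
noncomputable def vandermondeSign (n : ℕ) : ℝ := ∏ i : Fin n, ∏ _j ∈ Finset.Ioi i, (-1)

theorem vandermondeSign_ne_zero (n : ℕ) : vandermondeSign n ≠ 0 :=
  Finset.prod_ne_zero_iff.2 fun _ _ => Finset.prod_ne_zero_iff.2 fun _ _ => by norm_num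

theorem vandermondeProd_eq (y : Fin n → ℝ) :
    vandermondeProd y = vandermondeSign n * (Matrix.vandermonde y).det := by
  rw [Matrix.det_vandermonde, vandermondeSign, vandermondeProd, ← Finset.prod_mul_distrib]
  refine Finset.prod_congr rfl fun i _ => ?_
  rw [← Finset.prod_mul_distrib]
  exact Finset.prod_congr rfl fun j _ => by ring

theorem vandermondeProd_comp (y : Fin n → ℝ) (σ : Equiv.Perm (Fin n)) :
    vandermondeProd (y ∘ σ) = ((Equiv.Perm.sign σ : ℤ) : ℝ) * vandermondeProd y := by
  have h := Matrix.det_permute σ (Matrix.vandermonde y)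
  have h2 : (Matrix.vandermonde y).submatrix σ id = Matrix.vandermonde (y ∘ σ) := rfl
  rw [vandermondeProd_eq, ← h2, h, vandermondeProd_eq]
  ring

theorem phiDet_comp (φ : Fin n → ℝ → ℝ) (y : Fin n → ℝ) (σ : Equiv.Perm (Fin n)) :
    phiDet φ (y ∘ σ) = ((Equiv.Perm.sign σ : ℤ) : ℝ) * phiDet φ y :=
  Matrix.det_permute' σ (Matrix.of fun i j => φ i (y j))

/-- The Vandermonde product contributes the signs that complete the Leibniz formula. -/
theorem sum_Phi_comp (φ : Fin n → ℝ → ℝ) (y : Fin n → ℝ) :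
    ∑ σ : Equiv.Perm (Fin n), Phi φ (y ∘ σ) = vandermondeProd y * phiDet φ y := by
  rw [phiDet, ← Matrix.det_transpose, Matrix.det_apply', Finset.mul_sum]
  refine Finset.sum_congr rfl fun σ _ => ?_
  rw [Phi, vandermondeProd_comp]
  simp only [Function.comp_apply, Matrix.transpose_apply, Matrix.of_apply]
  ring

theorem vandermondeProd_pos {y : Fin n → ℝ} (hy : y ∈ chamber n) : 0 < vandermondeProd y :=
  Finset.prod_pos fun _ _ => Finset.prod_pos fun _ hj => sub_pos.2 (hy (Finset.mem_Ioi.1 hj))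

/-- Both factors on the left are antisymmetric, so their product is symmetric and may be evaluated
at the sorted vector. -/
theorem vandermondeProd_mul_phiDet (φ : Fin n → ℝ → ℝ) {y : Fin n → ℝ} {σ : Equiv.Perm (Fin n)}
    (hσ : y ∘ σ ∈ chamber n) :
    vandermondeProd y * phiDet φ y = vandermondeProd (y ∘ σ) * sortedPhiDet φ y := by
  rw [sortedPhiDet_eq φ hσ, vandermondeProd_comp, phiDet_comp]
  have : ((Equiv.Perm.sign σ : ℤ) : ℝ) * ((Equiv.Perm.sign σ : ℤ) : ℝ) = 1 := by
    rcases Int.units_eq_one_or (Equiv.Perm.sign σ) with h | h <;> simp [h]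
  linear_combination (-(vandermondeProd y * phiDet φ y)) * this

theorem measurePreserving_comp_perm (σ : Equiv.Perm (Fin n)) :
    MeasurePreserving (fun y : Fin n → ℝ => y ∘ σ) :=
  measurePreserving_comp_equiv (fun _ : Fin n => (volume : Measure ℝ)) σ

theorem ae_sortedPhiDet_nonneg (hnonneg : ∀ᵐ y : Fin n → ℝ, y ∈ chamber n → 0 ≤ phiDet φ y) :
    ∀ᵐ y : Fin n → ℝ, 0 ≤ sortedPhiDet φ y := by
  classical
  have h : ∀ᵐ y : Fin n → ℝ, ∀ σ : Equiv.Perm (Fin n), y ∘ σ ∈ chamber n → 0 ≤ phiDet φ (y ∘ σ) :=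
    ae_all_iff.2 fun σ => (measurePreserving_comp_perm σ).quasiMeasurePreserving.ae hnonneg
  filter_upwards [h] with y hy
  refine Finset.sum_nonneg fun σ _ => ?_
  split_ifs with hσ
  · exact hy σ hσ
  · exact le_rfl

theorem measurableSet_box (n : ℕ) (M : ℝ) : MeasurableSet (box n M) := measurableSet_Icc

theorem comp_mem_box {M : ℝ} {y : Fin n → ℝ} (σ : Equiv.Perm (Fin n)) :
    y ∘ σ ∈ box n M ↔ y ∈ box n M := by
  simp only [box, mem_Icc, Pi.le_def, Function.comp_apply]
  exact and_congr (σ.forall_congr_left.trans (by simp)) (σ.forall_congr_left.trans (by simp))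

theorem integrableOn_Phi_comp (hΦ : Integrable (Phi φ)) (M : ℝ) (σ : Equiv.Perm (Fin n)) :
    IntegrableOn (fun y => Phi φ (y ∘ σ)) (box n M) :=
  ((measurePreserving_comp_perm σ).integrable_comp_of_integrable hΦ).integrableOn

/-- The box and Lebesgue measure are invariant under permutations, so all permuted copies of `Phi`
have the same integral. The gain is an integrand on the right whose sign is known. -/
theorem factorial_mul_Bconst (hΦ : Integrable (Phi φ)) (M : ℝ) :
    (n.factorial : ℝ) * Bconst φ M = ∫ y in box n M, vandermondeProd y * phiDet φ y := by
  simp_rw [← sum_Phi_comp]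
  rw [integral_finsetSum _ fun σ _ => integrableOn_Phi_comp hΦ M σ]
  have h : ∀ σ : Equiv.Perm (Fin n), ∫ y in box n M, Phi φ (y ∘ σ) = Bconst φ M := by
    intro σ
    have hemb : MeasurableEmbedding (fun y : Fin n → ℝ => y ∘ σ) :=
      (MeasurableEquiv.piCongrLeft (fun _ : Fin n => ℝ) σ).symm.measurableEmbedding
    have hpre : (fun y : Fin n → ℝ => y ∘ σ) ⁻¹' box n M = box n M := by
      ext y
      exact comp_mem_box σ
    have := (measurePreserving_comp_perm σ).setIntegral_preimage_emb hemb (Phi φ) (box n M)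
    rwa [hpre] at this
  rw [Finset.sum_congr rfl fun σ _ => h σ, Finset.sum_const, Finset.card_univ, Fintype.card_perm,
    Fintype.card_fin, nsmul_eq_mul]

theorem ae_vandermondeProd_mul_phiDet_nonneg
    (hnonneg : ∀ᵐ y : Fin n → ℝ, y ∈ chamber n → 0 ≤ phiDet φ y) :
    ∀ᵐ y : Fin n → ℝ, 0 ≤ vandermondeProd y * phiDet φ y := by
  filter_upwards [ae_injective_pi n, ae_sortedPhiDet_nonneg hnonneg] with y hy hy'
  obtain ⟨σ, hσ⟩ := exists_comp_mem_chamber hy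
  rw [vandermondeProd_mul_phiDet φ hσ]
  exact mul_nonneg (vandermondeProd_pos hσ).le hy'

theorem Bconst_nonneg (hΦ : Integrable (Phi φ))
    (hnonneg : ∀ᵐ y : Fin n → ℝ, y ∈ chamber n → 0 ≤ phiDet φ y) (M : ℝ) : 0 ≤ Bconst φ M := by
  have h1 := factorial_mul_Bconst hΦ M
  have h2 : 0 ≤ ∫ y in box n M, vandermondeProd y * phiDet φ y :=
    integral_nonneg_of_ae (ae_restrict_of_ae (ae_vandermondeProd_mul_phiDet_nonneg hnonneg))
  rw [← h1] at h2
  exact nonneg_of_mul_nonneg_right h2 (by positivity)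

theorem ae_sortedPhiDet_eq_zero_of_Bconst (hΦ : Integrable (Phi φ))
    (hnonneg : ∀ᵐ y : Fin n → ℝ, y ∈ chamber n → 0 ≤ phiDet φ y) {M : ℝ}
    (hB : Bconst φ M = 0) : ∀ᵐ y : Fin n → ℝ, y ∈ box n M → sortedPhiDet φ y = 0 := by
  have h1 := factorial_mul_Bconst hΦ M
  have hint : IntegrableOn (fun y => vandermondeProd y * phiDet φ y) (box n M) := by
    simp_rw [← sum_Phi_comp]
    exact integrable_finsetSum _ fun σ _ => integrableOn_Phi_comp hΦ M σ
  rw [hB, mul_zero, eq_comm, integral_eq_zero_iff_of_nonneg_ae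
    (ae_restrict_of_ae (ae_vandermondeProd_mul_phiDet_nonneg hnonneg)) hint] at h1
  filter_upwards [(ae_restrict_iff' (measurableSet_box n M)).1 h1, ae_injective_pi n]
    with y hy hinj hyM
  obtain ⟨σ, hσ⟩ := exists_comp_mem_chamber hinj
  have h2 := hy hyM
  rw [vandermondeProd_mul_phiDet φ hσ] at h2
  exact (mul_eq_zero.1 h2).resolve_left (vandermondeProd_pos hσ).ne'

/-- `B_n^{(M)}` does not vanish for large `M`. -/
theorem exists_Bconst_ne_zero (hΦ : Integrable (Phi φ))
    (hnonneg : ∀ᵐ y : Fin n → ℝ, y ∈ chamber n → 0 ≤ phiDet φ y)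
    (hne : ¬ ∀ᵐ y : Fin n → ℝ, y ∈ chamber n → phiDet φ y = 0) :
    ∃ M₀ : ℝ, 0 < M₀ ∧ ∀ M ≥ M₀, Bconst φ M ≠ 0 := by
  by_contra! hcon
  refine hne ?_
  have h : ∀ N : ℕ, ∀ᵐ y : Fin n → ℝ, y ∈ box n N → sortedPhiDet φ y = 0 := by
    intro N
    obtain ⟨M, hM, hB⟩ := hcon (N + 1) (by positivity)
    filter_upwards [ae_sortedPhiDet_eq_zero_of_Bconst hΦ hnonneg hB] with y hy hyN
    refine hy ⟨fun i => ?_, fun i => ?_⟩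
    · have := hyN.1 i
      simp only at this ⊢
      linarith
    · have := hyN.2 i
      simp only at this ⊢
      linarith
  filter_upwards [ae_all_iff.2 h] with y hy hyc
  obtain ⟨N, hN⟩ := exists_nat_ge (∑ i, |y i|)
  have hle : ∀ i, |y i| ≤ N := fun i =>
    (Finset.single_le_sum (fun j _ => abs_nonneg (y j)) (Finset.mem_univ i)).trans hN
  have h1 := hy N ⟨fun i => (abs_le.1 (hle i)).1, fun i => (abs_le.1 (hle i)).2⟩
  rw [sortedPhiDet_eq φ (σ := 1) hyc] at h1
  exact h1

end Symmetrisation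

/-! ### Interpolation -/

open Polynomial in
theorem iteratedDeriv_eval (p : Polynomial ℝ) (m : ℕ) :
    iteratedDeriv m (fun x => p.eval x) = fun x => (derivative^[m] p).eval x := by
  induction m generalizing p with
  | zero => simp
  | succ m ih =>
    have hd : deriv (fun x => p.eval x) = fun x => (derivative p).eval x := by
      funext x; exact p.deriv
    rw [iteratedDeriv_succ', hd, ih, Function.iterate_succ_apply]

/-- The derivative of order `m` at `v` of the Lagrange basis function with value `1` at `z j`. -/
noncomputable def lagrangeDeriv {n : ℕ} (m : ℕ) (v : ℝ) (z : Fin n → ℝ) (j : Fin n) : ℝ :=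
  iteratedDeriv m (fun w => ∏ i ∈ Finset.univ.erase j, (w - z i) / (z j - z i)) v

/-- Lagrange interpolation at `z`, differentiated `m` times. -/
theorem sum_eval_mul_lagrangeDeriv {n : ℕ} {z : Fin n → ℝ} (hz : Function.Injective z)
    {p : Polynomial ℝ} (hp : p.degree < n) (m : ℕ) (v : ℝ) :
    ∑ j, p.eval (z j) * lagrangeDeriv m v z j = (Polynomial.derivative^[m] p).eval v := by
  have h1 : ∀ j, lagrangeDeriv m v z j =
      (Polynomial.derivative^[m] (Lagrange.basis Finset.univ z j)).eval v := by
    intro j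
    rw [lagrangeDeriv, ← congrFun (iteratedDeriv_eval _ m) v]
    congr 1
    funext w
    rw [Lagrange.basis, Polynomial.eval_prod]
    refine Finset.prod_congr rfl fun i _ => ?_
    simp [Lagrange.basisDivisor, div_eq_inv_mul]
  have h2 := Lagrange.eq_interpolate (s := Finset.univ) (v := z) (f := p) hz.injOn (by simpa using hp)
  conv_rhs => rw [h2, Lagrange.interpolate_apply, Polynomial.iterate_derivative_sum]
  rw [Polynomial.eval_finsetSum]
  refine Finset.sum_congr rfl fun j _ => ?_
  rw [Polynomial.iterate_derivative_C_mul, Polynomial.eval_mul, Polynomial.eval_C, h1]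

/-- The polynomial `(X - a) ^ e / e!`. -/
noncomputable def dpowPoly (e : ℕ) (a : ℝ) : Polynomial ℝ :=
  Polynomial.C ((e.factorial : ℝ)⁻¹) * (Polynomial.X - Polynomial.C a) ^ e

theorem eval_dpowPoly (e : ℕ) (a x : ℝ) : (dpowPoly e a).eval x = dpow e (x - a) := by
  simp [dpowPoly, dpow, div_eq_inv_mul]

theorem natDegree_dpowPoly_le (e : ℕ) (a : ℝ) : (dpowPoly e a).natDegree ≤ e := by
  refine Polynomial.natDegree_C_mul_le _ _ |>.trans ?_
  rw [Polynomial.natDegree_pow, Polynomial.natDegree_X_sub_C, mul_one]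

theorem degree_dpowPoly_lt {e n : ℕ} (a : ℝ) (h : e < n) : (dpowPoly e a).degree < n :=
  (Polynomial.degree_le_natDegree.trans (Nat.cast_le.2 (natDegree_dpowPoly_le e a))).trans_lt
    (Nat.cast_lt.2 h)

theorem eval_iterate_derivative_dpowPoly (e m : ℕ) (a x : ℝ) :
    (Polynomial.derivative^[m] (dpowPoly e a)).eval x =
      if m ≤ e then dpow (e - m) (x - a) else 0 := by
  rw [dpowPoly, Polynomial.iterate_derivative_C_mul, Polynomial.iterate_derivative_X_sub_pow]
  simp only [Polynomial.eval_mul, Polynomial.eval_C, nsmul_eq_mul, Polynomial.eval_natCast,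
    Polynomial.eval_pow, Polynomial.eval_sub, Polynomial.eval_X]
  split_ifs with h
  · have h1 : ((e - m).factorial : ℝ) * (e.descFactorial m : ℝ) = e.factorial := by
      exact_mod_cast Nat.factorial_mul_descFactorial h
    have h2 : ((e - m).factorial : ℝ) ≠ 0 := by positivity
    have h3 : (e.factorial : ℝ) ≠ 0 := by positivity
    rw [dpow]
    field_simp
    linear_combination (x - a) ^ (e - m) * h1
  · rw [Nat.descFactorial_of_lt (not_le.1 h)]
    simp

/-! ### Determinants of integrals and the Gram determinant -/

/-- The determinant of a matrix of integrals. -/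
theorem integrable_det_pi {n : ℕ} {f : Fin n → Fin n → ℝ → ℝ} (hf : ∀ j i, Integrable (f j i)) :
    Integrable fun z : Fin n → ℝ => (Matrix.of fun j i => f j i (z i)).det := by
  simp only [Matrix.det_apply', Matrix.of_apply]
  exact integrable_finsetSum _ fun σ _ =>
    (Integrable.fintype_prod (f := fun i => f (σ i) i) fun i => hf _ _).const_mul _

/-- Each column receives its own variable, so in every Leibniz term the product of integrals is an
integral over the product space. Unlike in Andréief's identity, no factorial appears. -/
theorem det_integral_eq {n : ℕ} {f : Fin n → Fin n → ℝ → ℝ} (hf : ∀ j i, Integrable (f j i)) :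
    (Matrix.of fun j i => ∫ x, f j i x).det =
      ∫ z : Fin n → ℝ, (Matrix.of fun j i => f j i (z i)).det := by
  simp only [Matrix.det_apply', Matrix.of_apply]
  rw [integral_finsetSum _ fun σ _ =>
    (Integrable.fintype_prod (f := fun i => f (σ i) i) fun i => hf _ _).const_mul _]
  refine Finset.sum_congr rfl fun σ _ => ?_
  rw [integral_const_mul, integral_fintype_prod_volume_eq_prod fun i => f (σ i) i]

/-- The polynomials that the functions `startFun` on the top level are made of. -/
noncomputable def startPoly (c : Fin (k + 1) → ℝ) (j : Fin (k + 1)) : Polynomial ℝ :=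
  dpowPoly (if j = 0 then k else k - 1) (c j)

theorem pos_card_of_ne_zero {j : Fin (k + 1)} (hj : j ≠ 0) : 0 < k := by
  have h1 := j.2
  have h2 : (j : ℕ) ≠ 0 := fun h => hj (Fin.ext h)
  omega

theorem degree_startPoly_lt (c : Fin (k + 1) → ℝ) (j : Fin (k + 1)) :
    (startPoly c j).degree < (k + 1 : ℕ) := by
  refine degree_dpowPoly_lt _ ?_
  split_ifs <;> omega

/-- For `v` in `[-M, M]` all starting points satisfy `c j ≤ -M ≤ v`, so the cut-offs disappear and
going down one level is differentiation. On level `0` and for `j ≠ 0`, both sides vanish: `v ≠ c j`,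
and the polynomial has degree at most `k - 1`. -/
theorem startFun_eq_eval (hc : c ∈ chamber (k + 1)) (hc0 : c 0 = -M) (j s : Fin (k + 1)) {v : ℝ}
    (hv : v ∈ Icc (-M) M) :
    startFun c M j (s, v) = (Polynomial.derivative^[k - s] (startPoly c j)).eval v := by
  have hs := s.2
  rw [startPoly, eval_iterate_derivative_dpowPoly, startFun]
  by_cases hj : j = 0
  · subst hj
    simp only [if_true]
    rw [if_pos (Nat.sub_le _ _), show k - (k - (s : ℕ)) = s by omega]
    split_ifs with h0
    · subst h0
      rw [indicator_of_mem hv]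
      simp [dpow_zero]
    -- At `v = -M = c 0` the cut-off power is `0` by definition; so is the divided power, its
    -- exponent being positive.
    · rcases hv.1.eq_or_lt with h1 | h1
      · have h2 : (s : ℕ) ≠ 0 := fun h => h0 (Fin.ext h)
        obtain ⟨d, hd⟩ := Nat.exists_eq_succ_of_ne_zero h2
        rw [← h1, hc0, cutPow_of_not_lt _ le_rfl, sub_self, hd, dpow_succ_zero]
      · exact cutPow_of_mem _ (chamber_last_le hc 0) (hc0 ▸ h1) hv.2
  · have h1 : c j < v := lt_of_lt_of_le (hc (Fin.pos_of_ne_zero hj)) (hc0 ▸ hv.1)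
    have hk := pos_card_of_ne_zero hj
    simp only [if_neg hj]
    by_cases h0 : s = 0
    · subst h0
      rw [if_pos rfl, if_neg h1.ne', if_neg]
      simp only [Fin.val_zero]
      omega
    · have h2 : (s : ℕ) ≠ 0 := fun h => h0 (Fin.ext h)
      rw [if_neg h0, if_pos (by omega), cutPow_of_mem _ (chamber_last_le hc j) h1 hv.2]
      congr 1
      omega

theorem coeff_dpowPoly (e m : ℕ) (a : ℝ) (hm : m ≤ e) :
    (dpowPoly e a).coeff m = dpow (e - m) (-a) / m.factorial := by
  have h := Polynomial.coeff_X_add_C_pow (-a) e m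
  rw [Polynomial.C_neg, ← sub_eq_add_neg] at h
  rw [dpowPoly, Polynomial.coeff_C_mul, h, dpow, Nat.cast_choose ℝ hm]
  have h1 : (e.factorial : ℝ) ≠ 0 := by positivity
  have h2 : (m.factorial : ℝ) ≠ 0 := by positivity
  have h3 : ((e - m).factorial : ℝ) ≠ 0 := by positivity
  field_simp

/-- The polynomials `startPoly` are linearly independent. -/
theorem det_coeff_startPoly_ne_zero (hc : c ∈ chamber (k + 1)) :
    (Matrix.of fun j m : Fin (k + 1) => (startPoly c j).coeff m).det ≠ 0 := by
  intro h0
  obtain ⟨v, hv, hv0⟩ := Matrix.exists_vecMul_eq_zero_iff.2 h0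
  refine hv ?_
  have hsum : ∀ m : Fin (k + 1), ∑ j, v j * (startPoly c j).coeff m = 0 := fun m => congrFun hv0 m
  have hlow : ∀ j : Fin (k + 1), j ≠ 0 → (startPoly c j).coeff k = 0 := by
    intro j hj
    refine Polynomial.coeff_eq_zero_of_natDegree_lt ((natDegree_dpowPoly_le _ _).trans_lt ?_)
    rw [if_neg hj]
    have := pos_card_of_ne_zero hj
    omega
  -- Only the polynomial with index `0` has degree `k`. The coefficients of the others are, up to
  -- non-zero factors, powers of `-c j`, so a Vandermonde argument finishes.
  have hv00 : v 0 = 0 := by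
    have h1 := hsum (Fin.last k)
    rw [Finset.sum_eq_single 0] at h1
    · refine (mul_eq_zero.1 h1).resolve_right ?_
      rw [startPoly, if_pos rfl, Fin.val_last, coeff_dpowPoly k k _ le_rfl, Nat.sub_self, dpow_zero]
      positivity
    · intro j _ hj
      rw [Fin.val_last, hlow j hj, mul_zero]
    · simp
  have hvs : (fun j : Fin k => v j.succ) = 0 := by
    refine Matrix.eq_zero_of_forall_pow_sum_mul_pow_eq_zero (f := fun j : Fin k => -c j.succ) ?_ ?_
    · intro i j hij
      exact Fin.succ_injective _ (hc.injective (neg_injective hij))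
    · intro i
      have hi := i.2
      have h1 := hsum ⟨k - 1 - i, by omega⟩
      rw [Fin.sum_univ_succ, hv00, zero_mul, zero_add] at h1
      have h2 : ∀ j : Fin k, (startPoly c j.succ).coeff (k - 1 - i) =
          (-c j.succ) ^ (i : ℕ) * (((i : ℕ).factorial : ℝ) * (k - 1 - i).factorial)⁻¹ := by
        intro j
        rw [startPoly, if_neg (Fin.succ_ne_zero j), coeff_dpowPoly _ _ _ (by omega), dpow,
          show k - 1 - (k - 1 - (i : ℕ)) = i by omega, div_div, div_eq_mul_inv]
      simp only [h2, ← mul_assoc] at h1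
      rw [← Finset.sum_mul] at h1
      refine (mul_eq_zero.1 h1).resolve_right (by positivity)
  funext j
  refine Fin.cases hv00 (fun j => congrFun hvs j) j

/-- On the box, the determinant of the functions `startFun` on the top level is a constant multiple
of the Vandermonde product. -/
theorem exists_det_startFun (hc : c ∈ chamber (k + 1)) (hc0 : c 0 = -M) :
    ∃ C : ℝ, C ≠ 0 ∧ ∀ z ∈ box (k + 1) M,
      (Matrix.of fun j i => startFun c M j (Fin.last k, z i)).det = C * vandermondeProd z := by
  refine ⟨(Matrix.of fun j m : Fin (k + 1) => (startPoly c j).coeff m).det *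
    (vandermondeSign (k + 1))⁻¹, mul_ne_zero (det_coeff_startPoly_ne_zero hc)
      (inv_ne_zero (vandermondeSign_ne_zero _)), fun z hz => ?_⟩
  have h1 : (Matrix.of fun j i => startFun c M j (Fin.last k, z i)) =
      (Matrix.of fun j m : Fin (k + 1) => (startPoly c j).coeff m) *
        (Matrix.vandermonde z).transpose := by
    ext j i
    rw [Matrix.mul_apply, Matrix.of_apply, startFun_eq_eval hc hc0 j _ ⟨hz.1 i, hz.2 i⟩]
    simp only [Fin.val_last, Nat.sub_self, Function.iterate_zero, id, Matrix.of_apply,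
      Matrix.transpose_apply, Matrix.vandermonde_apply]
    have hd : (startPoly c j).natDegree < k + 1 := by
      refine (natDegree_dpowPoly_le _ _).trans_lt ?_
      split_ifs <;> omega
    rw [Polynomial.eval_eq_sum_range' hd, Finset.sum_range]
  rw [h1, Matrix.det_mul, Matrix.det_transpose, vandermondeProd_eq]
  have := vandermondeSign_ne_zero (k + 1)
  field_simp

theorem prod_endFun (φ : Fin (k + 1) → ℝ → ℝ) (M : ℝ) (z : Fin (k + 1) → ℝ) :
    ∏ i, endFun φ M i (z i) = (box (k + 1) M).indicator (fun z => ∏ i, φ i (z i)) z := by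
  by_cases hz : z ∈ box (k + 1) M
  · rw [indicator_of_mem hz]
    exact Finset.prod_congr rfl fun i _ => indicator_of_mem (show z i ∈ Icc (-M) M from
      ⟨hz.1 i, hz.2 i⟩) _
  · rw [indicator_of_notMem hz]
    have : ∃ i, z i ∉ Icc (-M) M := by
      by_contra! hcon
      exact hz ⟨fun i => (hcon i).1, fun i => (hcon i).2⟩
    obtain ⟨i, hi⟩ := this
    exact Finset.prod_eq_zero (Finset.mem_univ i) (indicator_of_notMem hi _)

theorem integrable_startFun_mul_endFun (hM : 0 < M) (hc : c ∈ chamber (k + 1)) (hc0 : c 0 = -M)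
    (hφM : ∀ i, Integrable (endFun φ M i)) (j i : Fin (k + 1)) :
    Integrable fun z => startFun c M j (Fin.last k, z) * endFun φ M i z :=
  (hφM i).bdd_mul (measurable_startFun_level j _).aestronglyMeasurable
    (.of_forall fun y => (abs_startFun_le hM hc hc0 j (_, y)).trans
      (mul_le_of_le_one_right (Real.exp_pos _).le (rangeInd_le_one _ _ _)))

/-- The product of the end functions supplies both the factors `φ i` and the restriction to the box,
where the start functions give the Vandermonde product. -/
theorem det_gram (hM : 0 < M) (hc : c ∈ chamber (k + 1)) (hc0 : c 0 = -M)
    (hφM : ∀ i, Integrable (endFun φ M i)) {C : ℝ}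
    (hC : ∀ z ∈ box (k + 1) M,
      (Matrix.of fun j i => startFun c M j (Fin.last k, z i)).det = C * vandermondeProd z) :
    (gram φ c M).det = C * Bconst φ M := by
  rw [gram, det_integral_eq fun j i => integrable_startFun_mul_endFun hM hc hc0 hφM j i, Bconst,
    ← integral_indicator (measurableSet_box _ _), ← integral_const_mul]
  refine integral_congr_ae (.of_forall fun z => ?_)
  have h1 := Matrix.det_mul_row (fun i => endFun φ M i (z i))
    (Matrix.of fun j i => startFun c M j (Fin.last k, z i))
  simp only [Matrix.of_apply, prod_endFun] at h1
  simp only [mul_comm (startFun _ _ _ _)]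
  rw [h1]
  by_cases hz : z ∈ box (k + 1) M
  · rw [indicator_of_mem hz, indicator_of_mem hz, hC z hz, Phi]
    ring
  · rw [indicator_of_notMem hz, indicator_of_notMem hz]
    simp

/-! ### The formula for the kernel -/

theorem mem_symChamber_iff {n : ℕ} {M : ℝ} {z : Fin n → ℝ} :
    z ∈ symChamber n M ↔ Function.Injective z ∧ z ∈ box n M := by
  constructor
  · rintro ⟨σ, h1, h2⟩
    exact ⟨injective_of_comp_mem_chamber h1, (comp_mem_box σ).1 h2⟩
  · rintro ⟨h1, h2⟩
    obtain ⟨σ, hσ⟩ := exists_comp_mem_chamber h1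
    exact ⟨σ, hσ, (comp_mem_box σ).2 h2⟩

theorem restrict_symChamber (n : ℕ) (M : ℝ) :
    (volume : Measure (Fin n → ℝ)).restrict (symChamber n M) = volume.restrict (box n M) := by
  refine Measure.restrict_congr_set ?_
  filter_upwards [ae_injective_pi n] with z hz
  exact propext (mem_symChamber_iff.trans (and_iff_right hz))

theorem ae_restrict_box_mem_symChamber (n : ℕ) (M : ℝ) :
    ∀ᵐ z ∂(volume : Measure (Fin n → ℝ)).restrict (box n M), z ∈ symChamber n M := by
  filter_upwards [ae_restrict_of_ae (ae_injective_pi n), ae_restrict_mem (measurableSet_box n M)]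
    with z h1 h2
  exact mem_symChamber_iff.2 ⟨h1, h2⟩

/-- The integral of a determinant in which one column is replaced. -/
theorem integral_det_updateCol {n : ℕ} {s e : Fin n → ℝ → ℝ} {g : ℝ → ℝ}
    (hse : ∀ j i, Integrable fun x => s j x * e i x) (hge : ∀ i, Integrable fun x => g x * e i x)
    (b : Fin n → ℝ) (i : Fin n) :
    (Integrable fun z : Fin n → ℝ => (∏ l, e l (z l)) *
      (g (z i) * ((Matrix.of fun j l => s j (z l)).updateCol i b).det)) ∧
    ∫ z : Fin n → ℝ, (∏ l, e l (z l)) *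
        (g (z i) * ((Matrix.of fun j l => s j (z l)).updateCol i b).det) =
      (∫ x, g x * e i x) * ((Matrix.of fun j l => ∫ x, s j x * e l x).updateCol i b).det := by
  -- In column `i` the variable enters only through `g * e i`, so integration leaves a scalar times
  -- `b`, while the other columns become integrals of `s j * e l`.
  set f : Fin n → Fin n → ℝ → ℝ := fun j l x =>
    if l = i then g x * e l x * b j else s j x * e l x with hf
  have hfi : ∀ j l, Integrable (f j l) := by
    intro j l
    by_cases h : l = i
    · simp only [hf, if_pos h]
      exact (hge l).mul_const _
    · simp only [hf, if_neg h]
      exact hse j l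
  have h1 : ∀ z : Fin n → ℝ, (Matrix.of fun j l => f j l (z l)).det = (∏ l, e l (z l)) *
      (g (z i) * ((Matrix.of fun j l => s j (z l)).updateCol i b).det) := by
    intro z
    have h2 := Matrix.det_mul_row (fun l => e l (z l) * if l = i then g (z i) else 1)
      ((Matrix.of fun j l => s j (z l)).updateCol i b)
    rw [Finset.prod_mul_distrib, Finset.prod_ite_eq' Finset.univ i, if_pos (Finset.mem_univ i),
      mul_assoc] at h2
    rw [← h2]
    congr 1
    ext j l
    by_cases h : l = i
    · subst h
      simp [hf, mul_comm]
    · simp [hf, h, mul_comm]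
  have h3 : (Matrix.of fun j l => ∫ x, f j l x) =
      (Matrix.of fun j l => ∫ x, s j x * e l x).updateCol i ((∫ x, g x * e i x) • b) := by
    ext j l
    by_cases h : l = i
    · subst h
      simp [hf, integral_mul_const]
    · simp [hf, h]
  have h4 := integrable_det_pi hfi
  have h5 := det_integral_eq hfi
  rw [h3, Matrix.det_updateCol_smul] at h5
  simp only [h1] at h4 h5
  exact ⟨h4, h5.symm⟩

/-- Cramer's rule for the inverse Gram matrix. -/
theorem sum_dualFun_mul (p : Fin (k + 1) × ℝ) (b : Fin (k + 1) → ℝ) :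
    ∑ j, dualFun φ c M j p * b j =
      (gram φ c M).det⁻¹ * ∑ i, backFun φ c M i p * ((gram φ c M).updateCol i b).det := by
  have h : ∀ i, ((gram φ c M).updateCol i b).det = ∑ j, (gram φ c M).adjugate i j * b j := by
    intro i
    rw [← Matrix.cramer_apply, Matrix.cramer_eq_adjugate_mulVec]
    rfl
  simp only [dualFun, h, Matrix.inv_def, Matrix.smul_apply, Ring.inverse_eq_inv', smul_eq_mul,
    Finset.sum_mul, Finset.mul_sum]
  rw [Finset.sum_comm]
  exact Finset.sum_congr rfl fun i _ => Finset.sum_congr rfl fun j _ => by ring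

/-- The sum over `j` in the kernel, without the conditions on `u` and `v`. -/
theorem integral_Phi_mul_sum_levelTrans (hM : 0 < M) (hc : c ∈ chamber (k + 1)) (hc0 : c 0 = -M)
    (hφM : ∀ i, Integrable (endFun φ M i)) (hB : Bconst φ M ≠ 0)
    {r : Fin (k + 1)} (hr : r ≠ Fin.last k) (s : Fin (k + 1)) (u : ℝ) {v : ℝ}
    (hv : v ∈ Icc (-M) M) :
    IntegrableOn (fun z => Phi φ z * ∑ i, levelTrans c M (r, u) (Fin.last k, z i) *
      lagrangeDeriv (k - s) v z i) (symChamber (k + 1) M) ∧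
    ∫ z in symChamber (k + 1) M, Phi φ z * ∑ i, levelTrans c M (r, u) (Fin.last k, z i) *
      lagrangeDeriv (k - s) v z i =
      Bconst φ M * ∑ j, dualFun φ c M j (r, u) * startFun c M j (s, v) := by
  obtain ⟨C, hC0, hC⟩ := exists_det_startFun hc hc0
  have hge : ∀ i, Integrable fun z => levelTrans c M (r, u) (Fin.last k, z) * endFun φ M i z :=
    fun i => (hφM i).bdd_mul (measurable_levelTrans_left _ _).aestronglyMeasurable
      (.of_forall fun y => abs_levelTrans_le_exp _ _)
  have hmain := integral_det_updateCol (s := fun j x => startFun c M j (Fin.last k, x))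
    (fun j i => integrable_startFun_mul_endFun hM hc hc0 hφM j i) hge
    (fun j => startFun c M j (s, v))
  set H : Fin (k + 1) → (Fin (k + 1) → ℝ) → ℝ := fun i z => (∏ l, endFun φ M l (z l)) *
      (levelTrans c M (r, u) (Fin.last k, z i) *
        ((Matrix.of fun j l => startFun c M j (Fin.last k, z l)).updateCol i
          fun j => startFun c M j (s, v)).det) with hH
  have hHi : Integrable fun z => ∑ i, H i z := integrable_finsetSum _ fun i _ => (hmain i).1
  have hHb : ∀ i, ∫ z, H i z = backFun φ c M i (r, u) * ((gram φ c M).updateCol i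
      fun j => startFun c M j (s, v)).det := by
    intro i
    rw [(hmain i).2, backFun, if_neg hr]
    rfl
  have hpt : ∀ᵐ z ∂(volume : Measure (Fin (k + 1) → ℝ)).restrict (box (k + 1) M),
      C⁻¹ * ∑ i, H i z = Phi φ z * ∑ i, levelTrans c M (r, u) (Fin.last k, z i) *
        lagrangeDeriv (k - s) v z i := by
    filter_upwards [ae_restrict_box_mem_symChamber (k + 1) M] with z hz
    obtain ⟨hz1, hz2⟩ := mem_symChamber_iff.1 hz
    -- Interpolation at `z` writes the new column as a combination of the old ones. In the
    -- determinant with column `i` replaced only the `i`-th coefficient survives, times the old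
    -- determinant `C * vandermondeProd z`.
    have hb : (fun j => startFun c M j (s, v)) = fun j => ∑ i, lagrangeDeriv (k - s) v z i •
        (Matrix.of fun j l => startFun c M j (Fin.last k, z l)) j i := by
      funext j
      rw [startFun_eq_eval hc hc0 j s hv,
        ← sum_eval_mul_lagrangeDeriv hz1 (degree_startPoly_lt c j)]
      refine Finset.sum_congr rfl fun i _ => ?_
      rw [Matrix.of_apply, startFun_eq_eval hc hc0 j _ ⟨hz2.1 i, hz2.2 i⟩, smul_eq_mul, mul_comm]
      simp
    have hdet : ∀ i, ((Matrix.of fun j l => startFun c M j (Fin.last k, z l)).updateCol i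
        fun j => startFun c M j (s, v)).det =
          lagrangeDeriv (k - s) v z i * (C * vandermondeProd z) := by
      intro i
      rw [hb, Matrix.det_updateCol_sum, hC z hz2, smul_eq_mul]
    simp only [hH, hdet, prod_endFun, indicator_of_mem hz2, Phi, Finset.mul_sum]
    refine Finset.sum_congr rfl fun i _ => ?_
    field_simp
  have hoff : ∀ z, z ∉ box (k + 1) M → ∑ i, H i z = 0 := by
    intro z hz
    refine Finset.sum_eq_zero fun i _ => ?_
    simp only [hH, prod_endFun, indicator_of_notMem hz, zero_mul]
  rw [IntegrableOn, restrict_symChamber]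
  refine ⟨(hHi.integrableOn.const_mul C⁻¹).congr hpt, ?_⟩
  rw [← integral_congr_ae hpt, integral_const_mul,
    setIntegral_eq_integral_of_forall_compl_eq_zero hoff,
    integral_finsetSum _ fun i _ => (hmain i).1, sum_dualFun_mul, det_gram hM hc hc0 hφM hC]
  rw [Finset.sum_congr rfl fun i _ => hHb i]
  field_simp

theorem lagrangeTerm_eq (r s : Fin (k + 1)) (u v : ℝ) (z : Fin (k + 1) → ℝ) (j : Fin (k + 1)) :
    lagrangeTerm r s u v z j = dpow (k - r - 1) (z j - u) * lagrangeDeriv (k - s) v z j := by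
  simp only [lagrangeTerm, dpow, lagrangeDeriv, Nat.add_sub_add_right]

theorem levelTrans_last (hc : c ∈ chamber (k + 1)) (hc0 : c 0 = -M) {r : Fin (k + 1)}
    (hr : r ≠ Fin.last k) {u : ℝ} (hu : -M ≤ u) {x : ℝ} (hx : x ≤ M) :
    levelTrans c M (r, u) (Fin.last k, x) = if u < x then dpow (k - r - 1) (x - u) else 0 := by
  rw [levelTrans, if_pos (Fin.lt_last_iff_ne_last.2 hr)]
  split_ifs with h
  · exact cutPow_of_mem _ ((chamber_last_le hc 0).trans (hc0 ▸ hu)) h hx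
  · exact cutPow_of_not_lt _ (not_lt.1 h)

/-- The sum over all `j` of the terms of the kernel is the transition from `(r, u)` to `(s, v)`. -/
theorem sum_lagrangeTerm (hc : c ∈ chamber (k + 1)) (hc0 : c 0 = -M) {r : Fin (k + 1)}
    (hr : r ≠ Fin.last k) (s : Fin (k + 1)) {u v : ℝ} (hu : -M ≤ u) (hv : v ≤ M) (huv : u < v)
    {z : Fin (k + 1) → ℝ} (hz : Function.Injective z) :
    ∑ j, lagrangeTerm r s u v z j = levelTrans c M (r, u) (s, v) := by
  have hs := s.2
  have h := sum_eval_mul_lagrangeDeriv hz (degree_dpowPoly_lt (e := k - r - 1) u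
    (show k - r - 1 < k + 1 by omega)) (k - s) v
  simp only [eval_dpowPoly, eval_iterate_derivative_dpowPoly] at h
  have hrk : (r : ℕ) < k := Fin.lt_last_iff_ne_last.2 hr
  simp only [lagrangeTerm_eq, h, levelTrans]
  -- Differentiating a polynomial of degree `k - r - 1` exactly `k - s` times leaves something
  -- non-zero only if `r < s`, which is also when a transition exists.
  by_cases hrs : r < s
  · have h1 : (r : ℕ) < s := hrs
    rw [if_pos (by omega), if_pos hrs,
      cutPow_of_mem _ ((chamber_last_le hc 0).trans (hc0 ▸ hu)) huv hv]
    congr 1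
    omega
  · have h1 : ¬ (r : ℕ) < s := hrs
    rw [if_neg (by omega), if_neg hrs]

/-- For `v ≤ u` the transition vanishes and only the upper integrand remains. For `u < v` the
transition is the sum of all Lagrange terms, so subtracting it from the terms with `u < z j` leaves
minus those with `z j ≤ u`. -/
theorem fieldKernel_eq (hM : 0 < M) (hc : c ∈ chamber (k + 1)) (hc0 : c 0 = -M)
    (hΦ : Integrable (Phi φ)) (hφM : ∀ i, Integrable (endFun φ M i)) (hB : Bconst φ M ≠ 0)
    {r : Fin (k + 1)} (hr : r ≠ Fin.last k) (s : Fin (k + 1)) {u v : ℝ} (hu : u ∈ Icc (-M) M)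
    (hv : v ∈ Icc (-M) M) :
    IntegrableOn (upperIntegrand φ r s u v) (symChamber (k + 1) M) ∧
    IntegrableOn (lowerIntegrand φ r s u v) (symChamber (k + 1) M) ∧
    fieldKernel φ c M (r, u) (s, v) =
      1 / Bconst φ M * (∫ z in symChamber (k + 1) M, upperIntegrand φ r s u v z) -
      1 / Bconst φ M * (∫ z in symChamber (k + 1) M, lowerIntegrand φ r s u v z) := by
  obtain ⟨h1, h2⟩ := integral_Phi_mul_sum_levelTrans hM hc hc0 hφM hB hr s u hv
  set F : (Fin (k + 1) → ℝ) → ℝ := fun z => Phi φ z * ∑ i,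
    levelTrans c M (r, u) (Fin.last k, z i) * lagrangeDeriv (k - s) v z i with hF
  have hF' : ∀ z ∈ symChamber (k + 1) M,
      F z = Phi φ z * ∑ j, if u < z j then lagrangeTerm r s u v z j else 0 := by
    intro z hz
    simp only [hF]
    congr 1
    refine Finset.sum_congr rfl fun j _ => ?_
    rw [levelTrans_last hc hc0 hr hu.1 ((mem_symChamber_iff.1 hz).2.2 j), lagrangeTerm_eq, ite_mul,
      zero_mul]
  have hmem : ∀ᵐ z ∂(volume : Measure (Fin (k + 1) → ℝ)).restrict (symChamber (k + 1) M),
      z ∈ symChamber (k + 1) M := by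
    rw [restrict_symChamber]
    exact ae_restrict_box_mem_symChamber _ _
  rw [fieldKernel, chainKernel]
  rcases le_or_gt v u with hvu | huv
  · have hlow : lowerIntegrand φ r s u v = fun _ => 0 := by
      funext z
      simp [lowerIntegrand, not_lt.2 hvu]
    have hup : F =ᵐ[volume.restrict (symChamber (k + 1) M)] upperIntegrand φ r s u v := by
      filter_upwards [hmem] with z hz
      rw [hF' z hz, upperIntegrand]
      simp only [hvu, true_and]
    have hT : levelTrans c M (r, u) (s, v) = 0 := by
      rw [levelTrans]
      split_ifs
      · exact cutPow_of_not_lt _ hvu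
      · rfl
    rw [hlow, ← integral_congr_ae hup, h2, hT, integral_zero]
    refine ⟨h1.congr hup, integrableOn_zero, ?_⟩
    field_simp
    ring
  · have hup : upperIntegrand φ r s u v = fun _ => 0 := by
      funext z
      simp [upperIntegrand, not_le.2 huv]
    have hlow : (fun z => Phi φ z * levelTrans c M (r, u) (s, v) - F z)
        =ᵐ[volume.restrict (symChamber (k + 1) M)] lowerIntegrand φ r s u v := by
      filter_upwards [hmem] with z hz
      rw [hF' z hz, lowerIntegrand,
        ← sum_lagrangeTerm hc hc0 hr s hu.1 hv.2 huv (mem_symChamber_iff.1 hz).1, ← mul_sub,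
        ← Finset.sum_sub_distrib]
      congr 1
      refine Finset.sum_congr rfl fun j _ => ?_
      by_cases h : u < z j
      · simp [h, not_le.2 h]
      · simp [h, not_lt.1 h, huv]
    have hi := (hΦ.integrableOn (s := symChamber (k + 1) M)).mul_const
      (levelTrans c M (r, u) (s, v))
    -- The transition does not depend on `z`; its integral against `Phi` produces the factor
    -- `Bconst`, which the prefactor cancels.
    rw [hup, ← integral_congr_ae hlow, integral_sub hi h1, h2, integral_zero, integral_mul_const,
      restrict_symChamber, ← Bconst]
    refine ⟨integrableOn_zero, (hi.sub h1).congr hlow, ?_⟩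
    field_simp
    ring

/-! ### The measure `ξ_n` as a determinantal field -/

theorem measurePreserving_uncurry {Q : Type*} [Fintype Q] {X : Type*} [MeasurableSpace X]
    (ν : Q → Measure X) [∀ q, SigmaFinite (ν q)] (N : ℕ) :
    MeasurePreserving (fun (z : Q → Fin N → X) (p : Q × Fin N) => z p.1 p.2)
      (Measure.pi fun q => Measure.pi fun _ => ν q) (Measure.pi fun l => ν l.1) := by
  have hm : Measurable fun (z : Q → Fin N → X) (p : Q × Fin N) => z p.1 p.2 := by fun_prop
  refine ⟨hm, (Measure.pi_eq fun s hs => ?_).symm⟩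
  have h : (fun (z : Q → Fin N → X) (p : Q × Fin N) => z p.1 p.2) ⁻¹' univ.pi s =
      univ.pi fun q => univ.pi fun j => s (q, j) := by
    ext z
    simp [Set.mem_pi]
  rw [Measure.map_apply hm (MeasurableSet.univ_pi hs), h, Measure.pi_pi]
  simp only [Measure.pi_pi]
  rw [Fintype.prod_prod_type]

theorem det_endFun (hdet : (gram φ c M).det ≠ 0) (y : Fin (k + 1) → ℝ) :
    (Matrix.of fun i j => endFun φ M i (y j)).det = (gram φ c M).det *
      (Matrix.of fun i j => dualFun φ c M i (Fin.last k, y j)).det := by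
  have h : (Matrix.of fun i j => dualFun φ c M i (Fin.last k, y j)) =
      (gram φ c M)⁻¹.transpose * Matrix.of fun i j => endFun φ M i (y j) := by
    ext i j
    simp [Matrix.mul_apply, dualFun, backFun, mul_comm]
  rw [h, Matrix.det_mul, Matrix.det_transpose, Matrix.det_nonsing_inv, Ring.inverse_eq_inv',
    mul_inv_cancel_left₀ hdet]

theorem exists_chainDensity_eq (hdet : (gram φ c M).det ≠ 0) :
    ∃ κ : ℝ, κ ≠ 0 ∧ ∀ z, chainDensity φ c M z =
      κ * (levelMatrix (fieldKernel φ c M) Prod.fst fun p => z p.1 p.2).det := by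
  obtain ⟨ε, hε, h⟩ := exists_sign_det_chainKernel (X := ℝ) k (k + 1)
  refine ⟨ε * (gram φ c M).det, mul_ne_zero hε hdet, fun z => ?_⟩
  have h1 := h (levelTrans c M) (dualFun φ c M) (startFun c M) (levelTrans_of_not_lt c M)
    (fun p => z p.1 p.2)
  rw [chainDensity, det_endFun hdet, fieldKernel]
  linear_combination (gram φ c M).det * h1

theorem xiRaw_eq (hc : c ∈ chamber (k + 1)) (hc0 : c 0 = -M) :
    xiRaw φ M c = (Measure.pi fun r => Measure.pi fun _ => levelMeasure c r).withDensity
      fun z => ENNReal.ofReal (chainDensity φ c M z) := by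
  rw [xiRaw, ← withDensity_indicator (measurableSet_admissible M c)]
  congr 1
  funext z
  rw [chainDensity_eq_indicator hc hc0]
  by_cases hz : z ∈ admissible M c
  · rw [indicator_of_mem hz, indicator_of_mem hz]
  · rw [indicator_of_notMem hz, indicator_of_notMem hz, ENNReal.ofReal_zero]

theorem ae_top {p : (Fin (k + 1) → ℝ) → Prop} (h : ∀ᵐ y, p y) :
    ∀ᵐ z ∂(Measure.pi fun r : Fin (k + 1) => Measure.pi fun _ : Fin (k + 1) => levelMeasure c r),
      p (z (Fin.last k)) := by
  refine (Measure.quasiMeasurePreserving_eval (μ := fun r : Fin (k + 1) =>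
    Measure.pi fun _ : Fin (k + 1) => levelMeasure c r) (Fin.last k)).ae ?_
  simp only [levelMeasure_last]
  exact h

/-- The sign of `κ` is not known beforehand. Only its product with the determinant is non-negative,
being the density itself, and this allows `ENNReal.ofReal` to pass through the integral. -/
theorem xiRaw_preimage (hM : 0 < M) (hc : c ∈ chamber (k + 1)) (hc0 : c 0 = -M)
    (hφ : ∀ i, Measurable (φ i)) (hφM : ∀ i, Integrable (endFun φ M i))
    (hnonneg : ∀ᵐ y : Fin (k + 1) → ℝ, y ∈ chamber (k + 1) → 0 ≤ phiDet φ y)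
    (hdet : (gram φ c M).det ≠ 0) {κ : ℝ} (hκ : ∀ z, chainDensity φ c M z =
      κ * (levelMatrix (fieldKernel φ c M) Prod.fst fun p => z p.1 p.2).det)
    {S : Set (Fin (k + 1) × Fin (k + 1) → ℝ)} (hS : MeasurableSet S) :
    0 ≤ κ * ∫ z in S, (levelMatrix (fieldKernel φ c M) Prod.fst z).det
      ∂(Measure.pi fun l : Fin (k + 1) × Fin (k + 1) => levelMeasure c l.1) ∧
    xiRaw φ M c ((fun z p => z p.1 p.2) ⁻¹' S) = ENNReal.ofReal
      (κ * ∫ z in S, (levelMatrix (fieldKernel φ c M) Prod.fst z).det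
        ∂(Measure.pi fun l : Fin (k + 1) × Fin (k + 1) => levelMeasure c l.1)) := by
  have hrep := isLevelwiseReproducing_fieldKernel hM hc hc0 hφ hφM hdet
  have hD := measurable_levelMatrix_det hrep.measurable (Prod.fst : Fin (k + 1) × Fin (k + 1) → _)
  have hDi := integrable_levelMatrix_det hrep (Prod.fst : Fin (k + 1) × Fin (k + 1) → _)
  have hmp := measurePreserving_uncurry (levelMeasure c) (k + 1)
  have hpos : ∀ᵐ z ∂(Measure.pi fun l : Fin (k + 1) × Fin (k + 1) => levelMeasure c l.1),
      0 ≤ κ * (levelMatrix (fieldKernel φ c M) Prod.fst z).det := by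
    rw [← hmp.map_eq, ae_map_iff hmp.measurable.aemeasurable
      (measurableSet_le measurable_const (hD.const_mul κ))]
    filter_upwards [ae_top (ae_sortedPhiDet_nonneg hnonneg)] with z hz
    rw [← hκ, chainDensity_eq_indicator hc hc0]
    exact indicator_apply_nonneg fun _ => hz
  rw [← integral_const_mul]
  refine ⟨integral_nonneg_of_ae (ae_restrict_of_ae hpos), ?_⟩
  rw [xiRaw_eq hc hc0, withDensity_apply _ (hmp.measurable hS),
    ofReal_integral_eq_lintegral_ofReal (hDi.const_mul κ).integrableOn (ae_restrict_of_ae hpos)]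
  simp only [hκ]
  exact hmp.setLIntegral_comp_preimage hS (f := fun z => ENNReal.ofReal
    (κ * (levelMatrix (fieldKernel φ c M) Prod.fst z).det)) (hD.const_mul κ).ennreal_ofReal

/-- The case of no fixed particle, where everything is integrated out. -/
theorem integral_levelMatrix_det {Q : Type*} [Fintype Q] [DecidableEq Q] [MeasurableSpace Q] {X : Type*}
    [MeasurableSpace X] {ν : Q → Measure X} [∀ q, SigmaFinite (ν q)] {N : ℕ}
    {K : Q × X → Q × X → ℝ} (h : IsLevelwiseReproducing ν N K) :
    ∫ z, (levelMatrix K Prod.fst z).det ∂(Measure.pi fun l : Q × Fin N => ν l.1) =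
      (N.factorial : ℝ) ^ Fintype.card Q := by
  have h1 := integral_levelMatrix_det_embedding h _ (zero_add _)
    (⟨fun i => i.elim0, fun i => i.elim0⟩ : Fin 0 ↪ Q × Fin N) univ .univ
  simpa [measureReal_def, Measure.pi_of_empty] using h1

/-- If `Bconst` vanished, the sorted determinant would vanish almost everywhere on the box that
contains the top level of every admissible configuration. -/
theorem Bconst_ne_zero_of_xiRaw (hc : c ∈ chamber (k + 1)) (hc0 : c 0 = -M)
    (hΦ : Integrable (Phi φ))
    (hnonneg : ∀ᵐ y : Fin (k + 1) → ℝ, y ∈ chamber (k + 1) → 0 ≤ phiDet φ y)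
    (h : xiRaw φ M c ≠ 0) : Bconst φ M ≠ 0 := by
  intro hB
  refine h ?_
  rw [xiRaw_eq hc hc0, ← withDensity_zero]
  refine withDensity_congr_ae ?_
  filter_upwards [ae_top (ae_sortedPhiDet_eq_zero_of_Bconst hΦ hnonneg hB)] with z hz
  rw [chainDensity_eq_indicator hc hc0]
  by_cases hza : z ∈ admissible M c
  · rw [indicator_of_mem hza]
    have h0 : sortedPhiDet φ (z (topLevel (k + 1))) = 0 :=
      hz ⟨fun j => (hza.1 j).1, fun j => (hza.1 j).2⟩
    rw [h0, ENNReal.ofReal_zero]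
    rfl
  · rw [indicator_of_notMem hza, ENNReal.ofReal_zero]
    rfl

theorem Zconst_ne_zero_iff : Zconst φ M c ≠ 0 ↔ xiRaw φ M c univ ≠ 0 := by
  have h : ((k + 1).factorial : ℝ≥0∞) ^ (k + 1) ≠ ∞ :=
    ENNReal.pow_ne_top (ENNReal.natCast_ne_top _)
  rw [Zconst, Ne, ENNReal.div_eq_zero_iff, not_or]
  exact and_iff_left h

theorem xi_eq : xi φ M c = (xiRaw φ M c univ)⁻¹ • xiRaw φ M c := by
  have h : ((k + 1).factorial : ℝ≥0∞) ^ (k + 1) ≠ ∞ :=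
    ENNReal.pow_ne_top (ENNReal.natCast_ne_top _)
  have h0 : ((k + 1).factorial : ℝ≥0∞) ^ (k + 1) ≠ 0 :=
    pow_ne_zero _ (Nat.cast_ne_zero.2 (Nat.factorial_ne_zero _))
  rw [xi, Zconst, ENNReal.mul_div_cancel h0 h]

theorem det_gram_ne_zero (hM : 0 < M) (hc : c ∈ chamber (k + 1)) (hc0 : c 0 = -M)
    (hφM : ∀ i, Integrable (endFun φ M i)) (hB : Bconst φ M ≠ 0) : (gram φ c M).det ≠ 0 := by
  obtain ⟨C, hC0, hC⟩ := exists_det_startFun hc hc0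
  rw [det_gram hM hc hc0 hφM hC]
  exact mul_ne_zero hC0 hB

/-- The determinant has the positive total integral `(k + 1)! ^ (k + 1)`; since the total mass is
non-negative, this fixes the sign of `κ`. -/
theorem exists_xiRaw_preimage (hM : 0 < M) (hc : c ∈ chamber (k + 1)) (hc0 : c 0 = -M)
    (hφ : ∀ i, Measurable (φ i)) (hφM : ∀ i, Integrable (endFun φ M i))
    (hnonneg : ∀ᵐ y : Fin (k + 1) → ℝ, y ∈ chamber (k + 1) → 0 ≤ phiDet φ y)
    (hdet : (gram φ c M).det ≠ 0) :
    ∃ κ : ℝ, 0 < κ ∧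
      xiRaw φ M c univ = ENNReal.ofReal (κ * ((k + 1).factorial : ℝ) ^ (k + 1)) ∧
      ∀ S : Set (Fin (k + 1) × Fin (k + 1) → ℝ), MeasurableSet S →
        0 ≤ κ * ∫ z in S, (levelMatrix (fieldKernel φ c M) Prod.fst z).det
          ∂(Measure.pi fun l : Fin (k + 1) × Fin (k + 1) => levelMeasure c l.1) ∧
        xiRaw φ M c ((fun z p => z p.1 p.2) ⁻¹' S) = ENNReal.ofReal
          (κ * ∫ z in S, (levelMatrix (fieldKernel φ c M) Prod.fst z).det
            ∂(Measure.pi fun l : Fin (k + 1) × Fin (k + 1) => levelMeasure c l.1)) := by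
  obtain ⟨κ, hκ0, hκ⟩ := exists_chainDensity_eq hdet
  have hrep := isLevelwiseReproducing_fieldKernel hM hc hc0 hφ hφM hdet
  have hpre := fun S hS => xiRaw_preimage hM hc hc0 hφ hφM hnonneg hdet hκ (S := S) hS
  obtain ⟨h1, h2⟩ := hpre univ .univ
  simp only [Measure.restrict_univ, integral_levelMatrix_det hrep, Fintype.card_fin] at h1 h2
  refine ⟨κ, lt_of_le_of_ne (nonneg_of_mul_nonneg_left h1 (by positivity)) hκ0.symm, h2, hpre⟩

theorem isDeterminantal_xi (hM : 0 < M) (hc : c ∈ chamber (k + 1)) (hc0 : c 0 = -M)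
    (hφ : ∀ i, Measurable (φ i)) (hφM : ∀ i, Integrable (endFun φ M i))
    (hnonneg : ∀ᵐ y : Fin (k + 1) → ℝ, y ∈ chamber (k + 1) → 0 ≤ phiDet φ y)
    (hdet : (gram φ c M).det ≠ 0) :
    IsDeterminantal (xi φ M c) particles (refMeasure c) (fieldKernel φ c M) := by
  obtain ⟨κ, hκ, huniv, hS⟩ := exists_xiRaw_preimage hM hc hc0 hφ hφM hnonneg hdet
  have hpos : 0 < κ * ((k + 1).factorial : ℝ) ^ (k + 1) := by positivity
  have hP : IsProbabilityMeasure (xi φ M c) := by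
    refine ⟨?_⟩
    rw [xi_eq, Measure.smul_apply, smul_eq_mul, huniv]
    exact ENNReal.inv_mul_cancel (ENNReal.ofReal_pos.2 hpos).ne' ENNReal.ofReal_ne_top
  refine isDeterminantal_of_density (Z := fun (z : Fin (k + 1) → Fin (k + 1) → ℝ) p => z p.1 p.2)
    (isLevelwiseReproducing_fieldKernel hM hc hc0 hφ hφM hdet)
    (fun m r x q hq => levelMatrix_chainKernel_det_eq_zero (levelTrans_of_not_lt c M) r x q
      (by rwa [Fintype.card_fin])) (by fun_prop) fun S hSm => ?_
  obtain ⟨hnn, hSS⟩ := hS S hSm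
  rw [xi_eq, Measure.smul_apply, smul_eq_mul, huniv, hSS, ENNReal.toReal_mul,
    ENNReal.toReal_inv, ENNReal.toReal_ofReal hpos.le, ENNReal.toReal_ofReal hnn, Fintype.card_fin]
  field_simp

end InterlacedField

theorem mainTheorem6 (n : ℕ) [NeZero n] (φ : Fin n → ℝ → ℝ)
    (hφ : ∀ k, Measurable (φ k))
    (hΦ : Integrable (Phi φ))
    (hnonneg : ∀ᵐ y : Fin n → ℝ, y ∈ chamber n → 0 ≤ phiDet φ y)
    (hne : ¬ ∀ᵐ y : Fin n → ℝ, y ∈ chamber n → phiDet φ y = 0) :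
    (∃ M₀ : ℝ, 0 < M₀ ∧ ∀ M ≥ M₀, ∀ c ∈ chamber n, c 0 = -M → Zconst φ M c ≠ 0) ∧
    ∀ M : ℝ, 0 < M → ∀ c ∈ chamber n, c 0 = -M → Zconst φ M c ≠ 0 →
      0 < Bconst φ M ∧
      ∃ J : Fin n × ℝ → Fin n × ℝ → ℝ,
        IsDeterminantal (xi φ M c) particles (refMeasure c) J ∧
        ∀ r s : Fin n, r.val + 1 < n → ∀ u ∈ Ioo (-M) M, ∀ v ∈ Ioo (-M) M,
          IntegrableOn (upperIntegrand φ r s u v) (symChamber n M) ∧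
          IntegrableOn (lowerIntegrand φ r s u v) (symChamber n M) ∧
          J (r, u) (s, v) =
            1 / Bconst φ M * (∫ z in symChamber n M, upperIntegrand φ r s u v z) -
            1 / Bconst φ M * (∫ z in symChamber n M, lowerIntegrand φ r s u v z) := by
  obtain ⟨k, rfl⟩ : ∃ k, n = k + 1 := Nat.exists_eq_succ_of_ne_zero (NeZero.ne n)
  -- The threshold comes from `Bconst`, which does not involve `c`; this is the uniformity in `c`.
  obtain ⟨M₀, hM₀, hB⟩ := exists_Bconst_ne_zero hΦ hnonneg hne
  have hφM := fun M => integrable_endFun hφ hΦ hne M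
  refine ⟨⟨M₀, hM₀, fun M hM c hc hc0 => ?_⟩, fun M hM c hc hc0 hZ => ?_⟩
  · have hM' := hM₀.trans_le hM
    obtain ⟨κ, hκ, huniv, -⟩ := exists_xiRaw_preimage hM' hc hc0 hφ (hφM M) hnonneg
      (det_gram_ne_zero hM' hc hc0 (hφM M) (hB M hM))
    refine Zconst_ne_zero_iff.2 ?_
    rw [huniv]
    exact (ENNReal.ofReal_pos.2 (by positivity)).ne'
  · have hB := Bconst_ne_zero_of_xiRaw hc hc0 hΦ hnonneg
      fun h => Zconst_ne_zero_iff.1 hZ (by rw [h]; rfl)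
    have hdet := det_gram_ne_zero hM hc hc0 (hφM M) hB
    refine ⟨lt_of_le_of_ne (Bconst_nonneg hΦ hnonneg M) hB.symm, fieldKernel φ c M,
      isDeterminantal_xi hM hc hc0 hφ (hφM M) hnonneg hdet, fun r s hr u hu v hv => ?_⟩
    exact fieldKernel_eq hM hc hc0 hΦ (hφM M) hB
      (fun h => by rw [h, Fin.val_last] at hr; exact lt_irrefl _ hr) s
      (Ioo_subset_Icc_self hu) (Ioo_subset_Icc_self hv)
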